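/- Let $V$ be a commutative ring and $\mathfrak m\subseteq V$ an ideal with $\mathfrak m^2=\mathfrak m$. A $V$-module is almost zero if it is killed by $\mathfrak m$; $V^a\text{-}\mathbf{Mod}$ is the quotient of $V\text{-}\mathbf{Mod}$ by the Serre subcategory of almost zero modules, $M\mapsto M^a$ is the localization functor, and a $V^a$-algebra is a commutative unital monoid in the tensor category $V^a\text{-}\mathbf{Mod}$. (Every $V^a$-algebra is of the form $A=R^a$ for a $V$-algebra $R$, and then $A\text{-}\mathbf{Mod}$ is the quotient of $R\text{-}\mathbf{Mod}$ by the almost zero modules.) For a $V^a$-algebra $A$, an $A$-module $M$ is almost finitely generated if for every finitely generated ideal $\mathfrak m_0\subseteq\mathfrak m$ there are $k\in\mathbb N$ and a morphism $A^k\to M$ whose cokernel is annihilated by $\mathfrak m_0$; it is almost projective if the functor $N\mapsto \mathrm{Hom}_A(M,N)^a$ is exact. Let $A\text{-}\mathbf{Mod}_{\mathrm{afpr}}$ be the full subcategory of $A\text{-}\mathbf{Mod}$ of the modules that are almost finitely generated and almost projective. An ideal $I\subseteq A$ is tight if $I^n\subseteq\mathfrak m_0A$ for some $n\in\mathbb N$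 and some finitely generated ideal $\mathfrak m_0\subseteq\mathfrak m$. Let $(A_n;\ \phi_n:A_{n+1}\to A_n\mid n\in\mathbb N)$ be a projective system of $V^a$-algebras such that, for every $n\in\mathbb N$, (a) $\phi_n$ is an epimorphism (of $V^a$-modules); (b) $\mathrm{Ker}\,\phi_n=\mathrm{Ker}(\phi_0\circ\cdots\circ\phi_n:A_{n+1}\to A_0)^{n+1}$. Let $A_\infty:=\varprojlim_n A_n$, and suppose that the ideal $I:=\mathrm{Ker}(A_\infty\to A_0)$ is tight. Then the functor $$A_\infty\text{-}\mathbf{Mod}_{\mathrm{afpr}}\longrightarrow \text{2-}\varprojlim_{n\in\mathbb N}A_n\text{-}\mathbf{Mod}_{\mathrm{afpr}},\qquad M\longmapsto (M\otimes_{A_\infty}A_n\mid n\in\mathbb N),$$ is an equivalence of categories. Here the transition functors of the system on the right are $N\mapsto A_n\otimes_{A_{n+1}}N$; an object of the 2-limit is a family of objects $M_n$ with isomorphisms $A_n\otimes_{A_{n+1}}M_{n+1}\cong M_n$, and a morphism is a family of morphisms $M_n\to M'_n$ compatible with these isomorphisms. -/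

import Mathlib

open CategoryTheory Limits

universe u v₁ u₁ v₂ u₂

noncomputable section

namespace AlmostRing

/-! ## Almost modules

A `V^a`-algebra is represented by a `V`-algebra `R`, of which it is the associated almost algebra
`A = R^a`; every `V^a`-algebra is of this form, with `R = A_*`. The category of `A`-modules is
the quotient of the category of `R`-modules by the Serre subcategory of almost zero modules. -/

/-- `(V, m)` is a basic setup: `m` is an ideal of `V` with `m ^ 2 = m`. -/
class BasicSetup {V : Type u} [CommRing V] (m : Ideal V) : Prop where
  mul_self : m * m = m

/-- The almost zero modules: those annihilated by `m`. -/
def almostZero {V : Type u} [CommRing V] (m : Ideal V) (R : Type u) [CommRing R] [Algebra V R] :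
    ObjectProperty (ModuleCat.{u} R) :=
  fun M ↦ ∀ ε ∈ m, ∀ x : M, algebraMap V R ε • x = 0

section

variable {V : Type u} [CommRing V] (m : Ideal V)

lemma ann_of_mul [BasicSetup m] {R : Type u} [CommRing R] [Algebra V R] {M : Type u}
    [AddCommGroup M] [Module R M] (N : Submodule R M) (x : M)
    (h : ∀ ε ∈ m, ∀ δ ∈ m, algebraMap V R ε • algebraMap V R δ • x ∈ N) :
    ∀ ε ∈ m, algebraMap V R ε • x ∈ N := by
  intro ε hε
  rw [← BasicSetup.mul_self (m := m)] at hε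
  induction hε using Submodule.mul_induction_on' with
  | mem_mul_mem a ha b hb => rw [map_mul, mul_smul]; exact h a ha b hb
  | add a _ b _ ha hb => rw [map_add, add_smul]; exact N.add_mem ha hb

instance [BasicSetup m] (R : Type u) [CommRing R] [Algebra V R] :
    (almostZero m R).IsSerreClass where
  exists_zero := ⟨ModuleCat.of R PUnit, ModuleCat.isZero_of_subsingleton _,
    fun _ _ _ ↦ Subsingleton.elim _ _⟩
  prop_of_mono {X Y} f hf hY := fun ε hε x ↦ by
    have hinj := (ModuleCat.mono_iff_injective f).1 hf
    apply hinj
    rw [map_smul, map_zero]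
    exact hY ε hε _
  prop_of_epi {X Y} f hf hX := fun ε hε y ↦ by
    obtain ⟨x, rfl⟩ := (ModuleCat.epi_iff_surjective f).1 hf y
    rw [← map_smul, hX ε hε x, map_zero]
  prop_X₂_of_shortExact {S} hS h₁ h₃ := fun ε hε x ↦ by
    refine (Submodule.mem_bot R).1 (ann_of_mul m (⊥ : Submodule R S.X₂) x ?_ ε hε)
    intro a ha b hb
    have h0 : S.g (algebraMap V R b • x) = 0 := by rw [map_smul]; exact h₃ b hb _
    obtain ⟨y, hy⟩ := (ShortComplex.ShortExact.moduleCat_exact_iff_function_exact S).1 hS.exact _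
      |>.1 h0
    rw [Submodule.mem_bot, ← hy, ← map_smul, h₁ a ha y, map_zero]


/-- The category of `A`-modules for the `V^a`-algebra `A = R^a`. -/
abbrev AlmostMod [BasicSetup m] (R : Type u) [CommRing R] [Algebra V R] :=
  (almostZero m R).isoModSerre.Localization

/-- The localization functor `M ↦ M^a` from `R`-modules to `R^a`-modules. -/
abbrev almostFunctor [BasicSetup m] (R : Type u) [CommRing R] [Algebra V R] :
    ModuleCat.{u} R ⥤ AlmostMod m R :=
  (almostZero m R).isoModSerre.Q

instance [BasicSetup m] (R : Type u) [CommRing R] [Algebra V R] :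
    HasCokernels (AlmostMod m R) :=
  ObjectProperty.SerreClassLocalization.hasCokernels (almostFunctor m R) (almostZero m R)

/-- An `A`-module `M` is almost finitely generated if for every finitely generated ideal
`m₀ ⊆ m` there are `k` and a morphism `A^k → M` whose cokernel is annihilated by `m₀`. -/
def IsAlmostFG [BasicSetup m] {R : Type u} [CommRing R] [Algebra V R] (M : AlmostMod m R) :
    Prop :=
  ∀ m₀ : Ideal V, m₀ ≤ m → m₀.FG →
    ∃ (k : ℕ) (h : (almostFunctor m R).obj (ModuleCat.of R (Fin k → R)) ⟶ M),
      ∀ ε ∈ m₀, algebraMap V R ε • 𝟙 (cokernel h) = 0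

/-- An `A`-module `M` is almost projective if the functor `alHom_A(M, -) = Hom_A(M, -)^a` is
exact, that is, if it maps epimorphisms to epimorphisms: the cokernel of
`Hom_A(M, X) → Hom_A(M, Y)` is annihilated by `m` for every epimorphism `X → Y`. -/
def IsAlmostProjective [BasicSetup m] {R : Type u} [CommRing R] [Algebra V R]
    (M : AlmostMod m R) : Prop :=
  ∀ ⦃X Y : AlmostMod m R⦄ (p : X ⟶ Y) [Epi p] (g : M ⟶ Y), ∀ ε ∈ m,
    ∃ h : M ⟶ X, h ≫ p = algebraMap V R ε • g

/-- The almost finitely generated projective `A`-modules. -/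
def afpr [BasicSetup m] (R : Type u) [CommRing R] [Algebra V R] :
    ObjectProperty (AlmostMod m R) :=
  fun M ↦ IsAlmostFG m M ∧ IsAlmostProjective m M

/-- The full subcategory of almost finitely generated projective `A`-modules. -/
abbrev AfprMod [BasicSetup m] (R : Type u) [CommRing R] [Algebra V R] :=
  (afpr m R).FullSubcategory

/-! ## Base change -/

lemma isoModSerre_iff_elem [BasicSetup m] {R : Type u} [CommRing R] [Algebra V R]
    {M N : ModuleCat.{u} R} (f : M ⟶ N) :
    (almostZero m R).isoModSerre f ↔
      (∀ x : M, f x = 0 → ∀ ε ∈ m, algebraMap V R ε • x = 0) ∧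
      (∀ y : N, ∀ ε ∈ m, ∃ x : M, f x = algebraMap V R ε • y) := by
  rw [ObjectProperty.isoModSerre_iff, ObjectProperty.monoModSerre_iff,
    ObjectProperty.epiModSerre_iff]
  rw [(almostZero m R).prop_iff_of_iso (ModuleCat.kernelIsoKer f),
    (almostZero m R).prop_iff_of_iso (ModuleCat.cokernelIsoRangeQuotient f)]
  refine and_congr ⟨fun h x hx ε hε ↦ ?_, fun h ε hε x ↦ ?_⟩ ⟨fun h y ε hε ↦ ?_, fun h ε hε y ↦ ?_⟩
  · have := h ε hε ⟨x, hx⟩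
    exact congrArg Subtype.val this
  · exact Subtype.ext (h x.1 x.2 ε hε)
  · have := h ε hε (Submodule.Quotient.mk y)
    exact (Submodule.Quotient.mk_eq_zero _).1 this
  · obtain ⟨y, rfl⟩ := Submodule.Quotient.mk_surjective _ y
    exact (Submodule.Quotient.mk_eq_zero _).2 (h y ε hε)

lemma exists_almost_inverse [BasicSetup m] {R : Type u} [CommRing R] [Algebra V R]
    {M N : ModuleCat.{u} R} (f : M ⟶ N) (hf : (almostZero m R).isoModSerre f)
    (ε δ : V) (hε : ε ∈ m) (hδ : δ ∈ m) :
    ∃ g : N ⟶ M, g ≫ f = (algebraMap V R ε * algebraMap V R δ) • 𝟙 N ∧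
      f ≫ g = (algebraMap V R ε * algebraMap V R δ) • 𝟙 M := by
  rw [isoModSerre_iff_elem] at hf
  obtain ⟨h₁, h₂⟩ := hf
  choose s hs using fun y ↦ h₂ y δ hδ
  have key : ∀ x x' : M, f x = f x' → algebraMap V R ε • x = algebraMap V R ε • x' := by
    intro x x' h
    rw [← sub_eq_zero, ← smul_sub]
    exact h₁ _ (by rw [map_sub, h, sub_self]) ε hε
  refine ⟨ModuleCat.ofHom
    { toFun := fun y ↦ algebraMap V R ε • s y
      map_add' := fun y z ↦ by
        rw [← smul_add]; apply key; rw [map_add, hs, hs, hs, smul_add]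
      map_smul' := fun r y ↦ by
        rw [RingHom.id_apply, smul_comm r, ]; apply key
        rw [map_smul, hs, hs, smul_comm] }, ?_, ?_⟩
  · ext y
    change f (algebraMap V R ε • s y) = (algebraMap V R ε * algebraMap V R δ) • y
    rw [map_smul, hs, mul_smul]
  · ext x
    change algebraMap V R ε • s (f x) = (algebraMap V R ε * algebraMap V R δ) • x
    rw [mul_smul]; apply key; rw [hs, map_smul]

section

variable {R S T : Type u} [CommRing R] [CommRing S] [CommRing T]
  [Algebra V R] [Algebra V S] [Algebra V T]

lemma extendScalars_map_smul (f : R →ₐ[V] S) {M N : ModuleCat.{u} R} (g : M ⟶ N) (a : V) :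
    (ModuleCat.extendScalars f.toRingHom).map (algebraMap V R a • g) =
      algebraMap V S a • (ModuleCat.extendScalars f.toRingHom).map g := by
  ext x
  let := f.toRingHom.toAlgebra
  have h := TensorProduct.smul_tmul (R := R) (algebraMap V R a) (1 : S) (g x)
  have e : algebraMap V R a • (1 : S) = algebraMap V S a * 1 :=
    (Algebra.smul_def _ _).trans (congrArg (· * (1 : S)) (f.commutes a))
  rw [e] at h
  exact h.symm

lemma extendScalars_map_mem [BasicSetup m] (f : R →ₐ[V] S) {M N : ModuleCat.{u} R} (g : M ⟶ N)
    (hg : (almostZero m R).isoModSerre g) :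
    (almostZero m S).isoModSerre ((ModuleCat.extendScalars f.toRingHom).map g) := by
  have key : ∀ ε ∈ m, ∀ δ ∈ m, ∃ h : (ModuleCat.extendScalars f.toRingHom).obj N ⟶
      (ModuleCat.extendScalars f.toRingHom).obj M,
      h ≫ (ModuleCat.extendScalars f.toRingHom).map g = (algebraMap V S (ε * δ)) • 𝟙 _ ∧
      (ModuleCat.extendScalars f.toRingHom).map g ≫ h = (algebraMap V S (ε * δ)) • 𝟙 _ := by
    intro ε hε δ hδ
    obtain ⟨h, h₁, h₂⟩ := exists_almost_inverse m g hg ε δ hε hδ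
    refine ⟨(ModuleCat.extendScalars f.toRingHom).map h, ?_, ?_⟩
    · rw [← Functor.map_comp, h₁, ← map_mul, extendScalars_map_smul, CategoryTheory.Functor.map_id]
    · rw [← Functor.map_comp, h₂, ← map_mul, extendScalars_map_smul, CategoryTheory.Functor.map_id]
  rw [isoModSerre_iff_elem]
  refine ⟨fun x hx ↦ ?_, fun y ↦ ?_⟩
  · simp only [← Submodule.mem_bot S]
    refine ann_of_mul m _ x fun ε hε δ hδ ↦ ?_
    obtain ⟨h, -, h₂⟩ := key ε hε δ hδ
    have := ConcreteCategory.congr_hom h₂ x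
    rw [ConcreteCategory.comp_apply, hx, map_zero] at this
    rw [Submodule.mem_bot, ← mul_smul, ← map_mul]
    exact this.symm
  · refine ann_of_mul m (LinearMap.range ((ModuleCat.extendScalars f.toRingHom).map g).hom) y
      fun ε hε δ hδ ↦ ?_
    obtain ⟨h, h₁, -⟩ := key ε hε δ hδ
    refine ⟨h y, ?_⟩
    have := ConcreteCategory.congr_hom h₁ y
    rw [← mul_smul, ← map_mul]
    exact this

variable [BasicSetup m]

lemma isInvertedBy_extendScalars (f : R →ₐ[V] S) :
    (almostZero m R).isoModSerre.IsInvertedBy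
      (ModuleCat.extendScalars.{u} f.toRingHom ⋙ almostFunctor m S) :=
  fun _ _ g hg ↦ Localization.inverts (almostFunctor m S) (almostZero m S).isoModSerre _
    (extendScalars_map_mem m f g hg)

/-- The base change functor `M ↦ S^a ⊗_{R^a} M` attached to a morphism `R^a → S^a`: it is induced
by the functor `M ↦ S ⊗_R M` from `R`-modules to `S`-modules. -/
def baseChange (f : R →ₐ[V] S) : AlmostMod m R ⥤ AlmostMod m S :=
  Localization.lift (ModuleCat.extendScalars.{u} f.toRingHom ⋙ almostFunctor m S)
    (isInvertedBy_extendScalars m f) (almostFunctor m R)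

/-- `S^a ⊗_{R^a} M^a = (S ⊗_R M)^a`. -/
def baseChangeFac (f : R →ₐ[V] S) :
    almostFunctor m R ⋙ baseChange m f ≅ ModuleCat.extendScalars.{u} f.toRingHom ⋙
      almostFunctor m S :=
  Localization.fac _ (isInvertedBy_extendScalars m f) (almostFunctor m R)

/-- The transitivity isomorphism `T^a ⊗_{S^a} (S^a ⊗_{R^a} M) ≅ T^a ⊗_{R^a} M`. -/
def baseChangeComp (f : R →ₐ[V] S) (g : S →ₐ[V] T) (h : R →ₐ[V] T) (hfg : g.comp f = h) :
    baseChange m f ⋙ baseChange m g ≅ baseChange m h :=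
  letI : Localization.Lifting (almostFunctor m R) (almostZero m R).isoModSerre
      ((ModuleCat.extendScalars.{u} f.toRingHom ⋙ ModuleCat.extendScalars.{u} g.toRingHom) ⋙
        almostFunctor m T) (baseChange m f ⋙ baseChange m g) :=
    ⟨(Functor.associator _ _ _).symm ≪≫ Functor.isoWhiskerRight (baseChangeFac m f) _ ≪≫
      Functor.associator _ _ _ ≪≫ Functor.isoWhiskerLeft _ (baseChangeFac m g) ≪≫
      (Functor.associator _ _ _).symm⟩
  letI : Localization.Lifting (almostFunctor m R) (almostZero m R).isoModSerre
      (ModuleCat.extendScalars.{u} h.toRingHom ⋙ almostFunctor m T) (baseChange m h) :=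
    ⟨baseChangeFac m h⟩
  Localization.liftNatIso (almostFunctor m R) (almostZero m R).isoModSerre
    ((ModuleCat.extendScalars.{u} f.toRingHom ⋙ ModuleCat.extendScalars.{u} g.toRingHom) ⋙
      almostFunctor m T)
    (ModuleCat.extendScalars.{u} h.toRingHom ⋙ almostFunctor m T) _ _
    (Functor.isoWhiskerRight ((ModuleCat.extendScalarsComp f.toRingHom g.toRingHom).symm ≪≫
      eqToIso (by subst hfg; rfl)) _)

lemma baseChange_map_smul (f : R →ₐ[V] S) {X Y : AlmostMod m R} (g : X ⟶ Y) (a : V) :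
    (baseChange m f).map (algebraMap V R a • g) = algebraMap V S a • (baseChange m f).map g := by
  have h₀ : ∀ M : ModuleCat.{u} R, (baseChange m f).map (algebraMap V R a •
      𝟙 ((almostFunctor m R).obj M)) = algebraMap V S a • 𝟙 _ := by
    intro M
    have h₁ : algebraMap V R a • 𝟙 ((almostFunctor m R).obj M) =
        (almostFunctor m R).map (algebraMap V R a • 𝟙 M) := by
      rw [Functor.map_smul, CategoryTheory.Functor.map_id]
    have h₂ := (baseChangeFac m f).hom.naturality (algebraMap V R a • 𝟙 M)
    rw [← cancel_mono ((baseChangeFac m f).hom.app M), h₁]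
    refine h₂.trans ?_
    rw [Functor.comp_map, extendScalars_map_smul, Functor.map_smul, CategoryTheory.Functor.map_id,
      CategoryTheory.Functor.map_id, Linear.comp_smul, Linear.smul_comp]
    erw [Category.id_comp, Category.comp_id]
  have := Localization.essSurj (almostFunctor m R) (almostZero m R).isoModSerre
  let e := (almostFunctor m R).objObjPreimageIso X
  have h₃ : algebraMap V R a • g =
      e.inv ≫ (algebraMap V R a • 𝟙 _) ≫ e.hom ≫ g := by
    rw [Linear.smul_comp, Linear.comp_smul, Category.id_comp, e.inv_hom_id_assoc]
  rw [h₃, Functor.map_comp, Functor.map_comp, h₀, Linear.smul_comp, Linear.comp_smul,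
    Category.id_comp, ← Functor.map_comp, e.inv_hom_id_assoc]

lemma restrictScalars_map_mem (f : R →ₐ[V] S) {M N : ModuleCat.{u} S} (g : M ⟶ N)
    (hg : (almostZero m S).isoModSerre g) :
    (almostZero m R).isoModSerre ((ModuleCat.restrictScalars.{u} f.toRingHom).map g) := by
  rw [isoModSerre_iff_elem] at hg ⊢
  refine ⟨fun x hx ε hε ↦ ?_, fun y ε hε ↦ ?_⟩
  · have := hg.1 x hx ε hε
    rw [← f.commutes] at this
    exact this
  · obtain ⟨x, hx⟩ := hg.2 y ε hε
    rw [← f.commutes] at hx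
    exact ⟨x, hx⟩

lemma isInvertedBy_restrictScalars (f : R →ₐ[V] S) :
    (almostZero m S).isoModSerre.IsInvertedBy
      (ModuleCat.restrictScalars.{u} f.toRingHom ⋙ almostFunctor m R) :=
  fun _ _ g hg ↦ Localization.inverts (almostFunctor m R) (almostZero m R).isoModSerre _
    (restrictScalars_map_mem m f g hg)

/-- Restriction of scalars along `R^a → S^a`. -/
def restriction (f : R →ₐ[V] S) : AlmostMod m S ⥤ AlmostMod m R :=
  Localization.lift (ModuleCat.restrictScalars.{u} f.toRingHom ⋙ almostFunctor m R)
    (isInvertedBy_restrictScalars m f) (almostFunctor m S)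

/-- Restriction of scalars commutes with `M ↦ M^a`. -/
def restrictionFac (f : R →ₐ[V] S) :
    almostFunctor m S ⋙ restriction m f ≅ ModuleCat.restrictScalars.{u} f.toRingHom ⋙
      almostFunctor m R :=
  Localization.fac _ (isInvertedBy_restrictScalars m f) (almostFunctor m S)

/-- Base change is left adjoint to restriction of scalars. -/
def baseChangeAdj (f : R →ₐ[V] S) : baseChange m f ⊣ restriction m f :=
  letI : CatCommSq (ModuleCat.extendScalars.{u} f.toRingHom) (almostFunctor m R)
      (almostFunctor m S) (baseChange m f) := ⟨(baseChangeFac m f).symm⟩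
  letI : CatCommSq (ModuleCat.restrictScalars.{u} f.toRingHom) (almostFunctor m S)
      (almostFunctor m R) (restriction m f) := ⟨(restrictionFac m f).symm⟩
  (ModuleCat.extendRestrictScalarsAdj.{u} f.toRingHom).localization (almostFunctor m R)
    (almostZero m R).isoModSerre (almostFunctor m S) (almostZero m S).isoModSerre
    (baseChange m f) (restriction m f)

lemma epi_restriction (f : R →ₐ[V] S) {X Y : AlmostMod m S} (p : X ⟶ Y) [hp : Epi p] :
    Epi ((restriction m f).map p) := by
  rw [ObjectProperty.SerreClassLocalization.epi_iff (almostFunctor m S) (almostZero m S)] at hp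
  obtain ⟨M, N, q, hq, ⟨e⟩⟩ := hp
  have := ObjectProperty.SerreClassLocalization.preservesEpimorphisms
    (almostFunctor m R) (almostZero m R)
  have hq' : Epi ((ModuleCat.restrictScalars.{u} f.toRingHom).map q) := by
    rw [ModuleCat.epi_iff_surjective] at hq ⊢
    exact hq
  have h₁ : Epi ((ModuleCat.restrictScalars.{u} f.toRingHom ⋙ almostFunctor m R).map q) :=
    inferInstanceAs (Epi ((almostFunctor m R).map _))
  have h₂ : Epi ((almostFunctor m S ⋙ restriction m f).map q) := by
    refine ((MorphismProperty.epimorphisms _).arrow_mk_iso_iff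
      (Arrow.isoMk ((restrictionFac m f).app M) ((restrictionFac m f).app N) ?_)).2 h₁
    exact ((restrictionFac m f).hom.naturality q).symm
  exact ((MorphismProperty.epimorphisms _).arrow_mk_iso_iff
    ((restriction m f).mapArrow.mapIso e)).1 h₂

lemma isAlmostProjective_baseChange (f : R →ₐ[V] S) {M : AlmostMod m R}
    (hM : IsAlmostProjective m M) : IsAlmostProjective m ((baseChange m f).obj M) := by
  intro X Y p _ g ε hε
  have := epi_restriction m f p
  obtain ⟨h, hh⟩ := hM ((restriction m f).map p) ((baseChangeAdj m f).homEquiv _ _ g) ε hε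
  refine ⟨((baseChangeAdj m f).homEquiv _ _).symm h, ?_⟩
  rw [← Adjunction.homEquiv_naturality_right_symm, hh]
  have : algebraMap V R ε • (baseChangeAdj m f).homEquiv _ _ g =
      (algebraMap V R ε • 𝟙 M) ≫ (baseChangeAdj m f).homEquiv _ _ g := by
    rw [Linear.smul_comp, Category.id_comp]
  rw [this, Adjunction.homEquiv_naturality_left_symm, Equiv.symm_apply_apply,
    baseChange_map_smul, CategoryTheory.Functor.map_id, Linear.smul_comp, Category.id_comp]

lemma homEquiv_zero (f : R →ₐ[V] S) (X : AlmostMod m R) (Y : AlmostMod m S) :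
    (baseChangeAdj m f).homEquiv X Y 0 = 0 := by
  have h : (baseChange m f).map (0 : X ⟶ X) = 0 := by
    have := baseChange_map_smul m f (0 : X ⟶ X) 0
    rwa [map_zero, map_zero, zero_smul, zero_smul] at this
  have h' := (baseChangeAdj m f).homEquiv_naturality_left (0 : X ⟶ X)
    (0 : (baseChange m f).obj X ⟶ Y)
  rw [h, zero_comp, zero_comp] at h'
  exact h'

/-- The extension of scalars of the standard free module is the standard free module. -/
def extendScalarsFree (f : R →+* S) (k : ℕ) :
    (ModuleCat.extendScalars.{u} f).obj (ModuleCat.of R (Fin k → R)) ≅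
      ModuleCat.of S (Fin k → S) :=
  letI := f.toAlgebra
  (TensorProduct.piScalarRight R S S (Fin k)).toModuleIso

lemma isAlmostFG_baseChange (f : R →ₐ[V] S) {M : AlmostMod m R}
    (hM : IsAlmostFG m M) : IsAlmostFG m ((baseChange m f).obj M) := by
  intro m₀ h₀ hfg
  obtain ⟨k, h, hh⟩ := hM m₀ h₀ hfg
  let e : (almostFunctor m S).obj (ModuleCat.of S (Fin k → S)) ≅
      (baseChange m f).obj ((almostFunctor m R).obj (ModuleCat.of R (Fin k → R))) :=
    (almostFunctor m S).mapIso (extendScalarsFree f.toRingHom k).symm ≪≫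
      ((baseChangeFac m f).app _).symm
  refine ⟨k, e.hom ≫ (baseChange m f).map h, fun ε hε ↦ ?_⟩
  have hz : (baseChange m f).map h ≫ cokernel.π (e.hom ≫ (baseChange m f).map h) = 0 := by
    rw [← cancel_epi e.hom, comp_zero, ← Category.assoc, cokernel.condition]
  rw [← cancel_epi (cokernel.π (e.hom ≫ (baseChange m f).map h)), Linear.comp_smul,
    Category.comp_id, comp_zero]
  generalize cokernel.π (e.hom ≫ (baseChange m f).map h) = q at hz
  generalize cokernel (e.hom ≫ (baseChange m f).map h) = Z at q hz
  have hz' : h ≫ (baseChangeAdj m f).homEquiv _ _ q = 0 := by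
    rw [← Adjunction.homEquiv_naturality_left, hz, homEquiv_zero]
  have hq : algebraMap V S ε • q = ((baseChangeAdj m f).homEquiv _ _).symm
      (algebraMap V R ε • ((baseChangeAdj m f).homEquiv _ _ q)) := by
    have : algebraMap V R ε • (baseChangeAdj m f).homEquiv _ _ q =
        (algebraMap V R ε • 𝟙 M) ≫ (baseChangeAdj m f).homEquiv _ _ q := by
      rw [Linear.smul_comp, Category.id_comp]
    rw [this, Adjunction.homEquiv_naturality_left_symm, Equiv.symm_apply_apply,
      baseChange_map_smul, CategoryTheory.Functor.map_id, Linear.smul_comp, Category.id_comp]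
  have hd : algebraMap V R ε • (baseChangeAdj m f).homEquiv _ _ q = 0 := by
    rw [← cokernel.π_desc h _ hz', ← Category.id_comp (cokernel.desc h _ hz'),
      ← Linear.comp_smul, ← Linear.smul_comp, hh ε hε, zero_comp, comp_zero]
  rw [hq, hd, ← homEquiv_zero m f, Equiv.symm_apply_apply]

lemma afpr_baseChange (f : R →ₐ[V] S) (M : AlmostMod m R) (hM : afpr m R M) :
    afpr m S ((baseChange m f).obj M) :=
  ⟨isAlmostFG_baseChange m f hM.1, isAlmostProjective_baseChange m f hM.2⟩

/-- Base change of almost finitely generated projective modules. -/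
def afprBaseChange (f : R →ₐ[V] S) : AfprMod m R ⥤ AfprMod m S :=
  (afpr m S).lift ((afpr m R).ι ⋙ baseChange m f) fun M ↦ afpr_baseChange m f M.obj M.property

/-- Transitivity of base change for almost finitely generated projective modules. -/
def afprBaseChangeComp (f : R →ₐ[V] S) (g : S →ₐ[V] T) (h : R →ₐ[V] T) (hfg : g.comp f = h) :
    afprBaseChange m f ⋙ afprBaseChange m g ≅ afprBaseChange m h :=
  NatIso.ofComponents
    (fun M ↦ (afpr m T).isoMk ((baseChangeComp m f g h hfg).app M.obj))
    (fun {M N} φ ↦ by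
      ext
      exact (baseChangeComp m f g h hfg).hom.naturality φ.hom)

end

end

/-! ## The 2-limit of an inverse system of categories -/

/-- Objects of the 2-limit of a system of categories and functors
`⋯ ⥤ C (n + 1) ⥤ C n ⥤ ⋯ ⥤ C 0`: families of objects `obj n` of `C n` with isomorphisms
`F n (obj (n + 1)) ≅ obj n`. -/
structure TwoLimit {C : ℕ → Type u₁} [∀ n, Category.{v₁} (C n)] (F : ∀ n, C (n + 1) ⥤ C n) where
  obj : ∀ n, C n
  iso : ∀ n, (F n).obj (obj (n + 1)) ≅ obj n

namespace TwoLimit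

/-- Morphisms of the 2-limit: families of morphisms compatible with the structure isomorphisms. -/
@[ext]
structure Hom {C : ℕ → Type u₁} [∀ n, Category.{v₁} (C n)] {F : ∀ n, C (n + 1) ⥤ C n}
    (X Y : TwoLimit F) where
  app : ∀ n, X.obj n ⟶ Y.obj n
  comm : ∀ n, (F n).map (app (n + 1)) ≫ (Y.iso n).hom = (X.iso n).hom ≫ app n

instance {C : ℕ → Type u₁} [∀ n, Category.{v₁} (C n)] (F : ∀ n, C (n + 1) ⥤ C n) :
    Category (TwoLimit F) where
  Hom := Hom
  id X := ⟨fun _ ↦ 𝟙 _, fun n ↦ by simp⟩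
  comp f g := ⟨fun n ↦ f.app n ≫ g.app n, fun n ↦ by
    rw [Functor.map_comp, Category.assoc, g.comm, ← Category.assoc, f.comm, Category.assoc]⟩
  id_comp f := by apply Hom.ext; funext n; exact Category.id_comp _
  comp_id f := by apply Hom.ext; funext n; exact Category.comp_id _
  assoc f g h := by apply Hom.ext; funext n; exact Category.assoc _ _ _

/-- The functor to the 2-limit given by a compatible family of functors `G n : D ⥤ C n`. -/
def lift {C : ℕ → Type u₁} [∀ n, Category.{v₁} (C n)] (F : ∀ n, C (n + 1) ⥤ C n)
    {D : Type u₂} [Category.{v₂} D] (G : ∀ n, D ⥤ C n) (α : ∀ n, G (n + 1) ⋙ F n ≅ G n) :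
    D ⥤ TwoLimit F where
  obj M := ⟨fun n ↦ (G n).obj M, fun n ↦ (α n).app M⟩
  map f := ⟨fun n ↦ (G n).map f, fun n ↦ (α n).hom.naturality f⟩
  map_id M := by apply Hom.ext; funext n; exact (G n).map_id M
  map_comp f g := by apply Hom.ext; funext n; exact (G n).map_comp f g

end TwoLimit

/-! ## Inverse systems of almost algebras -/

section

variable {V : Type u} [CommRing V] (m : Ideal V)
  {R : ℕ → Type u} [∀ n, CommRing (R n)] [∀ n, Algebra V (R n)]

/-- The inverse limit of a system of `V`-algebras. The functor `(-)^a` preserves limits, so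
that `(limitAlgebra φ)^a` is the inverse limit of the system of `V^a`-algebras `(R n)^a`. -/
def limitAlgebra (φ : ∀ n, R (n + 1) →ₐ[V] R n) : Subalgebra V (∀ n, R n) where
  carrier := {x | ∀ n, φ n (x (n + 1)) = x n}
  mul_mem' hx hy n := by rw [Pi.mul_apply, map_mul, hx, hy]; rfl
  add_mem' hx hy n := by rw [Pi.add_apply, map_add, hx, hy]; rfl
  algebraMap_mem' r n := (φ n).commutes r

/-- The projection `lim R → R n`. -/
def limitProj (φ : ∀ n, R (n + 1) →ₐ[V] R n) (n : ℕ) : limitAlgebra φ →ₐ[V] R n :=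
  (Pi.evalAlgHom V R n).comp (limitAlgebra φ).val

/-- The composition `φ 0 ∘ ⋯ ∘ φ (n - 1) : R n → R 0`. -/
def toZero (φ : ∀ n, R (n + 1) →ₐ[V] R n) : ∀ n, R n →ₐ[V] R 0
  | 0 => AlgHom.id V (R 0)
  | n + 1 => (toZero φ n).comp (φ n)

/-- `f^a : A^a → B^a` is an epimorphism (of `V^a`-modules): the cokernel of `f` is almost zero. -/
def IsAlmostEpi {A B : Type u} [CommRing A] [CommRing B] [Algebra V A] [Algebra V B]
    (f : A →ₐ[V] B) : Prop :=
  ∀ ε ∈ m, ∀ b : B, ∃ a : A, f a = algebraMap V B ε * b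

/-- `I^a ⊆ J^a` for ideals `I`, `J` of a `V`-algebra `A`, that is, `m I ⊆ J`. -/
def AlmostLE {A : Type u} [CommRing A] [Algebra V A] (I J : Ideal A) : Prop :=
  ∀ ε ∈ m, ∀ x ∈ I, algebraMap V A ε * x ∈ J

/-- The ideal `I^a` of `A^a` is tight: `(I^a)^n ⊆ m₀ A^a` for some natural number `n` and some
finitely generated ideal `m₀ ⊆ m`. -/
def IsTight {A : Type u} [CommRing A] [Algebra V A] (I : Ideal A) : Prop :=
  ∃ m₀ : Ideal V, m₀ ≤ m ∧ m₀.FG ∧ ∃ n : ℕ, AlmostLE m (I ^ n) (m₀.map (algebraMap V A))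

/-- The functor `M ↦ (A_n ⊗ M)_n` from almost finitely generated projective modules over the
limit `A_∞` to the 2-limit of the categories of almost finitely generated projective
`A_n`-modules. -/
def afprToTwoLimit [BasicSetup m] (φ : ∀ n, R (n + 1) →ₐ[V] R n) :
    AfprMod m (limitAlgebra φ) ⥤ TwoLimit (C := fun n ↦ AfprMod m (R n)) (fun n ↦ afprBaseChange m (φ n)) :=
  TwoLimit.lift _ (fun n ↦ afprBaseChange m (limitProj φ n))
    (fun n ↦ afprBaseChangeComp m (limitProj φ (n + 1)) (φ n) (limitProj φ n)
      (AlgHom.ext fun x ↦ x.2 n))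

end

end AlmostRing

end

/-! Full faithfulness rests on almost dual bases. If `N` is almost finitely generated projective
over `A_∞`, then suitable multiples of its identity factor through finite free modules. A finite
free module is the limit of its reductions, so `N` is almost isomorphic to `lim (R n ⊗ N)`
(`isoModSerre_toCompletion`), and a morphism into `N` amounts to a compatible family of morphisms of
reductions.

For essential surjectivity, take the limit `L` of a compatible system `M n` and construct almost
dual bases for `L`. With `I = Ker (A_∞ → A_0)`, condition (b) says that the kernel of `M (n + 1) → M
n` is almost inside `I ^ (n + 1) M (n + 1)`. Tightness enters twice. First, a Nakayama argument
shows that finitely many elements of `L` almost generate every `M n`, with a loss that does not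
depend on `n` (`exists_uniform_generators`). Second, almost projectivity gives almost sections `M n
→ (A_∞ / K n)^k`, where `K n = Ker (A_∞ → A_n)`; these are not compatible as `n` varies, and their
defects take values in relations between the generators. Because `J I ^ N ≤ J₀`, relations in degree
`N + n` almost lift one degree further modulo `K n`. The maps into relations, multiplied by the
idempotent ideal, therefore form a tower with surjective transition maps, and the defects can be
corrected step by step in the manner of Mittag-Leffler (`exists_compatible_sections`). Completeness
of `A_∞` then yields sections `L → A_∞^k`. They show that `L` is almost finitely generated
projective and that `R n ⊗ L → M n` is an almost isomorphism.

The passage between the quotient category and honest modules uses firm modules: `J ⊗ J ⊗ M` is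
almost isomorphic to `M`, and morphisms out of it in the quotient category are morphisms of modules
(`IsFirm.map_bijective`). Every object and every structure isomorphism of a system can thus be
represented by modules and linear maps. Losses of finitely many factors from `m` are absorbed
throughout by `m * m = m`. -/

noncomputable section

namespace AlmostRing

/-! ## Idempotent ideals and firm modules -/

section Firm

open TensorProduct

variable {R : Type*} [CommRing R] (J : Ideal R)

/-- The multiplication map `J ⊗ M → M`. -/
def idealMul (M : Type*) [AddCommGroup M] [Module R M] : J ⊗[R] M →ₗ[R] M :=
  TensorProduct.lift ((LinearMap.lsmul R M).domRestrict J)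

@[simp]
lemma idealMul_tmul (M : Type*) [AddCommGroup M] [Module R M] (a : J) (x : M) :
    idealMul J M (a ⊗ₜ x) = (a : R) • x := rfl

lemma idealMul_naturality {M N : Type*} [AddCommGroup M] [Module R M] [AddCommGroup N]
    [Module R N] (g : M →ₗ[R] N) (t : J ⊗[R] M) :
    g (idealMul J M t) = idealMul J N (g.lTensor J t) := by
  induction t with
  | zero => simp
  | tmul a x => simp
  | add a b ha hb => simp only [map_add, ha, hb]

variable {J}

/-- A property which is linear in an element of an idempotent ideal may be checked on products. -/
lemma smul_mem_of_idempotent (hJ : J * J = J) {M : Type*} [AddCommGroup M] [Module R M]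
    (N : Submodule R M) (x : M) (h : ∀ a ∈ J, ∀ b ∈ J, (a * b) • x ∈ N) :
    ∀ a ∈ J, a • x ∈ N := by
  intro a ha
  rw [← hJ] at ha
  induction ha using Submodule.mul_induction_on' with
  | mem_mul_mem a ha b hb => exact h a ha b hb
  | add a _ b _ ha hb => rw [add_smul]; exact N.add_mem ha hb

/-- By right exactness the kernel of `J ⊗ g` comes from `J ⊗ ker g`, which vanishes there: for `c`,
`d` in `J` and `x` in the kernel, `cd ⊗ x = c ⊗ dx = 0`, and such products span `J`. -/
lemma lTensor_bijective_of_idempotent (hJ : J * J = J) {M N : Type*} [AddCommGroup M]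
    [Module R M] [AddCommGroup N] [Module R N] (g : M →ₗ[R] N) (hg : Function.Surjective g)
    (hk : ∀ x, g x = 0 → ∀ a ∈ J, a • x = 0) : Function.Bijective (g.lTensor J) := by
  refine ⟨?_, LinearMap.lTensor_surjective J hg⟩
  rw [← LinearMap.ker_eq_bot, LinearMap.ker_eq_bot']
  intro t ht
  have hex : Function.Exact (LinearMap.ker g).subtype g := LinearMap.exact_subtype_ker_map g
  obtain ⟨s, rfl⟩ := (lTensor_exact J hex hg t).1 ht
  clear ht
  induction s with
  | zero => simp
  | add a b ha hb => rw [map_add, ha, hb, add_zero]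
  | tmul a x =>
    obtain ⟨a, ha⟩ := a
    rw [LinearMap.lTensor_tmul, Submodule.subtype_apply]
    have key : ∀ b ∈ J, ∀ hb : b ∈ J, (⟨b, hb⟩ : J) ⊗ₜ[R] (x : M) = 0 := by
      intro b hb
      rw [← hJ] at hb
      induction hb using Submodule.mul_induction_on' with
      | mem_mul_mem c hc d hd =>
        intro hb
        have : (⟨c * d, hb⟩ : J) = d • ⟨c, hc⟩ := Subtype.ext (mul_comm c d)
        rw [this, TensorProduct.smul_tmul, hk x x.2 d hd, tmul_zero]
      | add c hc d hd h₁ h₂ =>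
        intro hb
        have hc' : c ∈ J := hJ ▸ hc
        have hd' : d ∈ J := hJ ▸ hd
        have : (⟨c + d, hb⟩ : J) = ⟨c, hc'⟩ + ⟨d, hd'⟩ := rfl
        rw [this, add_tmul, h₁ hc', h₂ hd', add_zero]
    exact key a ha ha

lemma idealMul_self_surjective (hJ : J * J = J) : Function.Surjective (idealMul J J) := by
  rintro ⟨a, ha⟩
  have key : ∀ b ∈ J, ∃ t : J ⊗[R] J, (idealMul J J t : R) = b := by
    intro b hb
    rw [← hJ] at hb
    induction hb using Submodule.mul_induction_on' with
    | mem_mul_mem c hc d hd => exact ⟨⟨c, hc⟩ ⊗ₜ ⟨d, hd⟩, rfl⟩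
    | add c hc d hd h₁ h₂ =>
      obtain ⟨s, hs⟩ := h₁
      obtain ⟨t, ht⟩ := h₂
      exact ⟨s + t, by rw [map_add, Submodule.coe_add, hs, ht]⟩
  obtain ⟨t, ht⟩ := key a ha
  exact ⟨t, Subtype.ext ht⟩

/-- This identity shows that the kernel of `J ⊗ J → J` is killed by `J`. -/
lemma smul_eq_tmul_idealMul (a : J) (t : J ⊗[R] J) :
    (a : R) • t = a ⊗ₜ[R] idealMul J J t := by
  induction t with
  | zero => simp
  | add s t hs ht => rw [smul_add, hs, ht, map_add, tmul_add]
  | tmul b c =>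
    have : (a : R) • b = (b : R) • a := Subtype.ext (mul_comm (a : R) b)
    rw [idealMul_tmul, smul_tmul', this, TensorProduct.smul_tmul]

/-- The multiplication `J ⊗ (J ⊗ J) → J ⊗ J` coincides with `J ⊗ μ` for `μ : J ⊗ J → J`, which is
surjective with kernel killed by `J`. Two tensor factors of `J` therefore suffice for firmness. -/
lemma idealMul_tensor_self_bijective (hJ : J * J = J) :
    Function.Bijective (idealMul J (J ⊗[R] J)) := by
  have h : idealMul J (J ⊗[R] J) = (idealMul J J).lTensor J := by
    ext a b c
    exact smul_eq_tmul_idealMul a (b ⊗ₜ c)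
  rw [h]
  refine lTensor_bijective_of_idempotent hJ _ (idealMul_self_surjective hJ) fun x hx a ha ↦ ?_
  have := smul_eq_tmul_idealMul ⟨a, ha⟩ x
  rwa [hx, tmul_zero] at this

variable (J) in
/-- The firm module `J ⊗ J ⊗ M` attached to a module `M`. -/
abbrev FirmTensor (M : Type*) [AddCommGroup M] [Module R M] := (J ⊗[R] J) ⊗[R] M

lemma idealMul_firmTensor_bijective (hJ : J * J = J) (M : Type*) [AddCommGroup M] [Module R M] :
    Function.Bijective (idealMul J (FirmTensor J M)) := by
  let e := LinearEquiv.ofBijective _ (idealMul_tensor_self_bijective hJ)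
  have h : idealMul J (FirmTensor J M) =
      ((TensorProduct.assoc R J (J ⊗[R] J) M).symm ≪≫ₗ e.rTensor M).toLinearMap := by
    ext a b c x
    rfl
  rw [h]
  exact LinearEquiv.bijective _

variable (J) in
/-- The natural map `J ⊗ J ⊗ M → M`. -/
def firmTensorTo (M : Type*) [AddCommGroup M] [Module R M] : FirmTensor J M →ₗ[R] M :=
  TensorProduct.lift ((LinearMap.lsmul R M).comp (J.subtype.comp (idealMul J J)))

@[simp]
lemma firmTensorTo_tmul (M : Type*) [AddCommGroup M] [Module R M] (t : J ⊗[R] J) (x : M) :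
    firmTensorTo J M (t ⊗ₜ x) = (idealMul J J t : R) • x := rfl

lemma mul_smul_eq_idealMul_smul (a b : J) (t : J ⊗[R] J) :
    ((a : R) * b) • t = (idealMul J J t : R) • (a ⊗ₜ[R] b) := by
  generalize hc : idealMul J J t = c
  have h₁ : (a : R) • b = (b : R) • a := Subtype.ext (mul_comm (a : R) b)
  have h₂ : (b : R) • c = (c : R) • b := Subtype.ext (mul_comm (b : R) c)
  rw [mul_smul, smul_eq_tmul_idealMul b t, hc, smul_tmul', h₁, TensorProduct.smul_tmul, h₂,
    tmul_smul]

/-- Multiplication by `ab` on `J ⊗ J ⊗ M` factors through `M`. Hence the kernel of `firmTensorTo` is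
killed by `J * J`, and multiples of a tensor can be computed from its image in `M`. -/
lemma mul_smul_eq_firmTensorTo {M : Type*} [AddCommGroup M] [Module R M] (a b : J)
    (t : FirmTensor J M) :
    ((a : R) * b) • t = (a ⊗ₜ[R] b) ⊗ₜ[R] firmTensorTo J M t := by
  induction t using TensorProduct.induction_on with
  | zero => simp
  | add s t hs ht => rw [smul_add, hs, ht, map_add, tmul_add]
  | tmul s x =>
    rw [firmTensorTo_tmul, smul_tmul', mul_smul_eq_idealMul_smul, TensorProduct.smul_tmul]

/-- A lift of `f` is a section of the projection `π` from the fibre product of `F` and `X` over `Y`.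
Since `F = JF` and `J Y` lies in the image of `s`, `π` is surjective; its kernel is killed by `J`.
So `J ⊗ π` is bijective, and the section is `F ≅ J ⊗ F ≅ J ⊗ P → P`. -/
lemma exists_lift_of_idealMul_bijective (hJ : J * J = J) {F X Y : Type*} [AddCommGroup F]
    [Module R F] [AddCommGroup X] [Module R X] [AddCommGroup Y] [Module R Y]
    (hF : Function.Bijective (idealMul J F)) (s : X →ₗ[R] Y)
    (hs₁ : ∀ x, s x = 0 → ∀ a ∈ J, a • x = 0) (hs₂ : ∀ y, ∀ a ∈ J, ∃ x, s x = a • y)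
    (f : F →ₗ[R] Y) : ∃ g : F →ₗ[R] X, s ∘ₗ g = f := by
  let P := LinearMap.eqLocus (f ∘ₗ LinearMap.fst R F X) (s ∘ₗ LinearMap.snd R F X)
  let π : P →ₗ[R] F := LinearMap.fst R F X ∘ₗ P.subtype
  have hπ : Function.Surjective π := by
    intro t
    obtain ⟨w, rfl⟩ := hF.2 t
    induction w with
    | zero => exact ⟨0, by simp⟩
    | add a b ha hb =>
      obtain ⟨x, hx⟩ := ha
      obtain ⟨y, hy⟩ := hb
      exact ⟨x + y, by rw [map_add, map_add, hx, hy]⟩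
    | tmul a t =>
      obtain ⟨x, hx⟩ := hs₂ (f t) a a.2
      exact ⟨⟨((a : R) • t, x), by simp [P, hx]⟩, rfl⟩
  have hk : ∀ p, π p = 0 → ∀ a ∈ J, a • p = 0 := by
    rintro ⟨⟨t, x⟩, h⟩ hp a ha
    obtain rfl : t = 0 := hp
    have h' : f 0 = s x := h
    rw [map_zero] at h'
    refine Subtype.ext (Prod.ext (smul_zero a) (hs₁ x h'.symm a ha))
  let e₁ := LinearEquiv.ofBijective _ hF
  let e₂ := LinearEquiv.ofBijective _ (lTensor_bijective_of_idempotent hJ π hπ hk)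
  let σ : F →ₗ[R] P := idealMul J P ∘ₗ e₂.symm.toLinearMap ∘ₗ e₁.symm.toLinearMap
  have hσ : ∀ t, π (σ t) = t := by
    intro t
    change π (idealMul J P (e₂.symm (e₁.symm t))) = t
    rw [idealMul_naturality]
    change idealMul J F (e₂ (e₂.symm (e₁.symm t))) = t
    rw [LinearEquiv.apply_symm_apply]
    exact e₁.apply_symm_apply t
  refine ⟨LinearMap.snd R F X ∘ₗ P.subtype ∘ₗ σ, LinearMap.ext fun t ↦ ?_⟩
  have h : f (π (σ t)) = s (σ t).1.2 := (σ t).2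
  rw [hσ] at h
  exact h.symm

/-- The difference `f - g` lands in the kernel of `s`, which `J` kills, while `F = JF`. -/
lemma eq_of_comp_eq_of_idealMul_surjective {F X Y : Type*} [AddCommGroup F]
    [Module R F] [AddCommGroup X] [Module R X] [AddCommGroup Y] [Module R Y]
    (hF : Function.Surjective (idealMul J F)) (s : X →ₗ[R] Y)
    (hs : ∀ x, s x = 0 → ∀ a ∈ J, a • x = 0) (f g : F →ₗ[R] X) (h : s ∘ₗ f = s ∘ₗ g) :
    f = g := by
  ext t
  obtain ⟨w, rfl⟩ := hF t
  induction w with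
  | zero => simp
  | add a b ha hb => rw [map_add, map_add, map_add, ha, hb]
  | tmul a t =>
    rw [idealMul_tmul, map_smul, map_smul, ← sub_eq_zero, ← smul_sub]
    refine hs _ ?_ a a.2
    rw [map_sub, sub_eq_zero]
    exact LinearMap.congr_fun h t

end Firm

/-! ### Firm modules as colocal objects for almost isomorphisms -/

section Colocal

open TensorProduct

variable {V : Type u} [CommRing V] (m : Ideal V)

/-- The ideal `m R` of a `V`-algebra `R`. -/
abbrev almostIdeal (R : Type u) [CommRing R] [Algebra V R] : Ideal R := m.map (algebraMap V R)

lemma forall_almostIdeal {R : Type u} [CommRing R] [Algebra V R] {M : Type*} [AddCommGroup M]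
    [Module R M] (N : Submodule R M) (x : M) :
    (∀ a ∈ almostIdeal m R, a • x ∈ N) ↔ ∀ ε ∈ m, algebraMap V R ε • x ∈ N := by
  refine ⟨fun h ε hε ↦ h _ (Ideal.mem_map_of_mem _ hε), fun h a ha ↦ ?_⟩
  refine Submodule.span_induction ?_ ?_ ?_ ?_ ha
  · rintro _ ⟨ε, hε, rfl⟩
    exact h ε hε
  · rw [zero_smul]; exact N.zero_mem
  · intro a b _ _ ha hb
    rw [add_smul]; exact N.add_mem ha hb
  · intro r a _ ha
    rw [smul_eq_mul, mul_smul]; exact N.smul_mem r ha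

lemma almostIdeal_mul_self [BasicSetup m] (R : Type u) [CommRing R] [Algebra V R] :
    almostIdeal m R * almostIdeal m R = almostIdeal m R := by
  rw [← Ideal.map_mul, BasicSetup.mul_self]

variable [BasicSetup m] {R S : Type u} [CommRing R] [Algebra V R] [CommRing S] [Algebra V S]

lemma isoModSerre_iff_ideal {M N : ModuleCat.{u} R} (f : M ⟶ N) :
    (almostZero m R).isoModSerre f ↔
      (∀ x : M, f x = 0 → ∀ a ∈ almostIdeal m R, a • x = 0) ∧
      (∀ y : N, ∀ a ∈ almostIdeal m R, ∃ x : M, f x = a • y) := by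
  rw [isoModSerre_iff_elem]
  refine and_congr (forall_congr' fun x ↦ imp_congr_right fun _ ↦ ?_) (forall_congr' fun y ↦ ?_)
  · exact (forall_almostIdeal m (⊥ : Submodule R M) x).symm
  · exact (forall_almostIdeal m (LinearMap.range f.hom) y).symm

/-- A module is firm if maps out of it do not see almost isomorphisms. -/
abbrev IsFirm (M : ModuleCat.{u} R) : Prop := (almostZero m R).isoModSerre.isColocal M

lemma isFirm_firmTensor (N : ModuleCat.{u} R) :
    IsFirm m (ModuleCat.of R (FirmTensor (almostIdeal m R) N)) := by
  have hJ := almostIdeal_mul_self m R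
  have hF := idealMul_firmTensor_bijective hJ N
  intro X Y s hs
  obtain ⟨h₁, h₂⟩ := (isoModSerre_iff_ideal m s).1 hs
  refine ⟨fun f g h ↦ ?_, fun f ↦ ?_⟩
  · exact ModuleCat.hom_ext (eq_of_comp_eq_of_idealMul_surjective hF.2 s.hom h₁ f.hom g.hom
      (congrArg ModuleCat.Hom.hom h))
  · obtain ⟨g, hg⟩ := exists_lift_of_idealMul_bijective hJ hF s.hom h₁ h₂ f.hom
    exact ⟨ModuleCat.ofHom g, ModuleCat.hom_ext hg⟩

lemma isoModSerre_firmTensorTo (N : ModuleCat.{u} R) :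
    (almostZero m R).isoModSerre
      (ModuleCat.ofHom (X := FirmTensor (almostIdeal m R) N) (Y := N)
        (firmTensorTo (almostIdeal m R) N)) := by
  have hJ := almostIdeal_mul_self m R
  rw [isoModSerre_iff_ideal]
  refine ⟨fun x hx ↦ ?_, fun y ↦ ?_⟩
  · refine smul_mem_of_idempotent hJ (⊥ : Submodule R _) x fun a ha b hb ↦ ?_
    have h := mul_smul_eq_firmTensorTo ⟨a, ha⟩ ⟨b, hb⟩ x
    have hx' : firmTensorTo (almostIdeal m R) N x = 0 := hx
    rw [hx', tmul_zero] at h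
    exact h
  · refine smul_mem_of_idempotent hJ (LinearMap.range (firmTensorTo (almostIdeal m R) N)) y
      fun a ha b hb ↦ ⟨(⟨a, ha⟩ ⊗ₜ ⟨b, hb⟩) ⊗ₜ y, rfl⟩

lemma exists_firm (N : ModuleCat.{u} R) :
    ∃ (M : ModuleCat.{u} R) (s : M ⟶ N), IsFirm m M ∧ (almostZero m R).isoModSerre s :=
  ⟨_, _, isFirm_firmTensor m N, isoModSerre_firmTensorTo m N⟩

lemma exists_firm_iso (X : AlmostMod m R) :
    ∃ M : ModuleCat.{u} R, IsFirm m M ∧ Nonempty ((almostFunctor m R).obj M ≅ X) := by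
  have := Localization.essSurj (almostFunctor m R) (almostZero m R).isoModSerre
  obtain ⟨M, s, hM, hs⟩ := exists_firm m ((almostFunctor m R).objPreimage X)
  exact ⟨M, hM, ⟨Localization.isoOfHom (almostFunctor m R) (almostZero m R).isoModSerre s hs ≪≫
    (almostFunctor m R).objObjPreimageIso X⟩⟩

variable {m}

/-- A morphism in the localization is a left fraction whose denominator is an almost isomorphism out
of `X`; firmness of `M` lifts the numerator through the denominator. -/
lemma IsFirm.map_bijective {M : ModuleCat.{u} R} (hM : IsFirm m M) (X : ModuleCat.{u} R) :
    Function.Bijective (fun f : M ⟶ X ↦ (almostFunctor m R).map f) := by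
  refine ⟨fun f g h ↦ ?_, fun f ↦ ?_⟩
  · obtain ⟨Z, s, hs, h⟩ := (MorphismProperty.map_eq_iff_postcomp (almostFunctor m R)
      (almostZero m R).isoModSerre f g).1 h
    exact (hM s hs).1 h
  · obtain ⟨φ, rfl⟩ := Localization.exists_leftFraction (almostFunctor m R)
      (almostZero m R).isoModSerre f
    obtain ⟨g, hg⟩ := (hM φ.s φ.hs).2 φ.f
    refine ⟨g, ?_⟩
    have := Localization.inverts (almostFunctor m R) (almostZero m R).isoModSerre _ φ.hs
    rw [← cancel_mono ((almostFunctor m R).map φ.s), φ.map_comp_map_s]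
    dsimp only at hg ⊢
    rw [← Functor.map_comp, hg]

/-- The quotient of `M` by `mM` is almost zero, so its map to zero is an almost isomorphism, and a
firm module has only the zero map to it. -/
lemma IsFirm.smul_top {M : ModuleCat.{u} R} (hM : IsFirm m M) :
    almostIdeal m R • (⊤ : Submodule R M) = ⊤ := by
  let N := almostIdeal m R • (⊤ : Submodule R M)
  let s : ModuleCat.of R (M ⧸ N) ⟶ ModuleCat.of R PUnit := 0
  have hs : (almostZero m R).isoModSerre s := by
    rw [isoModSerre_iff_ideal]
    refine ⟨fun x _ a ha ↦ ?_, fun y a _ ↦ ⟨0, Subsingleton.elim _ _⟩⟩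
    obtain ⟨x, rfl⟩ := N.mkQ_surjective x
    rw [← map_smul]
    exact (Submodule.Quotient.mk_eq_zero _).2 (Submodule.smul_mem_smul ha trivial)
  have h : ModuleCat.ofHom N.mkQ = 0 := (hM s hs).1 (by simp [s])
  have h' : N.mkQ = 0 := congrArg ModuleCat.Hom.hom h
  exact (N.ker_mkQ.symm.trans (by rw [h'])).trans LinearMap.ker_zero

/-- Firmness is a condition on maps out, and the right adjoint, restriction of scalars, preserves
almost isomorphisms. -/
lemma IsFirm.extendScalars {M : ModuleCat.{u} R} (hM : IsFirm m M) (f : R →ₐ[V] S) :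
    IsFirm m ((ModuleCat.extendScalars.{u} f.toRingHom).obj M) := by
  intro X Y s hs
  have h := hM _ (restrictScalars_map_mem m f s hs)
  let adj := ModuleCat.extendRestrictScalarsAdj.{u} f.toRingHom
  refine ⟨fun a b hab ↦ ?_, fun a ↦ ?_⟩
  · apply (adj.homEquiv _ _).injective
    apply h.1
    dsimp only at hab ⊢
    rw [← adj.homEquiv_naturality_right, ← adj.homEquiv_naturality_right, hab]
  · obtain ⟨b, hb⟩ := h.2 (adj.homEquiv _ _ a)
    refine ⟨(adj.homEquiv _ _).symm b, ?_⟩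
    dsimp only at hb ⊢
    rw [← adj.homEquiv_naturality_right_symm, hb, Equiv.symm_apply_apply]

end Colocal

/-! ## Towers of modules -/

/-! ### Finitely generated ideals below powers inside an idempotent ideal -/

section Ideals

variable {R : Type*} [CommRing R]

lemma exists_fg_le_mul_self {J : Ideal R} (hJ : J * J = J) (J₀ : Ideal R) (h₀ : J₀ ≤ J)
    (hfg : J₀.FG) : ∃ J₁ : Ideal R, J₁ ≤ J ∧ J₁.FG ∧ J₀ ≤ J₁ * J₁ := by
  induction J₀, hfg using Submodule.fg_induction with
  | singleton a =>
    have ha : a ∈ J * J := hJ.symm ▸ h₀ (Submodule.mem_span_singleton_self a)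
    suffices ∃ J₁ : Ideal R, J₁ ≤ J ∧ J₁.FG ∧ a ∈ J₁ * J₁ by
      obtain ⟨J₁, h₁, h₂, h₃⟩ := this
      exact ⟨J₁, h₁, h₂, (Submodule.span_singleton_le_iff_mem _ _).2 h₃⟩
    clear h₀
    induction ha using Submodule.mul_induction_on' with
    | mem_mul_mem a ha b hb =>
      refine ⟨Ideal.span {a, b}, ?_, Submodule.fg_span (Set.toFinite _), ?_⟩
      · rw [Ideal.span_le]
        rintro _ (rfl | rfl)
        · exact ha
        · exact hb
      · exact Ideal.mul_mem_mul (Ideal.subset_span (by simp)) (Ideal.subset_span (by simp))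
    | add a _ b _ ha hb =>
      obtain ⟨A, hA, hA', hA''⟩ := ha
      obtain ⟨B, hB, hB', hB''⟩ := hb
      exact ⟨A ⊔ B, sup_le hA hB, Submodule.FG.sup hA' hB',
        add_mem (Ideal.mul_mono le_sup_left le_sup_left hA'')
          (Ideal.mul_mono le_sup_right le_sup_right hB'')⟩
  | sup A B _ _ hA hB =>
    obtain ⟨A', h₁, h₂, h₃⟩ := hA (le_sup_left.trans h₀)
    obtain ⟨B', h₄, h₅, h₆⟩ := hB (le_sup_right.trans h₀)
    exact ⟨A' ⊔ B', sup_le h₁ h₄, Submodule.FG.sup h₂ h₅,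
      sup_le (h₃.trans (Ideal.mul_mono le_sup_left le_sup_left))
        (h₆.trans (Ideal.mul_mono le_sup_right le_sup_right))⟩

/-- This is the bookkeeping device for losses: a construction that spends `p` factors is run with
`J₁`, so that the total loss still covers `J₀`. -/
lemma exists_fg_le_pow {J : Ideal R} (hJ : J * J = J) (J₀ : Ideal R) (h₀ : J₀ ≤ J)
    (hfg : J₀.FG) (p : ℕ) : ∃ J₁ : Ideal R, J₁ ≤ J ∧ J₁.FG ∧ J₀ ≤ J₁ ^ p := by
  suffices ∃ J₁ : Ideal R, J₁ ≤ J ∧ J₁.FG ∧ J₀ ≤ J₁ ^ (2 ^ p) by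
    obtain ⟨J₁, h₁, h₂, h₃⟩ := this
    exact ⟨J₁, h₁, h₂, h₃.trans (Ideal.pow_le_pow_right Nat.lt_two_pow_self.le)⟩
  induction p with
  | zero => exact ⟨J₀, h₀, hfg, by simp⟩
  | succ p ih =>
    obtain ⟨J₁, h₁, h₂, h₃⟩ := ih
    obtain ⟨J₂, h₄, h₅, h₆⟩ := exists_fg_le_mul_self hJ J₁ h₁ h₂
    refine ⟨J₂, h₄, h₅, h₃.trans ?_⟩
    rw [pow_succ', pow_mul, sq]
    exact Ideal.pow_right_mono h₆ _

end Ideals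

section Limit

/-- The inverse limit of a tower of modules. -/
def limitModule {R : Type*} [CommRing R] {M : ℕ → Type*} [∀ n, AddCommGroup (M n)]
    [∀ n, Module R (M n)] (ρ : ∀ n, M (n + 1) →ₗ[R] M n) : Submodule R (∀ n, M n) where
  carrier := {x | ∀ n, ρ n (x (n + 1)) = x n}
  add_mem' hx hy n := by simp only [Pi.add_apply, map_add, hx n, hy n]
  zero_mem' n := by simp
  smul_mem' r x hx n := by simp only [Pi.smul_apply, map_smul, hx n]

/-- Above degree `n` preimages are chosen successively; below it the values are forced. The
induction shifts the tower by one degree. -/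
lemma exists_compatible_of_surjective (n : ℕ) : ∀ {X : ℕ → Type u} (f : ∀ n, X (n + 1) → X n),
    (∀ n, Function.Surjective (f n)) → ∀ x : X n,
      ∃ y : ∀ k, X k, (∀ k, f k (y (k + 1)) = y k) ∧ y n = x := by
  induction n with
  | zero =>
    intro X f hf x
    choose s hs using hf
    exact ⟨fun k ↦ Nat.rec x (fun k y ↦ s k y) k, fun k ↦ hs _ _, rfl⟩
  | succ n ih =>
    intro X f hf x
    obtain ⟨y, hy, hyn⟩ := ih (X := fun k ↦ X (k + 1)) (fun k ↦ f (k + 1)) (fun k ↦ hf (k + 1)) x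
    refine ⟨fun k ↦ Nat.casesOn k (f 0 (y 0)) y, fun k ↦ ?_, hyn⟩
    cases k with
    | zero => rfl
    | succ k => exact hy k

end Limit

/-- A tower of modules `M n` over a ring `R`, where `M n` is killed by an ideal `K n`
which almost contains `I ^ (n + 1)`, and is almost projective as such. Almost mathematics is
relative to an idempotent ideal `J` of `R`. -/
structure IsAlmostTower {R : Type u} [CommRing R] (J I : Ideal R) (K : ℕ → Ideal R)
    {M : ℕ → Type u} [∀ n, AddCommGroup (M n)] [∀ n, Module R (M n)]
    (ρ : ∀ n, M (n + 1) →ₗ[R] M n) : Prop where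
  idem : J * J = J
  anti : Antitone K
  pow_le : ∀ n, J * I ^ (n + 1) ≤ K n
  smul_top : ∀ n, J • (⊤ : Submodule R (M n)) = ⊤
  smul_eq_zero : ∀ n, ∀ r ∈ K n, ∀ x : M n, r • x = 0
  surj : ∀ n, Function.Surjective (ρ n)
  ker : ∀ n x, ρ n x = 0 → ∀ a ∈ J, a • x ∈ I ^ (n + 1) • (⊤ : Submodule R (M (n + 1)))
  proj : ∀ n (X Y : Type u) [AddCommGroup X] [AddCommGroup Y] [Module R X] [Module R Y]
    (q : X →ₗ[R] Y), Function.Surjective q → (∀ r ∈ K n, ∀ x : X, r • x = 0) →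
    ∀ (g : M n →ₗ[R] Y), ∀ a ∈ J, ∃ h : M n →ₗ[R] X, q ∘ₗ h = a • g
  gen : ∀ J₀ ≤ J, J₀.FG → ∃ (k : ℕ) (x : Fin k → M 0), J₀ • ⊤ ≤ Submodule.span R (Set.range x)
  tight : ∃ J₀ ≤ J, J₀.FG ∧ ∃ N, J * I ^ N ≤ J₀

/-! ### Kernels of the projections and uniform generators -/

namespace IsAlmostTower

variable {R : Type u} [CommRing R] {J I : Ideal R} {K : ℕ → Ideal R}
    {M : ℕ → Type u} [∀ n, AddCommGroup (M n)] [∀ n, Module R (M n)]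
    {ρ : ∀ n, M (n + 1) →ₗ[R] M n}

lemma exists_limit (T : IsAlmostTower J I K ρ) {n : ℕ} (x : M n) :
    ∃ y : limitModule ρ, y.1 n = x := by
  obtain ⟨y, hy, h⟩ := exists_compatible_of_surjective n (fun n ↦ ρ n) T.surj x
  exact ⟨⟨y, hy⟩, h⟩

lemma apply_eq_zero_of_le (y : limitModule ρ) {n p : ℕ} (h : n ≤ p) (hy : y.1 p = 0) :
    y.1 n = 0 := by
  induction p, h using Nat.le_induction with
  | base => exact hy
  | succ p _ ih => exact ih (by rw [← y.2 p, hy, map_zero])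

/-- Only `J * I ^ (n + 1)` is known to lie in `K n`, but the extra factor is free because `M n = J M
n`. -/
lemma pow_smul_top (T : IsAlmostTower J I K ρ) (n : ℕ) :
    I ^ (n + 1) • (⊤ : Submodule R (M n)) = ⊥ := by
  rw [eq_bot_iff, ← T.smul_top, ← Submodule.mul_smul, mul_comm, Submodule.smul_le]
  intro r hr x _
  exact (Submodule.mem_bot R).2 (T.smul_eq_zero n r (T.pow_le n hr) x)

lemma map_smul_top (T : IsAlmostTower J I K ρ) (A : Ideal R) (n : ℕ) :
    (A • (⊤ : Submodule R (M (n + 1)))).map (ρ n) = A • ⊤ := by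
  rw [Submodule.map_smul'', Submodule.map_top, LinearMap.range_eq_top.2 (T.surj n)]

/-- Induction on `p`: an element of `I ^ (n + 1) M p` lifts to `I ^ (n + 1) M (p + 1)`, and the
error lies in the kernel of `ρ p`, which is almost in the smaller submodule `I ^ (p + 1) M (p + 1)`.
Idempotence of `J` keeps the loss from growing with `p`. -/
lemma smul_mem_of_apply_eq_zero (T : IsAlmostTower J I K ρ) (y : limitModule ρ) {n p : ℕ}
    (h : n ≤ p) (hy : y.1 n = 0) : ∀ a ∈ J, a • y.1 p ∈ I ^ (n + 1) • (⊤ : Submodule R (M p)) := by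
  induction p, h using Nat.le_induction with
  | base =>
    intro a _
    rw [hy, smul_zero]
    exact zero_mem _
  | succ p hp ih =>
    refine smul_mem_of_idempotent T.idem _ _ fun a ha b hb ↦ ?_
    have h := ih b hb
    rw [← T.map_smul_top] at h
    obtain ⟨z, hz, hz'⟩ := h
    have hk := T.ker p (b • y.1 (p + 1) - z) (by rw [map_sub, map_smul, y.2 p, hz', sub_self]) a ha
    have hk' : a • (b • y.1 (p + 1) - z) ∈ I ^ (n + 1) • (⊤ : Submodule R (M (p + 1))) :=
      Submodule.smul_mono_left (Ideal.pow_le_pow_right (by omega)) hk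
    have := add_mem hk' (Submodule.smul_mem _ a hz)
    rwa [smul_sub, sub_add_cancel, ← mul_smul] at this

/-- Lifts of almost generators of `M 0` work in all degrees, by Nakayama. Iterating generation
modulo `I` gives `B ^ j M ≤ U + I ^ j M`, with a loss growing with `j`. Tightness trades `J * I ^ N`
for `B ^ (N + 2)`, so that `D = B ^ (N + 1) M` satisfies `D ≤ U + B D`; iterating this costs nothing
more, and nilpotence of `I` on `M n` ends the argument. -/
lemma exists_uniform_generators (T : IsAlmostTower J I K ρ) (J₀ : Ideal R) (h₀ : J₀ ≤ J)
    (hfg : J₀.FG) : ∃ (k : ℕ) (x : Fin k → limitModule ρ),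
      ∀ n, J₀ • (⊤ : Submodule R (M n)) ≤ Submodule.span R (Set.range fun i ↦ (x i).1 n) := by
  obtain ⟨Jt, ht, htfg, N, hN⟩ := T.tight
  -- The loss `B = J₁ ^ 2` is that of generation modulo `I`. The power `N + 2` of `B` is one more
  -- than the power defining `D`, which makes the inclusion `D ≤ U ⊔ B • D` contracting.
  obtain ⟨J₁, h₁, h₁fg, hJ₁⟩ := exists_fg_le_pow T.idem (J₀ ⊔ Jt) (sup_le h₀ ht)
    (Submodule.FG.sup hfg htfg) (2 * (N + 2))
  obtain ⟨k, x₀, hx₀⟩ := T.gen J₁ h₁ h₁fg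
  choose x hx using fun i ↦ T.exists_limit (x₀ i)
  refine ⟨k, x, fun n ↦ ?_⟩
  set U := Submodule.span R (Set.range fun i ↦ (x i).1 n) with hU
  rw [pow_mul] at hJ₁
  set B := J₁ ^ 2 with hB
  have hBJ : B ≤ J := (Ideal.pow_le_self two_ne_zero).trans h₁
  have hmul : ∀ A : Ideal R, A • U ≤ U := fun A ↦ Submodule.smul_le_right
  -- One factor from `J₁` expresses an element through the generators in `M 0`; the other moves the
  -- error, which vanishes in `M 0`, into `I M n`.
  have step₁ : B • (⊤ : Submodule R (M n)) ≤ U ⊔ I • ⊤ := by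
    rw [hB, sq, Submodule.mul_smul, Submodule.smul_le]
    intro a ha z hz
    refine Submodule.smul_induction_on hz (fun b hb y _ ↦ ?_) (fun y z hy hz ↦ ?_)
    · obtain ⟨Y, rfl⟩ := T.exists_limit y
      have hb' := hx₀ (Submodule.smul_mem_smul hb (Submodule.mem_top (x := Y.1 0)))
      obtain ⟨c, hc⟩ := (Submodule.mem_span_range_iff_exists_fun R).1 hb'
      have hz := T.smul_mem_of_apply_eq_zero (b • Y - ∑ i, c i • x i) (Nat.zero_le n) (by
        simp only [Submodule.coe_sub, Submodule.coe_smul, Submodule.coe_sum, Pi.sub_apply,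
          Pi.smul_apply, Finset.sum_apply, hx, hc, sub_self]) a (h₁ ha)
      have e : a • b • Y.1 n = (∑ i, (a * c i) • (x i).1 n) +
          a • (b • Y - ∑ i, c i • x i).1 n := by
        simp only [Submodule.coe_sub, Submodule.coe_smul, Submodule.coe_sum, Pi.sub_apply,
          Pi.smul_apply, Finset.sum_apply, smul_sub, Finset.smul_sum, mul_smul]
        abel
      rw [e]
      refine add_mem (Submodule.mem_sup_left (sum_mem fun i _ ↦ Submodule.smul_mem _ _
        (Submodule.subset_span ⟨i, rfl⟩))) (Submodule.mem_sup_right ?_)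
      rwa [zero_add, pow_one] at hz
    · rw [smul_add]
      exact add_mem hy hz
  have step₂ : ∀ j, B ^ j • (⊤ : Submodule R (M n)) ≤ U ⊔ I ^ j • ⊤ := by
    intro j
    induction j with
    | zero => simp
    | succ j ih =>
      calc B ^ (j + 1) • (⊤ : Submodule R (M n)) = B • B ^ j • ⊤ := by
            rw [pow_succ', Submodule.mul_smul]
        _ ≤ B • (U ⊔ I ^ j • ⊤) := smul_mono_right _ ih
        _ = B • U ⊔ I ^ j • B • ⊤ := by
            rw [Submodule.smul_sup, ← Submodule.mul_smul, ← Submodule.mul_smul, mul_comm]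
        _ ≤ U ⊔ I ^ j • (U ⊔ I • ⊤) :=
            sup_le_sup (hmul _) (smul_mono_right _ step₁)
        _ = U ⊔ (I ^ j • U ⊔ I ^ (j + 1) • ⊤) := by
            rw [Submodule.smul_sup, pow_succ, Submodule.mul_smul]
        _ ≤ U ⊔ I ^ (j + 1) • ⊤ :=
            sup_le le_sup_left (sup_le ((hmul _).trans le_sup_left) le_sup_right)
  set D := B ^ (N + 1) • (⊤ : Submodule R (M n)) with hD
  have hBD : B ^ (N + 2) • (⊤ : Submodule R (M n)) = B • D := by
    rw [hD, ← Submodule.mul_smul, ← pow_succ']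
  have step₃ : D ≤ U ⊔ B • D := by
    calc D = B • B ^ N • ⊤ := by rw [hD, pow_succ', Submodule.mul_smul]
      _ ≤ B • (U ⊔ I ^ N • ⊤) := smul_mono_right _ (step₂ N)
      _ = B • U ⊔ (B * I ^ N) • ⊤ := by rw [Submodule.smul_sup, Submodule.mul_smul]
      _ ≤ U ⊔ B ^ (N + 2) • ⊤ := sup_le_sup (hmul _) (Submodule.smul_mono_left
          ((Ideal.mul_mono_left hBJ).trans (hN.trans (le_sup_right.trans hJ₁))))
      _ = U ⊔ B • D := by rw [hBD]
  have step₄ : ∀ j, D ≤ U ⊔ B ^ j • D := by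
    intro j
    induction j with
    | zero => simp
    | succ j ih =>
      calc D ≤ U ⊔ B • D := step₃
        _ ≤ U ⊔ B • (U ⊔ B ^ j • D) := sup_le_sup_left (smul_mono_right _ ih) _
        _ = U ⊔ (B • U ⊔ B ^ (j + 1) • D) := by
          rw [Submodule.smul_sup, pow_succ', Submodule.mul_smul]
        _ ≤ U ⊔ B ^ (j + 1) • D :=
          sup_le le_sup_left (sup_le ((hmul _).trans le_sup_left) le_sup_right)
  -- The number of iterations depends on `n`, but `D` does not lose any further power of `B`.
  have step₅ : D ≤ U := by
    refine (step₄ (n + 1)).trans (sup_le le_rfl ?_)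
    refine (smul_mono_right _ le_top).trans ((step₂ (n + 1)).trans ?_)
    rw [T.pow_smul_top, sup_bot_eq]
  refine (Submodule.smul_mono_left (le_sup_left.trans hJ₁)).trans ?_
  rw [hBD]
  exact Submodule.smul_le_right.trans step₅

end IsAlmostTower

/-! ### Projections of the limit and vectors modulo ideals -/

section LimitMaps

variable {R : Type u} [CommRing R] {M : ℕ → Type u} [∀ n, AddCommGroup (M n)]
  [∀ n, Module R (M n)]

/-- The projection from the inverse limit of a tower of modules. -/
def limitEval (ρ : ∀ n, M (n + 1) →ₗ[R] M n) (n : ℕ) : limitModule ρ →ₗ[R] M n :=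
  LinearMap.proj n ∘ₗ (limitModule ρ).subtype

@[simp]
lemma apply_limitEval (ρ : ∀ n, M (n + 1) →ₗ[R] M n) (n : ℕ) (y : limitModule ρ) :
    ρ n (limitEval ρ (n + 1) y) = limitEval ρ n y := y.2 n

/-- Reduction of vectors modulo an ideal. -/
abbrev vecMk (k : ℕ) (A : Ideal R) : (Fin k → R) →ₗ[R] (Fin k → R ⧸ A) :=
  A.mkQ.compLeft (Fin k)

/-- The reduction map between vectors modulo two ideals. -/
abbrev vecFactor (k : ℕ) {A B : Ideal R} (h : A ≤ B) : (Fin k → R ⧸ A) →ₗ[R] (Fin k → R ⧸ B) :=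
  (Submodule.factor h).compLeft (Fin k)

lemma vecMk_surjective (k : ℕ) (A : Ideal R) : Function.Surjective (vecMk k A) := by
  intro z
  choose c hc using fun i ↦ A.mkQ_surjective (z i)
  exact ⟨c, funext hc⟩

lemma vecFactor_vecMk {k : ℕ} {A B : Ideal R} (h : A ≤ B) (c : Fin k → R) :
    vecFactor k h (vecMk k A c) = vecMk k B c := rfl

lemma vecMk_eq_zero {k : ℕ} {A : Ideal R} {c : Fin k → R} : vecMk k A c = 0 ↔ ∀ i, c i ∈ A := by
  rw [funext_iff]
  exact forall_congr' fun i ↦ Submodule.Quotient.mk_eq_zero _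

/-- The combination of vectors `x i` in a module killed by an ideal `A`, with coefficients
modulo `A`. -/
def quotientCombination {k : ℕ} (A : Ideal R) {P : Type u} [AddCommGroup P] [Module R P]
    (hP : ∀ r ∈ A, ∀ y : P, r • y = 0) (x : Fin k → P) : (Fin k → R ⧸ A) →ₗ[R] P :=
  ∑ i, A.liftQ (LinearMap.toSpanSingleton R P (x i)) (fun r hr ↦ hP r hr _) ∘ₗ LinearMap.proj i

lemma quotientCombination_vecMk {k : ℕ} (A : Ideal R) {P : Type u} [AddCommGroup P] [Module R P]
    (hP : ∀ r ∈ A, ∀ y : P, r • y = 0) (x : Fin k → P) (c : Fin k → R) :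
    quotientCombination A hP x (vecMk k A c) = ∑ i, c i • x i := by
  simp only [quotientCombination, LinearMap.sum_apply]
  rfl

end LimitMaps

/-! ### Almost sections in each degree and lifting of relations -/

namespace IsAlmostTower

variable {R : Type u} [CommRing R] {J I : Ideal R} {K : ℕ → Ideal R}
    {M : ℕ → Type u} [∀ n, AddCommGroup (M n)] [∀ n, Module R (M n)]
    {ρ : ∀ n, M (n + 1) →ₗ[R] M n}

lemma limitEval_surjective (T : IsAlmostTower J I K ρ) (n : ℕ) :
    Function.Surjective (limitEval ρ n) := fun x ↦ T.exists_limit x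

/-- Multiplication by `a` maps `M n` into the image of `(R / K n)^k`, and almost projectivity lifts
this map at the cost of `b`. -/
lemma exists_section_level (T : IsAlmostTower J I K ρ) {k n : ℕ} (x : Fin k → M n)
    {J₀ : Ideal R} (hx : J₀ • (⊤ : Submodule R (M n)) ≤ Submodule.span R (Set.range x))
    {a b : R} (ha : a ∈ J₀) (hb : b ∈ J) :
    ∃ s : M n →ₗ[R] (Fin k → R ⧸ K n), ∀ y c, vecMk k (K n) c = s y →
      ∑ i, c i • x i = (b * a) • y := by
  let q := quotientCombination (K n) (T.smul_eq_zero n) x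
  have hq : ∀ y : M n, a • y ∈ LinearMap.range q := by
    intro y
    obtain ⟨c, hc⟩ := (Submodule.mem_span_range_iff_exists_fun R).1
      (hx (Submodule.smul_mem_smul ha (Submodule.mem_top (x := y))))
    exact ⟨vecMk k (K n) c, (quotientCombination_vecMk _ _ _ _).trans hc⟩
  obtain ⟨s, hs⟩ := T.proj n _ _ q.rangeRestrict q.surjective_rangeRestrict
    (fun r hr z ↦ by
      obtain ⟨c, rfl⟩ := vecMk_surjective k (K n) z
      rw [← map_smul, vecMk_eq_zero]
      exact fun i ↦ (K n).mul_mem_right _ hr)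
    ((a • LinearMap.id).codRestrict (LinearMap.range q) hq) b hb
  refine ⟨s, fun y c hc ↦ ?_⟩
  have h : q (s y) = b • a • y := congrArg Subtype.val (LinearMap.congr_fun hs y)
  rw [mul_smul, ← h, ← hc]
  exact (quotientCombination_vecMk _ _ _ _).symm

/-- Linear maps from the limit of a tower to vectors modulo `K n`, which factor through `M n` and
whose values lift to relations in degree `N + n` between given elements of the limit. -/
def relationMaps (K : ℕ → Ideal R) (ρ : ∀ n, M (n + 1) →ₗ[R] M n) {k : ℕ}
    (x : Fin k → limitModule ρ) (N n : ℕ) :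
    Submodule R (limitModule ρ →ₗ[R] (Fin k → R ⧸ K n)) where
  carrier := {e | (∀ y, limitEval ρ n y = 0 → e y = 0) ∧
    ∀ y, ∃ c : Fin k → R, limitEval ρ (N + n) (∑ i, c i • x i) = 0 ∧ vecMk k (K n) c = e y}
  add_mem' {e f} he hf := ⟨fun y hy ↦ by
    rw [LinearMap.add_apply, he.1 y hy, hf.1 y hy, add_zero], fun y ↦ by
    obtain ⟨c, hc, hc'⟩ := he.2 y
    obtain ⟨d, hd, hd'⟩ := hf.2 y
    refine ⟨c + d, ?_, by rw [map_add, hc', hd', LinearMap.add_apply]⟩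
    simp only [Pi.add_apply, add_smul, Finset.sum_add_distrib]
    rw [map_add, hc, hd, add_zero]⟩
  zero_mem' := ⟨fun _ _ ↦ rfl, fun y ↦ ⟨0, by simp, by simp⟩⟩
  smul_mem' r e he := ⟨fun y hy ↦ by
    rw [LinearMap.smul_apply, he.1 y hy, smul_zero], fun y ↦ by
    obtain ⟨c, hc, hc'⟩ := he.2 y
    refine ⟨r • c, ?_, by rw [map_smul, hc', LinearMap.smul_apply]⟩
    simp only [Pi.smul_apply, smul_assoc]
    rw [← Finset.smul_sum, map_smul, hc, smul_zero]⟩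

/-- The combination `v` of the `x i` in degree `N + n + 1` lies in the kernel of the transition map,
hence almost in `I ^ (N + n + 1) M`. The factor `I ^ N` is spent on `J * I ^ N ≤ J₀`, so that a
multiple of `v` is a combination of the generators with coefficients `d i` in `I ^ (n + 1)`.
Subtracting `d` gives a relation in degree `N + n + 1`, and after one more factor from `J` the
change is invisible modulo `K n`. -/
lemma exists_relation_lift (T : IsAlmostTower J I K ρ) {k : ℕ} (x : Fin k → limitModule ρ)
    {J₀ : Ideal R}
    (hx : ∀ n, J₀ • (⊤ : Submodule R (M n)) ≤ Submodule.span R (Set.range fun i ↦ (x i).1 n))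
    {N : ℕ} (hN : J * I ^ N ≤ J₀) (n : ℕ) (c : Fin k → R)
    (hc : limitEval ρ (N + n) (∑ i, c i • x i) = 0) :
    ∀ a ∈ J, ∃ c' : Fin k → R, limitEval ρ (N + n + 1) (∑ i, c' i • x i) = 0 ∧
      vecMk k (K n) c' = a • vecMk k (K n) c := by
  let u : (Fin k → R) →ₗ[R] limitModule ρ := Fintype.linearCombination R x
  let G := (LinearMap.ker (limitEval ρ (N + n + 1) ∘ₗ u)).map (vecMk k (K n))
  suffices ∀ a ∈ J, a • vecMk k (K n) c ∈ G by
    intro a ha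
    obtain ⟨c', h, h'⟩ := this a ha
    exact ⟨c', h, h'⟩
  -- The multiplier is split into three factors: `a` brings `v` into `I ^ (N + n + 1) M`, `b` is
  -- used in `J * I ^ N ≤ J₀`, and `e` brings `d` into `K n`.
  refine smul_mem_of_idempotent T.idem G _ fun a ha b hb ↦ ?_
  rw [mul_comm, mul_smul]
  revert b
  refine smul_mem_of_idempotent T.idem G _ fun e he b hb ↦ ?_
  set v := limitEval ρ (N + n + 1) (u c) with hv
  have h₁ : a • v ∈ I ^ (N + n + 1) • (⊤ : Submodule R (M (N + n + 1))) :=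
    T.ker _ _ (by rw [hv, apply_limitEval]; exact hc) a ha
  have h₂ : b • a • v ∈
      I ^ (n + 1) • Submodule.span R (Set.range fun i ↦ (x i).1 (N + n + 1)) := by
    refine (smul_mono_right (I ^ (n + 1)) (hx (N + n + 1))) ?_
    refine (smul_mono_right (I ^ (n + 1)) (Submodule.smul_mono_left hN)) ?_
    rw [← Submodule.mul_smul, mul_left_comm, ← pow_add, Submodule.mul_smul,
      show n + 1 + N = N + n + 1 by ring]
    exact Submodule.smul_mem_smul hb h₁
  obtain ⟨d, hd, hd'⟩ := (Submodule.mem_ideal_smul_span_iff_exists_sum _ _ _).1 h₂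
  rw [Finsupp.sum_fintype _ _ (by simp)] at hd'
  refine ⟨e • (b • a • c - d), ?_, ?_⟩
  · have h₃ : limitEval ρ (N + n + 1) (u d) = b • a • v := by
      rw [← hd']
      simp [u, Fintype.linearCombination_apply, limitEval]
    change limitEval ρ (N + n + 1) (u (e • (b • a • c - d))) = 0
    rw [map_smul, map_sub, map_smul, map_smul, map_smul, map_sub, map_smul, map_smul, h₃, ← hv,
      sub_self, smul_zero]
  · have h₄ : vecMk k (K n) (e • (d : Fin k → R)) = 0 :=
      vecMk_eq_zero.2 fun i ↦ T.pow_le n (Ideal.mul_mem_mul he (hd i))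
    rw [smul_sub, map_sub, h₄, sub_zero]
    simp only [map_smul, mul_smul]

/-- The lifts of relations must be chosen linearly. A multiple `b • e` factors through `M (n + 1)`
and takes values in the reductions of relations one degree higher; these relations modulo `K (n +
1)` form a module killed by `K (n + 1)`, so almost projectivity of `M (n + 1)` provides the linear
lift. -/
lemma exists_relationMaps_lift (T : IsAlmostTower J I K ρ) {k : ℕ} (x : Fin k → limitModule ρ)
    {J₀ : Ideal R}
    (hx : ∀ n, J₀ • (⊤ : Submodule R (M n)) ≤ Submodule.span R (Set.range fun i ↦ (x i).1 n))
    {N : ℕ} (hN : J * I ^ N ≤ J₀) (n : ℕ) (e) (he : e ∈ relationMaps K ρ x N n) :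
    ∀ a ∈ J, ∃ e' ∈ relationMaps K ρ x N (n + 1),
      vecFactor k (T.anti n.le_succ) ∘ₗ e' = a • e := by
  let τ := vecFactor k (T.anti n.le_succ)
  let P := (relationMaps K ρ x N (n + 1)).map (LinearMap.compRight R τ)
  suffices ∀ a ∈ J, a • e ∈ P by
    intro a ha
    obtain ⟨e', h, h'⟩ := this a ha
    exact ⟨e', h, h'⟩
  refine smul_mem_of_idempotent T.idem P _ fun a ha b hb ↦ ?_
  let u : (Fin k → R) →ₗ[R] limitModule ρ := Fintype.linearCombination R x
  let G := (LinearMap.ker (limitEval ρ (N + (n + 1)) ∘ₗ u)).map (vecMk k (K (n + 1)))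
  let q : G →ₗ[R] G.map τ := (τ ∘ₗ G.subtype).codRestrict (G.map τ) fun z ↦ ⟨z, z.2, rfl⟩
  have hq : Function.Surjective q := by
    rintro ⟨_, z, hz, rfl⟩
    exact ⟨⟨z, hz⟩, rfl⟩
  have hbe : ∀ y, (b • e) y ∈ G.map τ := by
    intro y
    obtain ⟨c, hc, hc'⟩ := he.2 y
    obtain ⟨c', h, h'⟩ := T.exists_relation_lift x hx hN n c hc b hb
    exact ⟨vecMk k (K (n + 1)) c', ⟨c', h, rfl⟩, by rw [LinearMap.smul_apply, ← hc', ← h']; rfl⟩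
  have hsurj := T.limitEval_surjective (n + 1)
  have hker : LinearMap.ker (limitEval ρ (n + 1)) ≤
      LinearMap.ker ((b • e).codRestrict (G.map τ) hbe) := by
    intro y hy
    refine Subtype.ext ?_
    have h0 : e y = 0 := he.1 y (apply_eq_zero_of_le y n.le_succ hy)
    change b • e y = 0
    rw [h0, smul_zero]
  let ι := (limitEval ρ (n + 1)).quotKerEquivOfSurjective hsurj
  let g : M (n + 1) →ₗ[R] G.map τ :=
    (LinearMap.ker (limitEval ρ (n + 1))).liftQ _ hker ∘ₗ ι.symm.toLinearMap
  have hg : ∀ y, g (limitEval ρ (n + 1) y) = (b • e).codRestrict (G.map τ) hbe y := by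
    intro y
    have : ι.symm (limitEval ρ (n + 1) y) = Submodule.Quotient.mk y := by
      rw [LinearEquiv.symm_apply_eq]; rfl
    change (LinearMap.ker (limitEval ρ (n + 1))).liftQ _ hker (ι.symm _) = _
    rw [this]
    rfl
  obtain ⟨h, hh⟩ := T.proj (n + 1) _ _ q hq (fun r hr z ↦ Subtype.ext (by
      obtain ⟨c, hc⟩ := vecMk_surjective k (K (n + 1)) z
      rw [Submodule.coe_smul, ← hc, ← map_smul, ZeroMemClass.coe_zero, vecMk_eq_zero]
      exact fun i ↦ (K (n + 1)).mul_mem_right _ hr)) g a ha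
  refine ⟨G.subtype ∘ₗ h ∘ₗ limitEval ρ (n + 1), ⟨fun y hy ↦ ?_, fun y ↦ ?_⟩, ?_⟩
  · rw [LinearMap.comp_apply, LinearMap.comp_apply, hy, map_zero, map_zero]
  · obtain ⟨c, hc, hc'⟩ := (h (limitEval ρ (n + 1) y)).2
    exact ⟨c, hc, hc'⟩
  · ext1 y
    have h₁ := congrArg Subtype.val (LinearMap.congr_fun hh (limitEval ρ (n + 1) y))
    rw [LinearMap.smul_apply, hg] at h₁
    exact h₁.trans (smul_smul a b (e y))

/-- Multiplying by `J` turns almost surjectivity into surjectivity: since `J = J * J`, one factor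
pays for the lift and the other keeps it in `J • relationMaps`. Infinitely many successive lifts can
then be made without accumulating losses. -/
lemma exists_smul_relationMaps_lift (T : IsAlmostTower J I K ρ) {k : ℕ}
    (x : Fin k → limitModule ρ) {J₀ : Ideal R}
    (hx : ∀ n, J₀ • (⊤ : Submodule R (M n)) ≤ Submodule.span R (Set.range fun i ↦ (x i).1 n))
    {N : ℕ} (hN : J * I ^ N ≤ J₀) (n : ℕ) (e) (he : e ∈ J • relationMaps K ρ x N n) :
    ∃ e' ∈ J • relationMaps K ρ x N (n + 1), vecFactor k (T.anti n.le_succ) ∘ₗ e' = e := by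
  let τ := vecFactor k (T.anti n.le_succ)
  suffices e ∈ (J • relationMaps K ρ x N (n + 1)).map (LinearMap.compRight R τ) from this
  rw [← T.idem, Submodule.mul_smul] at he
  refine Submodule.smul_le.2 (fun b hb f hf ↦ ?_) he
  refine Submodule.smul_induction_on hf (fun a ha e he ↦ ?_) (fun y z hy hz ↦ ?_)
  · obtain ⟨e', he', h⟩ := T.exists_relationMaps_lift x hx hN n e he a ha
    refine ⟨b • e', Submodule.smul_mem_smul hb he', ?_⟩
    rw [map_smul]
    exact congrArg (b • ·) h
  · rw [smul_add]
    exact add_mem hy hz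

end IsAlmostTower

/-- Completeness gives a value for each argument, and separatedness makes it unique, which forces
linearity. -/
lemma exists_lift_of_complete {R : Type u} [CommRing R] {K : ℕ → Ideal R} (anti : Antitone K)
    (complete : ∀ c : ℕ → R, (∀ n, c (n + 1) - c n ∈ K n) → ∃ r, ∀ n, r - c n ∈ K n)
    (separated : ∀ r, (∀ n, r ∈ K n) → r = 0) {L : Type u} [AddCommGroup L] [Module R L] {k : ℕ}
    (t : ∀ n, L →ₗ[R] (Fin k → R ⧸ K n))
    (ht : ∀ n, vecFactor k (anti n.le_succ) ∘ₗ t (n + 1) = t n) :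
    ∃ t' : L →ₗ[R] (Fin k → R), ∀ n y, vecMk k (K n) (t' y) = t n y := by
  have h₁ : ∀ y, ∃ c : Fin k → R, ∀ n, vecMk k (K n) c = t n y := by
    intro y
    choose d hd using fun n ↦ vecMk_surjective k (K n) (t n y)
    have h₂ : ∀ i, ∃ r, ∀ n, r - d n i ∈ K n := by
      intro i
      refine complete (fun n ↦ d n i) fun n ↦ ?_
      have h := LinearMap.congr_fun (ht n) y
      rw [LinearMap.comp_apply, ← hd, vecFactor_vecMk, ← hd, ← sub_eq_zero, ← map_sub,
        vecMk_eq_zero] at h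
      exact h i
    choose c hc using h₂
    refine ⟨c, fun n ↦ ?_⟩
    rw [← hd, ← sub_eq_zero, ← map_sub, vecMk_eq_zero]
    exact fun i ↦ hc i n
  have h₂ : ∀ c d : Fin k → R, (∀ n, vecMk k (K n) c = vecMk k (K n) d) → c = d := by
    intro c d h
    funext i
    rw [← sub_eq_zero]
    refine separated _ fun n ↦ ?_
    have := h n
    rw [← sub_eq_zero, ← map_sub, vecMk_eq_zero] at this
    exact this i
  choose f hf using h₁
  refine ⟨{ toFun := f, map_add' := fun y z ↦ h₂ _ _ fun n ↦ ?_,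
            map_smul' := fun r y ↦ h₂ _ _ fun n ↦ ?_ }, fun n y ↦ hf y n⟩
  · rw [map_add, hf, hf, hf, map_add]
  · rw [map_smul, hf, hf, map_smul, RingHom.id_apply]

/-! ### Compatible almost sections on the limit -/

namespace IsAlmostTower

variable {R : Type u} [CommRing R] {J I : Ideal R} {K : ℕ → Ideal R}
    {M : ℕ → Type u} [∀ n, AddCommGroup (M n)] [∀ n, Module R (M n)]
    {ρ : ∀ n, M (n + 1) →ₗ[R] M n}

/-- The sections in degree `N + n`, reduced modulo `K n`, agree for successive `n` up to maps with
values in relations in degree `N + n`. The surjective tower `J • relationMaps` absorbs this defect.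
The four scalars are the costs: `a` for generation, `b` for projectivity, `c` for factoring through
`M n`, and `d` for entering `J • relationMaps`. -/
lemma exists_compatible_sections (T : IsAlmostTower J I K ρ) {k : ℕ} (x : Fin k → limitModule ρ)
    {J₀ : Ideal R}
    (hx : ∀ n, J₀ • (⊤ : Submodule R (M n)) ≤ Submodule.span R (Set.range fun i ↦ (x i).1 n))
    {N : ℕ} (hN : J * I ^ N ≤ J₀) {a b c d : R} (ha : a ∈ J₀) (hb : b ∈ J) (hc : c ∈ J)
    (hd : d ∈ J) :
    ∃ t : ∀ n, limitModule ρ →ₗ[R] (Fin k → R ⧸ K n),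
      (∀ n, vecFactor k (T.anti n.le_succ) ∘ₗ t (n + 1) = t n) ∧
      (∀ n y, limitEval ρ n y = 0 → t n y = 0) ∧
      ∀ n y f, vecMk k (K n) f = t n y →
        limitEval ρ n (∑ i, f i • x i) = (d * (c * (b * a))) • limitEval ρ n y := by
  choose s hs using fun n ↦ T.exists_section_level (fun i ↦ (x i).1 n) (hx n) ha hb
  have hs' : ∀ n y f, vecMk k (K n) f = s n (limitEval ρ n y) →
      limitEval ρ n (∑ i, f i • x i) = (b * a) • limitEval ρ n y := by
    intro n y f hf
    rw [← hs n _ f hf, map_sum]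
    simp only [map_smul]
    rfl
  have hle : ∀ n, K (N + n) ≤ K n := fun n ↦ T.anti (Nat.le_add_left n N)
  let σ : ∀ n, limitModule ρ →ₗ[R] (Fin k → R ⧸ K n) := fun n ↦
    c • (vecFactor k (hle n) ∘ₗ s (N + n) ∘ₗ limitEval ρ (N + n))
  -- If `y` vanishes in degree `n`, then `c` moves its component in degree `p` into `I ^ (n + 1) J M
  -- p`, and `J * I ^ (n + 1)` vanishes modulo `K n`. The spare factor `J` comes from `M p = J M p`.
  have hσ₀ : ∀ n p (h : n ≤ p) y, limitEval ρ n y = 0 →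
      c • vecFactor k (T.anti h) (s p (limitEval ρ p y)) = 0 := by
    intro n p hp y hy
    have h := T.smul_mem_of_apply_eq_zero y hp hy c hc
    have h₁ : s p (c • limitEval ρ p y) ∈
        I ^ (n + 1) • J • (⊤ : Submodule R (Fin k → R ⧸ K p)) := by
      have h₂ : c • limitEval ρ p y ∈ I ^ (n + 1) • J • (⊤ : Submodule R (M p)) := by
        rw [T.smul_top]
        exact h
      have h₃ := Submodule.mem_map_of_mem (f := s p) h₂
      rw [Submodule.map_smul'', Submodule.map_smul''] at h₃
      refine Submodule.smul_mono le_rfl (Submodule.smul_mono le_rfl le_top) h₃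
    have h₂ : vecFactor k (T.anti hp) (s p (c • limitEval ρ p y)) ∈
        (I ^ (n + 1) • J • (⊤ : Submodule R (Fin k → R ⧸ K p))).map
          (vecFactor k (T.anti hp)) := ⟨_, h₁, rfl⟩
    rw [Submodule.map_smul'', Submodule.map_smul'', ← Submodule.mul_smul, mul_comm] at h₂
    have h₃ : (J * I ^ (n + 1)) • (⊤ : Submodule R (Fin k → R ⧸ K p)).map
        (vecFactor k (T.anti hp)) ≤ ⊥ := by
      rw [Submodule.map_top, Submodule.smul_le]
      rintro r hr z -
      obtain ⟨f, rfl⟩ := vecMk_surjective k _ z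
      rw [← map_smul]
      exact vecMk_eq_zero.2 fun i ↦ (K n).mul_mem_right _ (T.pow_le n hr)
    have h₄ := (Submodule.mem_bot R).1 (h₃ h₂)
    rwa [map_smul, map_smul] at h₄
  have hσ : ∀ n y f, vecMk k _ f = s (N + n) (limitEval ρ (N + n) y) →
      vecMk k (K n) (c • f) = σ n y := by
    intro n y f hf
    change _ = c • vecFactor k (hle n) (s (N + n) (limitEval ρ (N + n) y))
    rw [← hf, map_smul]
    rfl
  let δ : ∀ n, limitModule ρ →ₗ[R] (Fin k → R ⧸ K n) := fun n ↦
    vecFactor k (T.anti n.le_succ) ∘ₗ σ (n + 1) - σ n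
  -- In degree `N + n` both almost sections recombine to `(b * a) • y`, so the difference of their
  -- coefficients is a relation there.
  have hδ : ∀ n, δ n ∈ relationMaps K ρ x N n := by
    intro n
    refine ⟨fun y hy ↦ ?_, fun y ↦ ?_⟩
    · have h₁ := hσ₀ n (N + n) (Nat.le_add_left n N) y hy
      have h₂ := hσ₀ n (N + (n + 1)) (by omega) y hy
      have h₃ : vecFactor k (T.anti n.le_succ) (σ (n + 1) y) = 0 := by
        obtain ⟨g, hg⟩ := vecMk_surjective k _ (s (N + (n + 1)) (limitEval ρ (N + (n + 1)) y))
        rw [← hg] at h₂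
        rw [← hσ (n + 1) y g hg, vecFactor_vecMk, map_smul]
        exact h₂
      exact (congrArg₂ _ h₃ h₁).trans (sub_zero 0)
    · obtain ⟨f, hf⟩ := vecMk_surjective k _ (s (N + n) (limitEval ρ (N + n) y))
      obtain ⟨g, hg⟩ := vecMk_surjective k _ (s (N + (n + 1)) (limitEval ρ (N + (n + 1)) y))
      refine ⟨c • g - c • f, ?_, ?_⟩
      · have h₁ := hs' _ _ _ hf
        have h₂ := congrArg (ρ (N + n)) (hs' _ _ _ hg)
        rw [map_smul] at h₂
        erw [apply_limitEval, apply_limitEval] at h₂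
        have e : ∑ i, (c • g - c • f) i • x i = c • (∑ i, g i • x i - ∑ i, f i • x i) := by
          have := map_sub (Fintype.linearCombination R x) (c • g) (c • f)
          exact this.trans (by rw [map_smul, map_smul, smul_sub]; rfl)
        rw [e, map_smul, map_sub, h₁, h₂, sub_self, smul_zero]
      · rw [map_sub, hσ n y f hf]
        change _ = vecFactor k (T.anti n.le_succ) (σ (n + 1) y) - σ n y
        rw [← hσ (n + 1) y g hg, vecFactor_vecMk]
  have hstep : ∀ n (e : ↥(J • relationMaps K ρ x N n)),
      ∃ e' : ↥(J • relationMaps K ρ x N (n + 1)),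
        vecFactor k (T.anti n.le_succ) ∘ₗ e'.1 = e.1 - d • δ n := by
    intro n e
    obtain ⟨e', h, h'⟩ := T.exists_smul_relationMaps_lift x hx hN n (e.1 - d • δ n)
      (sub_mem e.2 (Submodule.smul_mem_smul hd (hδ n)))
    exact ⟨⟨e', h⟩, h'⟩
  choose next hnext using hstep
  -- The corrections solve `e (n + 1) ↦ e n - d • δ n`, starting from zero; then `d • σ n + e n` is
  -- compatible.
  let e : ∀ n, ↥(J • relationMaps K ρ x N n) := fun n ↦ Nat.rec 0 next n
  have he : ∀ n, vecFactor k (T.anti n.le_succ) ∘ₗ (e (n + 1)).1 = (e n).1 - d • δ n :=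
    fun n ↦ hnext n (e n)
  have heN : ∀ n, (e n).1 ∈ relationMaps K ρ x N n := fun n ↦
    Submodule.smul_le_right (e n).2
  refine ⟨fun n ↦ d • σ n + (e n).1, fun n ↦ ?_, fun n y hy ↦ ?_, fun n y f hf ↦ ?_⟩
  · rw [LinearMap.comp_add, he, LinearMap.comp_smul]
    simp only [δ, smul_sub]
    abel
  · rw [LinearMap.add_apply, (heN n).1 y hy, add_zero, LinearMap.smul_apply]
    have : σ n y = 0 := hσ₀ n (N + n) (Nat.le_add_left n N) y hy
    rw [this, smul_zero]
  · obtain ⟨g, hg⟩ := vecMk_surjective k _ (s (N + n) (limitEval ρ (N + n) y))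
    obtain ⟨h, hh, hh'⟩ := (heN n).2 y
    have h₁ := hs' _ _ _ hg
    have h₂ : limitEval ρ n (∑ i, g i • x i) = (b * a) • limitEval ρ n y := by
      rw [← sub_eq_zero, ← map_smul, ← map_sub] at h₁ ⊢
      exact apply_eq_zero_of_le (∑ i, g i • x i - (b * a) • y) (Nat.le_add_left n N) h₁
    have h₃ : limitEval ρ n (∑ i, h i • x i) = 0 :=
      apply_eq_zero_of_le _ (Nat.le_add_left n N) hh
    have h₄ : vecMk k (K n) (f - (d • c • g + h)) = 0 := by
      rw [map_sub, map_add, map_smul, hσ n y g hg, hh', hf, LinearMap.add_apply,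
        LinearMap.smul_apply, sub_self]
    have h₅ : limitEval ρ n (∑ i, (f - (d • c • g + h)) i • x i) = 0 := by
      rw [map_sum]
      exact Finset.sum_eq_zero fun i _ ↦ by
        rw [map_smul]
        exact T.smul_eq_zero n _ (vecMk_eq_zero.1 h₄ i) _
    let u : (Fin k → R) →ₗ[R] limitModule ρ := Fintype.linearCombination R x
    have h₆ : ∀ f, u f = ∑ i, f i • x i := fun _ ↦ rfl
    rw [← h₆] at h₂ h₃ h₅ ⊢
    rw [map_sub, map_add, map_smul, map_smul, map_sub, map_add, map_smul, map_smul, h₂, h₃,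
      add_zero, sub_eq_zero] at h₅
    rw [h₅, mul_smul d, mul_smul c]

lemma exists_limit_sections (T : IsAlmostTower J I K ρ)
    (complete : ∀ c : ℕ → R, (∀ n, c (n + 1) - c n ∈ K n) → ∃ r, ∀ n, r - c n ∈ K n)
    (separated : ∀ r, (∀ n, r ∈ K n) → r = 0) (J₀ : Ideal R) (h₀ : J₀ ≤ J) (hfg : J₀.FG) :
    ∃ (k : ℕ) (x : Fin k → limitModule ρ), ∀ ε ∈ J₀,
      ∃ t : limitModule ρ →ₗ[R] (Fin k → R), (∀ y, ∑ i, t y i • x i = ε • y) ∧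
        ∀ n y, limitEval ρ n y = 0 → ∀ i, t y i ∈ K n := by
  obtain ⟨Jt, ht, htfg, N, hN⟩ := T.tight
  -- The exponent counts the four scalars spent by `exists_compatible_sections`. Below, `Jt` is
  -- added to `J₁` so that `J * I ^ N` is contained in the ideal of uniform generation.
  obtain ⟨J₁, h₁, h₁fg, hJ₁⟩ := exists_fg_le_pow T.idem J₀ h₀ hfg 4
  obtain ⟨k, x, hx⟩ := T.exists_uniform_generators (J₁ ⊔ Jt) (sup_le h₁ ht)
    (Submodule.FG.sup h₁fg htfg)
  refine ⟨k, x, fun ε hε ↦ ?_⟩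
  let u : (Fin k → R) →ₗ[R] limitModule ρ := Fintype.linearCombination R x
  -- For fixed generators `x`, the admissible scalars form an ideal, so fourfold products of
  -- elements of `J₁` suffice.
  let A : Submodule R R :=
    { carrier := {ε | ∃ t : limitModule ρ →ₗ[R] (Fin k → R), (∀ y, u (t y) = ε • y) ∧
        ∀ n y, limitEval ρ n y = 0 → ∀ i, t y i ∈ K n}
      zero_mem' := ⟨0, by simp, by simp⟩
      add_mem' := by
        rintro a b ⟨s, hs, hs'⟩ ⟨t, ht, ht'⟩
        refine ⟨s + t, fun y ↦ ?_, fun n y hy i ↦ add_mem (hs' n y hy i) (ht' n y hy i)⟩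
        rw [LinearMap.add_apply, map_add, hs, ht, add_smul]
      smul_mem' := by
        rintro r a ⟨s, hs, hs'⟩
        refine ⟨r • s, fun y ↦ ?_, fun n y hy i ↦ (K n).mul_mem_left r (hs' n y hy i)⟩
        rw [LinearMap.smul_apply, map_smul, hs, smul_assoc] }
  suffices J₁ * (J₁ * (J₁ * J₁)) ≤ A by
    refine this (hJ₁.trans_eq ?_ hε)
    ring
  refine Submodule.mul_le.2 fun d hd z hz ↦ ?_
  refine Submodule.mul_induction_on hz (fun c hc z hz ↦ ?_) (fun a b ha hb ↦ ?_)
  · refine Submodule.mul_induction_on hz (fun b hb a ha ↦ ?_) (fun a b ha hb ↦ ?_)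
    · obtain ⟨t, ht₁, ht₂, ht₃⟩ := T.exists_compatible_sections x hx (hN.trans le_sup_right)
        (Ideal.mem_sup_left ha) (h₁ hb) (h₁ hc) (h₁ hd)
      obtain ⟨t', ht'⟩ := exists_lift_of_complete T.anti complete separated t ht₁
      refine ⟨t', fun y ↦ ?_, fun n y hy ↦ ?_⟩
      · refine Subtype.ext (funext fun n ↦ ?_)
        exact ht₃ n y _ (ht' n y)
      · rw [← vecMk_eq_zero, ht', ht₂ n y hy]
    · rw [mul_add, mul_add]
      exact A.add_mem ha hb
  · rw [mul_add]
    exact A.add_mem ha hb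

end IsAlmostTower

/-! ## Almost epimorphisms of algebras -/

section AlmostEpi

variable {V : Type u} [CommRing V] {m : Ideal V} {R S : Type u} [CommRing R] [CommRing S]
  [Algebra V R] [Algebra V S]

lemma almostIdeal_induction {p : R → Prop} (zero : p 0) (add : ∀ a b, p a → p b → p (a + b))
    (mul : ∀ ε ∈ m, ∀ r, p (algebraMap V R ε * r)) {a : R} (ha : a ∈ almostIdeal m R) : p a := by
  have ha' : a ∈ Ideal.span (algebraMap V R '' m) := ha
  refine Submodule.closure_induction (zero := zero) (add := fun a b _ _ ↦ add a b)
    (smul_mem := ?_) ha'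
  rintro r _ ⟨ε, hε, rfl⟩
  rw [smul_eq_mul, mul_comm]
  exact mul ε hε r

lemma smul_top_induction {M : Type*} [AddCommGroup M] [Module R M]
    (hM : almostIdeal m R • (⊤ : Submodule R M) = ⊤) {p : M → Prop}
    (add : ∀ x y, p x → p y → p (x + y)) (smul : ∀ ε ∈ m, ∀ x, p (algebraMap V R ε • x))
    (x : M) : p x := by
  have hx : x ∈ almostIdeal m R • (⊤ : Submodule R M) := hM.symm ▸ Submodule.mem_top (x := x)
  refine Submodule.smul_induction_on hx (fun a ha y _ ↦ ?_) add
  refine almostIdeal_induction (p := fun a ↦ p (a • y)) ?_ (fun a b ha hb ↦ ?_)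
    (fun ε hε r ↦ ?_) ha
  · rw [zero_smul, ← smul_zero (algebraMap V R 0)]
    exact smul 0 m.zero_mem 0
  · rw [add_smul]
    exact add _ _ ha hb
  · rw [mul_smul]
    exact smul ε hε _

lemma exists_fg_le_map (J₀ : Ideal R) (h₀ : J₀ ≤ almostIdeal m R) (hfg : J₀.FG) :
    ∃ m₀ : Ideal V, m₀ ≤ m ∧ m₀.FG ∧ J₀ ≤ m₀.map (algebraMap V R) := by
  induction J₀, hfg using Submodule.fg_induction with
  | singleton a =>
    simp only [Submodule.span_singleton_le_iff_mem] at h₀ ⊢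
    refine almostIdeal_induction (p := fun a ↦ ∃ m₀ : Ideal V, m₀ ≤ m ∧ m₀.FG ∧
      a ∈ m₀.map (algebraMap V R)) ⟨⊥, bot_le, Submodule.fg_bot, zero_mem _⟩ ?_ ?_ h₀
    · rintro a b ⟨A, hA, hA', hA''⟩ ⟨B, hB, hB', hB''⟩
      exact ⟨A ⊔ B, sup_le hA hB, Submodule.FG.sup hA' hB',
        add_mem (Ideal.map_mono le_sup_left hA'') (Ideal.map_mono le_sup_right hB'')⟩
    · intro ε hε r
      exact ⟨Ideal.span {ε}, (Ideal.span_singleton_le_iff_mem _).2 hε,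
        Submodule.fg_span (Set.toFinite _),
        Ideal.mul_mem_right _ _ (Ideal.mem_map_of_mem _ (Ideal.mem_span_singleton_self ε))⟩
  | sup A B _ _ hA hB =>
    obtain ⟨A', h₁, h₂, h₃⟩ := hA (le_sup_left.trans h₀)
    obtain ⟨B', h₄, h₅, h₆⟩ := hB (le_sup_right.trans h₀)
    exact ⟨A' ⊔ B', sup_le h₁ h₄, Submodule.FG.sup h₂ h₅,
      sup_le (h₃.trans (Ideal.map_mono le_sup_left)) (h₆.trans (Ideal.map_mono le_sup_right))⟩

/-- The element `1 ⊗ x` of `S ⊗ M`. -/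
def oneTmul (f : R →ₐ[V] S) (M : ModuleCat.{u} R) :
    M ⟶ (ModuleCat.restrictScalars.{u} f.toRingHom).obj
      ((ModuleCat.extendScalars.{u} f.toRingHom).obj M) :=
  (ModuleCat.extendRestrictScalarsAdj.{u} f.toRingHom).unit.app M

/-- The element `s ⊗ x` of `S ⊗ M`. -/
def pureTmul (f : R →ₐ[V] S) (M : ModuleCat.{u} R) (s : S) (x : M) :
    (ModuleCat.extendScalars.{u} f.toRingHom).obj M :=
  TensorProduct.tmul R
    (id s : (ModuleCat.restrictScalars f.toRingHom).obj (ModuleCat.of S S)) x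

lemma smul_pureTmul (f : R →ₐ[V] S) (M : ModuleCat.{u} R) (s s' : S) (x : M) :
    s • pureTmul f M s' x = pureTmul f M (s * s') x :=
  ModuleCat.ExtendScalars.smul_tmul f.toRingHom s s' x

lemma pureTmul_eq_smul (f : R →ₐ[V] S) (M : ModuleCat.{u} R) (s : S) (x : M) :
    pureTmul f M s x = s • pureTmul f M 1 x := by
  rw [smul_pureTmul, mul_one]

lemma pureTmul_add (f : R →ₐ[V] S) (M : ModuleCat.{u} R) (s : S) (x y : M) :
    pureTmul f M s (x + y) = pureTmul f M s x + pureTmul f M s y :=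
  TensorProduct.tmul_add _ _ _

lemma pureTmul_smul (f : R →ₐ[V] S) (M : ModuleCat.{u} R) (s : S) (r : R) (x : M) :
    pureTmul f M s (r • x) = pureTmul f M (f r * s) x :=
  (TensorProduct.smul_tmul r
    (id s : (ModuleCat.restrictScalars f.toRingHom).obj (ModuleCat.of S S)) x).symm

lemma extendScalars_induction (f : R →ₐ[V] S) (M : ModuleCat.{u} R)
    {p : (ModuleCat.extendScalars.{u} f.toRingHom).obj M → Prop}
    (add : ∀ x y, p x → p y → p (x + y)) (tmul : ∀ s x, p (pureTmul f M s x))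
    (z) : p z := by
  refine TensorProduct.induction_on z ?_ tmul add
  have h := tmul 0 0
  rwa [pureTmul_eq_smul, zero_smul] at h

lemma extendScalars_map_pureTmul (f : R →ₐ[V] S) {M N : ModuleCat.{u} R} (g : M ⟶ N) (s : S)
    (x : M) :
    (ModuleCat.extendScalars.{u} f.toRingHom).map g (pureTmul f M s x) = pureTmul f N s (g x) :=
  rfl

lemma extendScalars_hom_ext (f : R →ₐ[V] S) {M : ModuleCat.{u} R} {N : ModuleCat.{u} S}
    {g h : (ModuleCat.extendScalars.{u} f.toRingHom).obj M ⟶ N}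
    (H : ∀ x, g (pureTmul f M 1 x) = h (pureTmul f M 1 x)) : g = h := by
  ext x
  exact H x

/-- For an almost epimorphism `f : R → S`, a map of `R`-modules `X → Z` with `Z` killed by the
kernel of `f` almost extends to `S ⊗ X`. -/
lemma exists_almost_extension {f : R →ₐ[V] S} (hf : IsAlmostEpi m f) {X Z : ModuleCat.{u} R}
    (hZ : ∀ r, f r = 0 → ∀ z : Z, r • z = 0) (g : X ⟶ Z) {ε : V} (hε : ε ∈ m) :
    ∃ θ : (ModuleCat.restrictScalars.{u} f.toRingHom).obj
      ((ModuleCat.extendScalars.{u} f.toRingHom).obj X) ⟶ Z,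
      ∀ s r, f r = algebraMap V S ε * s → ∀ x, θ (pureTmul f X s x) = r • g x := by
  -- Any two choices of `c s` differ by an element of the kernel of `f`, which kills `Z`; hence `c s
  -- • g x` is bilinear although `c` is not additive.
  choose c hc using hf ε hε
  have key : ∀ r r', f r = f r' → ∀ z : Z, r • z = r' • z := by
    intro r r' h z
    rw [← sub_eq_zero, ← sub_smul]
    exact hZ _ (by rw [map_sub, h, sub_self]) z
  have hadd : ∀ s s' : S, f (c (s + s')) = f (c s + c s') := fun s s' ↦ by
    rw [map_add, hc, hc, hc, mul_add]
  have hmul : ∀ (r : R) (s : S), f (c (f r * s)) = f (r * c s) := fun r s ↦ by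
    rw [map_mul, hc, hc, mul_left_comm]
  let S' := (ModuleCat.restrictScalars.{u} f.toRingHom).obj (ModuleCat.of S S)
  let B : S' →ₗ[R] X →ₗ[R] Z := LinearMap.mk₂ R (fun (s : S) x ↦ c s • g x)
    (fun s s' x ↦ by
      rw [← add_smul]
      refine key _ _ ?_ _
      exact hadd s s')
    (fun r s x ↦ by
      rw [← mul_smul]
      refine key _ _ ?_ _
      exact hmul r s)
    (fun s x y ↦ by rw [map_add, smul_add])
    (fun r s x ↦ by rw [map_smul, smul_comm])
  let θ := TensorProduct.lift B
  have hθ : ∀ s r, f r = algebraMap V S ε * s → ∀ x, θ (pureTmul f X s x) = r • g x := by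
    intro s r h x
    exact key _ _ ((hc s).trans h.symm) _
  let E := (ModuleCat.restrictScalars.{u} f.toRingHom).obj
    ((ModuleCat.extendScalars.{u} f.toRingHom).obj X)
  let θ' : E →+ Z := θ.toAddMonoidHom
  refine ⟨ModuleCat.ofHom (X := E) { θ' with map_smul' := fun r z ↦ ?_ }, hθ⟩
  change θ (f r • (id z : (ModuleCat.extendScalars.{u} f.toRingHom).obj X)) = r • θ z
  refine extendScalars_induction f X (p := fun z ↦ θ (f r • z) = r • θ z)
    (fun x y hx hy ↦ ?_) (fun s x ↦ ?_) z
  · rw [smul_add]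
    refine (map_add θ _ _).trans ((congrArg₂ _ hx hy).trans ?_)
    exact (smul_add r _ _).symm.trans (congrArg (r • ·) (map_add θ x y).symm)
  · obtain ⟨t, ht⟩ := hf ε hε s
    rw [smul_pureTmul, hθ s t ht x,
      hθ (f r * s) (r * t) (by rw [map_mul, ht]; exact mul_left_comm _ _ _) x, mul_smul]

/-- When `M = mM`, almost surjectivity of `f` becomes surjectivity of `M → S ⊗ M`: one has `s ⊗ εx =
1 ⊗ rx` with `f r = εs`. -/
lemma exists_pureTmul_one_eq {f : R →ₐ[V] S} (hf : IsAlmostEpi m f) {M : ModuleCat.{u} R}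
    (hM : almostIdeal m R • (⊤ : Submodule R M) = ⊤) (z) : ∃ x, pureTmul f M 1 x = z := by
  have hadd : ∀ z w, (∃ x, pureTmul f M 1 x = z) → (∃ x, pureTmul f M 1 x = w) →
      ∃ x, pureTmul f M 1 x = z + w := by
    rintro _ _ ⟨a, rfl⟩ ⟨b, rfl⟩
    exact ⟨a + b, pureTmul_add f M 1 a b⟩
  refine extendScalars_induction f M hadd (fun s x ↦ ?_) z
  refine smul_top_induction (m := m) hM (p := fun x ↦ ∃ y, pureTmul f M 1 y = pureTmul f M s x)
    (fun x y hx hy ↦ ?_) (fun ε hε x ↦ ?_) x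
  · rw [pureTmul_add]
    exact hadd _ _ hx hy
  · obtain ⟨r, hr⟩ := hf ε hε s
    exact ⟨r • x, by rw [pureTmul_smul, pureTmul_smul, hr, f.commutes, mul_one]⟩

/-- The quotient map from `M` to `M / (ker f) M` almost extends to `S ⊗ M`, so it kills `ε • x` as
soon as `1 ⊗ x = 0`. -/
lemma smul_mem_ker_smul_top {f : R →ₐ[V] S} (hf : IsAlmostEpi m f) {M : ModuleCat.{u} R} (x : M)
    (hx : pureTmul f M 1 x = 0) {ε : V} (hε : ε ∈ m) :
    algebraMap V R ε • x ∈ RingHom.ker f • (⊤ : Submodule R M) := by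
  let N := RingHom.ker f • (⊤ : Submodule R M)
  obtain ⟨θ, hθ⟩ := exists_almost_extension hf (Z := ModuleCat.of R (M ⧸ N))
    (fun r hr z ↦ by
      obtain ⟨y, rfl⟩ := N.mkQ_surjective z
      rw [← map_smul]
      exact (Submodule.Quotient.mk_eq_zero _).2 (Submodule.smul_mem_smul hr trivial))
    (ModuleCat.ofHom N.mkQ) hε
  have h := hθ 1 (algebraMap V R ε) (by rw [f.commutes, mul_one]) x
  have h' : θ (pureTmul f M 1 x) = 0 := by
    rw [hx]
    exact map_zero θ.hom
  exact (Submodule.Quotient.mk_eq_zero _).1 ((map_smul N.mkQ _ x).trans (h.symm.trans h'))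

/-- Linearity over the target of an almost epimorphism is automatic. -/
lemma exists_restrictScalars_map_eq {f : R →ₐ[V] S} (hf : IsAlmostEpi m f) {M Z : ModuleCat.{u} S}
    (hM : almostIdeal m S • (⊤ : Submodule S M) = ⊤)
    (g : (ModuleCat.restrictScalars.{u} f.toRingHom).obj M ⟶
      (ModuleCat.restrictScalars.{u} f.toRingHom).obj Z) :
    ∃ g' : M ⟶ Z, ∀ x, g' x = g x := by
  refine ⟨ModuleCat.ofHom (X := M) (Y := Z)
    { toFun := fun x ↦ g x
      map_add' := fun x y ↦ map_add g.hom x y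
      map_smul' := fun s x ↦ ?_ }, fun x ↦ rfl⟩
  let g₀ : M → Z := g
  change g₀ (s • x) = s • g₀ x
  have hg : ∀ r (x : M), g₀ (f r • x) = f r • g₀ x := fun r x ↦ g.hom.map_smul' r x
  have hg' : ∀ x y : M, g₀ (x + y) = g₀ x + g₀ y := fun x y ↦ map_add g.hom x y
  refine smul_top_induction (m := m) hM (p := fun x ↦ g₀ (s • x) = s • g₀ x)
    (fun x y hx hy ↦ ?_) (fun ε hε x ↦ ?_) x
  · rw [smul_add, hg', hg', smul_add, hx, hy]
  · obtain ⟨r, hr⟩ := hf ε hε s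
    have h₁ := hg (algebraMap V R ε) x
    rw [f.commutes] at h₁
    rw [h₁, ← mul_smul, ← mul_smul, mul_comm s, ← hr, hg]

/-- Almost projectivity of a module over the target of an almost epimorphism `f : R → S`, tested
on modules over the source killed by the kernel of `f`. -/
lemma exists_lift_of_almostEpi [BasicSetup m] {f : R →ₐ[V] S} (hf : IsAlmostEpi m f)
    {M : ModuleCat.{u} S}
    (hM : almostIdeal m S • (⊤ : Submodule S M) = ⊤)
    (hP : ∀ (X Y : ModuleCat.{u} S) (q : X ⟶ Y), Function.Surjective q → ∀ (g : M ⟶ Y),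
      ∀ ε ∈ m, ∃ h : M ⟶ X, h ≫ q = algebraMap V S ε • g)
    (X Y : ModuleCat.{u} R) (q : X ⟶ Y) (hq : Function.Surjective q)
    (hX : ∀ r, f r = 0 → ∀ x : X, r • x = 0)
    (g : (ModuleCat.restrictScalars.{u} f.toRingHom).obj M ⟶ Y) :
    ∀ a ∈ almostIdeal m R, ∃ h : (ModuleCat.restrictScalars.{u} f.toRingHom).obj M ⟶ X,
      h ≫ q = a • g := by
  let P : Submodule R ((ModuleCat.restrictScalars.{u} f.toRingHom).obj M ⟶ Y) :=
    LinearMap.range (Linear.rightComp R _ q)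
  suffices ∀ a ∈ almostIdeal m R, a • g ∈ P from this
  rw [forall_almostIdeal]
  refine ann_of_mul m P g fun δ hδ ε hε ↦ ?_
  have hY : ∀ r, f r = 0 → ∀ y : Y, r • y = 0 := by
    intro r hr y
    obtain ⟨x, rfl⟩ := hq y
    rw [← map_smul, hX r hr, map_zero]
  -- The lifting problem is pushed to `S ⊗ X → S ⊗ Y`, where almost projectivity over `S` applies,
  -- and the solution is brought back by the maps `θ` and `η`, which invert `X → S ⊗ X` and `Y → S ⊗
  -- Y` up to `δ`.
  obtain ⟨g', hg'⟩ := exists_restrictScalars_map_eq hf hM (g ≫ oneTmul f Y)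
  obtain ⟨h, hh⟩ := hP _ _ ((ModuleCat.extendScalars.{u} f.toRingHom).map q) (by
    intro z
    refine extendScalars_induction f Y (p := fun z ↦
      ∃ x, (ModuleCat.extendScalars.{u} f.toRingHom).map q x = z) (fun x y hx hy ↦ ?_)
      (fun s y ↦ ?_) z
    · obtain ⟨a, ha⟩ := hx
      obtain ⟨b, hb⟩ := hy
      exact ⟨a + b, by rw [map_add, ha, hb]⟩
    · obtain ⟨x, rfl⟩ := hq y
      exact ⟨pureTmul f X s x, extendScalars_map_pureTmul f q s x⟩) g' ε hε
  obtain ⟨θ, hθ⟩ := exists_almost_extension hf hX (𝟙 X) hδ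
  obtain ⟨η, hη⟩ := exists_almost_extension hf hY (𝟙 Y) hδ
  have hcomm : ∀ z : (ModuleCat.extendScalars.{u} f.toRingHom).obj X, q (θ z) =
      η ((ModuleCat.extendScalars.{u} f.toRingHom).map q z) := by
    intro z
    refine extendScalars_induction f X (p := fun z ↦ q (θ z) =
      η ((ModuleCat.extendScalars.{u} f.toRingHom).map q z)) (fun x y hx hy ↦ ?_)
      (fun s x ↦ ?_) z
    · refine (congrArg q (map_add θ.hom x y)).trans ?_
      rw [map_add]
      refine (congrArg₂ _ hx hy).trans ?_
      rw [map_add]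
      exact (map_add η.hom _ _).symm
    · obtain ⟨r, hr⟩ := hf δ hδ s
      rw [extendScalars_map_pureTmul, hθ s r hr x, hη s r hr (q x), map_smul]
      rfl
  refine ⟨(ModuleCat.restrictScalars.{u} f.toRingHom).map h ≫ θ, ?_⟩
  change ((ModuleCat.restrictScalars.{u} f.toRingHom).map h ≫ θ) ≫ q = _
  ext x
  have h₁ : (ModuleCat.extendScalars.{u} f.toRingHom).map q (h x) =
      algebraMap V S ε • pureTmul f Y 1 (g x) :=
    (ConcreteCategory.congr_hom hh x).trans (congrArg (algebraMap V S ε • ·) (hg' x))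
  refine (hcomm (h x)).trans ?_
  rw [h₁, smul_pureTmul, mul_one,
    hη (algebraMap V S ε) (algebraMap V R δ * algebraMap V R ε)
      (by rw [map_mul, f.commutes, f.commutes]) (g x)]
  exact mul_smul _ _ _

end AlmostEpi

/-! ## Almost finitely generated projective modules in terms of elements -/

section Afpr

open TensorProduct

variable {V : Type u} [CommRing V] {m : Ideal V} [BasicSetup m] {R : Type u} [CommRing R]
  [Algebra V R]

lemma smul_mem_of_mul (m : Ideal V) [BasicSetup m] {M : Type*} [AddCommGroup M] [Module R M]
    (N : Submodule R M) (x : M)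
    (h : ∀ ε ∈ m, ∀ δ ∈ m, algebraMap V R ε • algebraMap V R δ • x ∈ N) :
    ∀ ε ∈ m, algebraMap V R ε • x ∈ N := by
  intro ε hε
  rw [← BasicSetup.mul_self (m := m)] at hε
  induction hε using Submodule.mul_induction_on' with
  | mem_mul_mem a ha b hb => rw [map_mul, mul_smul]; exact h a ha b hb
  | add a _ b _ ha hb => rw [map_add, add_smul]; exact N.add_mem ha hb

lemma IsFirm.exists_lift {M : ModuleCat.{u} R} (hM : IsFirm m M)
    (hP : IsAlmostProjective m ((almostFunctor m R).obj M)) (X Y : ModuleCat.{u} R) (q : X ⟶ Y)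
    (hq : Function.Surjective q) (g : M ⟶ Y) (ε : V) (hε : ε ∈ m) :
    ∃ h : M ⟶ X, h ≫ q = algebraMap V R ε • g := by
  have := ObjectProperty.SerreClassLocalization.preservesEpimorphisms
    (almostFunctor m R) (almostZero m R)
  have : Epi q := (ModuleCat.epi_iff_surjective q).2 hq
  obtain ⟨h, hh⟩ := hP ((almostFunctor m R).map q) ((almostFunctor m R).map g) ε hε
  obtain ⟨h, rfl⟩ := (hM.map_bijective X).2 h
  refine ⟨h, (hM.map_bijective Y).1 ?_⟩
  dsimp only at hh ⊢
  rw [Functor.map_comp, hh, Functor.map_smul]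

open scoped Pointwise in
-- The source need not be finitely generated, but for generators `a`, `b` of `J₁` the element `ab •
-- t` equals `(a ⊗ b) ⊗ v` with `v` in `R^k`. So the images of `(a ⊗ b) ⊗ e_i` suffice.
lemma exists_fg_of_firmTensor {J : Ideal R} {k : ℕ} {M : Type u} [AddCommGroup M] [Module R M]
    (h : FirmTensor J (Fin k → R) →ₗ[R] M) (J₁ : Ideal R) (h₁ : J₁ ≤ J) (hfg : J₁.FG) :
    ∃ U : Submodule R M, U.FG ∧ (J₁ * J₁) • LinearMap.range h ≤ U := by
  obtain ⟨G, rfl⟩ := hfg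
  have hG : ∀ a : G, (a : R) ∈ J := fun a ↦ h₁ (Ideal.subset_span a.2)
  let x : G × G × Fin k → M := fun p ↦
    h (((⟨p.1, hG p.1⟩ : J) ⊗ₜ[R] (⟨p.2.1, hG p.2.1⟩ : J)) ⊗ₜ[R] Pi.single p.2.2 1)
  refine ⟨Submodule.span R (Set.range x), Submodule.fg_span (Set.finite_range x), ?_⟩
  have hG' : (Ideal.span (G : Set R)) * Ideal.span (G : Set R) =
      Ideal.span ((G : Set R) * (G : Set R)) := Ideal.span_mul_span' _ _
  rw [hG', Submodule.smul_le]
  rintro r hr _ ⟨t, rfl⟩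
  rw [← map_smul]
  refine Submodule.span_induction (p := fun r _ ↦ h (r • t) ∈ Submodule.span R (Set.range x))
    ?_ ?_ ?_ ?_ hr
  · rintro _ ⟨a, ha, b, hb, rfl⟩
    have h₂ := mul_smul_eq_firmTensorTo (⟨a, hG ⟨a, ha⟩⟩ : J) (⟨b, hG ⟨b, hb⟩⟩ : J) t
    dsimp only at h₂ ⊢
    rw [h₂, pi_eq_sum_univ' (firmTensorTo J (Fin k → R) t), tmul_sum, map_sum]
    refine sum_mem fun i _ ↦ ?_
    rw [tmul_smul, map_smul]
    refine Submodule.smul_mem _ _ (Submodule.subset_span ⟨(⟨a, ha⟩, ⟨b, hb⟩, i), ?_⟩)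
    congr 2
  · rw [zero_smul, map_zero]
    exact zero_mem _
  · intro a b _ _ ha hb
    rw [add_smul, map_add]
    exact add_mem ha hb
  · intro a b _ hb
    rw [smul_assoc, map_smul]
    exact Submodule.smul_mem _ _ hb

lemma IsFirm.exists_fg {M : ModuleCat.{u} R} (hM : IsFirm m M)
    (hfg : IsAlmostFG m ((almostFunctor m R).obj M)) (J₀ : Ideal R)
    (h₀ : J₀ ≤ almostIdeal m R) (h₀fg : J₀.FG) :
    ∃ U : Submodule R M, U.FG ∧ J₀ • (⊤ : Submodule R M) ≤ U := by
  -- One factor of `J₁` moves `M` into the range of `h'`, and two more move that range into a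
  -- finitely generated submodule.
  obtain ⟨J₁, h₁, h₁fg, h₀₁⟩ := exists_fg_le_pow (almostIdeal_mul_self m R) J₀ h₀ h₀fg 3
  obtain ⟨m₁, hm₁, hm₁fg, hJ₁⟩ := exists_fg_le_map J₁ h₁ h₁fg
  obtain ⟨k, h, hh⟩ := hfg m₁ hm₁ hm₁fg
  let s := ModuleCat.ofHom (X := FirmTensor (almostIdeal m R) (Fin k → R)) (Y := Fin k → R)
        (firmTensorTo (almostIdeal m R) (Fin k → R))
  have hs : (almostZero m R).isoModSerre s :=
    isoModSerre_firmTensorTo m (ModuleCat.of R (Fin k → R))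
  have hF : IsFirm m (ModuleCat.of R (FirmTensor (almostIdeal m R) (Fin k → R))) :=
    isFirm_firmTensor m (ModuleCat.of R (Fin k → R))
  obtain ⟨h', hh'⟩ := (hF.map_bijective M).2 ((almostFunctor m R).map s ≫ h)
  dsimp only at hh'
  obtain ⟨U, hU, hU'⟩ := exists_fg_of_firmTensor h'.hom J₁ h₁ h₁fg
  refine ⟨U, hU, le_trans ?_ hU'⟩
  let N := LinearMap.range h'.hom
  let π : M ⟶ ModuleCat.of R (M ⧸ N) := ModuleCat.ofHom N.mkQ
  have hπ : h' ≫ π = 0 := by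
    exact ModuleCat.hom_ext (LinearMap.ext fun t ↦
      (Submodule.Quotient.mk_eq_zero _).2 ⟨t, rfl⟩)
  have hiso := Localization.inverts (almostFunctor m R) (almostZero m R).isoModSerre _ hs
  have hz : h ≫ (almostFunctor m R).map π = 0 := by
    rw [← cancel_epi ((almostFunctor m R).map s), ← Category.assoc, ← hh', ← Functor.map_comp, hπ,
      Functor.map_zero, comp_zero]
  have hε : ∀ ε ∈ m₁, algebraMap V R ε • π = 0 := by
    intro ε hε
    refine (hM.map_bijective _).1 ?_
    dsimp only
    rw [Functor.map_smul, Functor.map_zero, ← cokernel.π_desc h _ hz, ← Category.id_comp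
      (cokernel.desc h _ hz), ← Linear.comp_smul, ← Linear.smul_comp, hh ε hε, zero_comp, comp_zero]
  have hJN : J₁ • (⊤ : Submodule R M) ≤ N := by
    rw [Submodule.smul_le]
    intro a ha x _
    have ha' : a ∈ almostIdeal m₁ R := hJ₁ ha
    revert a
    intro a _ ha
    refine (forall_almostIdeal m₁ N x).2 (fun ε hε' ↦ ?_) a ha
    exact (Submodule.Quotient.mk_eq_zero _).1 (ConcreteCategory.congr_hom (hε ε hε') x)
  refine (Submodule.smul_mono_left h₀₁).trans ?_
  rw [pow_succ, sq, Submodule.mul_smul]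
  exact Submodule.smul_mono le_rfl hJN

/-- This is an almost dual basis: `δ` is the cost of finite generation, `ε` that of lifting. -/
lemma IsFirm.exists_section {M : ModuleCat.{u} R} (hM : IsFirm m M)
    (h : afpr m R ((almostFunctor m R).obj M)) {ε δ : V} (hε : ε ∈ m) (hδ : δ ∈ m) :
    ∃ (k : ℕ) (t : M ⟶ ModuleCat.of R (Fin k → R)) (x : Fin k → M),
      ∀ y, ∑ i, t y i • x i = algebraMap V R ε • algebraMap V R δ • y := by
  obtain ⟨U, hU, hU'⟩ := hM.exists_fg h.1 (Ideal.span {algebraMap V R δ})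
    ((Ideal.span_singleton_le_iff_mem _).2 (Ideal.mem_map_of_mem _ hδ))
    (Submodule.fg_span (Set.toFinite _))
  obtain ⟨k, x, rfl⟩ := Submodule.fg_iff_exists_fin_generating_family.1 hU
  let u : (Fin k → R) →ₗ[R] M := Fintype.linearCombination R x
  have hx : ∀ y : M, algebraMap V R δ • y ∈ LinearMap.range u := by
    intro y
    obtain ⟨c, hc⟩ := (Submodule.mem_span_range_iff_exists_fun R).1
      (hU' (Submodule.smul_mem_smul (Ideal.mem_span_singleton_self _)
        (Submodule.mem_top (x := y))))
    exact ⟨c, hc⟩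
  obtain ⟨t, ht⟩ := hM.exists_lift h.2 (ModuleCat.of R (Fin k → R))
    (ModuleCat.of R (LinearMap.range u)) (ModuleCat.ofHom u.rangeRestrict)
    u.surjective_rangeRestrict
    (ModuleCat.ofHom ((algebraMap V R δ • LinearMap.id).codRestrict _ hx)) ε hε
  refine ⟨k, t, x, fun y ↦ ?_⟩
  exact congrArg Subtype.val (ConcreteCategory.congr_hom ht y)

/-- The module `R^k` is projective but need not be firm. A morphism out of it is represented on a
firm replacement `F`, brought back to `R^k` by an almost inverse of `F → R^k`, and then lifted
through an epimorphism of modules representing `p`. -/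
lemma isAlmostProjective_free (k : ℕ) {X Y : AlmostMod m R} (p : X ⟶ Y) [hp : Epi p]
    (g : (almostFunctor m R).obj (ModuleCat.of R (Fin k → R)) ⟶ Y) (ε : V) (hε : ε ∈ m) :
    ∃ h, h ≫ p = algebraMap V R ε • g := by
  let P : Submodule R ((almostFunctor m R).obj (ModuleCat.of R (Fin k → R)) ⟶ Y) :=
    LinearMap.range (Linear.rightComp R _ p)
  suffices ∀ ε ∈ m, algebraMap V R ε • g ∈ P from this ε hε
  refine smul_mem_of_mul m P g fun ε hε δ hδ ↦ ?_
  rw [ObjectProperty.SerreClassLocalization.epi_iff (almostFunctor m R) (almostZero m R)] at hp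
  obtain ⟨M, N, q, hq, ⟨e⟩⟩ := hp
  obtain ⟨F, s, hF, hs⟩ := exists_firm m (ModuleCat.of R (Fin k → R))
  obtain ⟨s', hs', -⟩ := exists_almost_inverse m s hs ε δ hε hδ
  obtain ⟨f, hf⟩ := (hF.map_bijective N).2 ((almostFunctor m R).map s ≫ g ≫ e.inv.right)
  dsimp only at hf
  have : Projective (ModuleCat.of R (Fin k → R)) :=
    (IsProjective.iff_projective _).1 inferInstance
  obtain ⟨r, hr⟩ : ∃ r, r ≫ q = s' ≫ f := ⟨Projective.factorThru _ q, Projective.factorThru_comp _ _⟩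
  refine ⟨(almostFunctor m R).map r ≫ e.hom.left, ?_⟩
  change ((almostFunctor m R).map r ≫ e.hom.left) ≫ p = _
  have hw : e.hom.left ≫ p = (almostFunctor m R).map q ≫ e.hom.right := e.hom.w
  have he : e.inv.right ≫ e.hom.right = 𝟙 Y := by
    rw [← Arrow.comp_right, e.inv_hom_id]; rfl
  rw [Category.assoc, hw, ← Category.assoc, ← Functor.map_comp, hr, Functor.map_comp, hf]
  have : (almostFunctor m R).map s' ≫ (almostFunctor m R).map s =
      (algebraMap V R ε * algebraMap V R δ) • 𝟙 _ := by
    rw [← Functor.map_comp, hs', Functor.map_smul, CategoryTheory.Functor.map_id]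
  simp only [Category.assoc, he, Category.comp_id]
  rw [← Category.assoc, this, Linear.smul_comp, Category.id_comp, mul_smul]

lemma afpr_of_sections {M : ModuleCat.{u} R}
    (h : ∀ m₀ ≤ m, m₀.FG → ∃ (k : ℕ) (u : ModuleCat.of R (Fin k → R) ⟶ M), ∀ ε ∈ m₀,
      ∃ t : M ⟶ ModuleCat.of R (Fin k → R), t ≫ u = algebraMap V R ε • 𝟙 M) :
    afpr m R ((almostFunctor m R).obj M) := by
  have key : ∀ {k : ℕ} (u : ModuleCat.of R (Fin k → R) ⟶ M) (ε : V)
      (t : M ⟶ ModuleCat.of R (Fin k → R)), t ≫ u = algebraMap V R ε • 𝟙 M →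
      (almostFunctor m R).map t ≫ (almostFunctor m R).map u = algebraMap V R ε • 𝟙 _ := by
    intro k u ε t ht
    rw [← Functor.map_comp, ht, Functor.map_smul, CategoryTheory.Functor.map_id]
  refine ⟨fun m₀ h₀ hfg ↦ ?_, fun X Y p _ g ↦ ?_⟩
  · obtain ⟨k, u, hu⟩ := h m₀ h₀ hfg
    refine ⟨k, (almostFunctor m R).map u, fun ε hε ↦ ?_⟩
    obtain ⟨t, ht⟩ := hu ε hε
    rw [← cancel_epi (cokernel.π _), Linear.comp_smul, Category.comp_id, comp_zero,
      ← Category.id_comp (cokernel.π _), ← Linear.smul_comp, ← key u ε t ht, Category.assoc,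
      cokernel.condition, comp_zero]
  · let P : Submodule R ((almostFunctor m R).obj M ⟶ Y) :=
      LinearMap.range (Linear.rightComp R _ p)
    suffices ∀ ε ∈ m, algebraMap V R ε • g ∈ P from this
    refine smul_mem_of_mul m P g fun ε hε δ hδ ↦ ?_
    obtain ⟨k, u, hu⟩ := h (Ideal.span {δ}) ((Ideal.span_singleton_le_iff_mem _).2 hδ)
      (Submodule.fg_span (Set.toFinite _))
    obtain ⟨t, ht⟩ := hu δ (Ideal.mem_span_singleton_self δ)
    obtain ⟨f, hf⟩ := isAlmostProjective_free k p ((almostFunctor m R).map u ≫ g) ε hε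
    refine ⟨(almostFunctor m R).map t ≫ f, ?_⟩
    change ((almostFunctor m R).map t ≫ f) ≫ p = _
    rw [Category.assoc, hf, Linear.comp_smul, ← Category.assoc, key u δ t ht, Linear.smul_comp,
      Category.id_comp]

end Afpr

/-! ## The tower of modules over the limit algebra -/

section Tower

variable {V : Type u} [CommRing V] {m : Ideal V}
  {R : ℕ → Type u} [∀ n, CommRing (R n)] [∀ n, Algebra V (R n)]
  (φ : ∀ n, R (n + 1) →ₐ[V] R n)

lemma apply_limitProj (n : ℕ) (x : limitAlgebra φ) :
    φ n (limitProj φ (n + 1) x) = limitProj φ n x := x.2 n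

lemma toZero_limitProj (n : ℕ) (x : limitAlgebra φ) :
    toZero φ n (limitProj φ n x) = limitProj φ 0 x := by
  induction n with
  | zero => rfl
  | succ n ih =>
    rw [← ih, ← apply_limitProj φ n]
    rfl

lemma limitAlgebra_ext {x y : limitAlgebra φ} (h : ∀ n, limitProj φ n x = limitProj φ n y) :
    x = y :=
  Subtype.ext (funext h)

lemma antitone_ker_limitProj : Antitone fun n ↦ RingHom.ker (limitProj φ n) := by
  refine antitone_nat_of_succ_le fun n x hx ↦ ?_
  rw [RingHom.mem_ker] at hx ⊢
  rw [← apply_limitProj, hx, map_zero]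

lemma limitAlgebra_complete (c : ℕ → limitAlgebra φ)
    (hc : ∀ n, c (n + 1) - c n ∈ RingHom.ker (limitProj φ n)) :
    ∃ r, ∀ n, r - c n ∈ RingHom.ker (limitProj φ n) := by
  refine ⟨⟨fun n ↦ limitProj φ n (c n), fun n ↦ ?_⟩, fun n ↦ ?_⟩
  · have h := hc n
    rw [RingHom.mem_ker, map_sub, sub_eq_zero] at h
    rw [apply_limitProj, h]
  · rw [RingHom.mem_ker, map_sub, sub_eq_zero]
    rfl

lemma mem_ker_toZero_pow (n j : ℕ) {x : limitAlgebra φ}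
    (hx : x ∈ RingHom.ker (limitProj φ 0) ^ j) :
    limitProj φ n x ∈ RingHom.ker (toZero φ n) ^ j := by
  have h := Ideal.mem_map_of_mem (limitProj φ n) hx
  rw [Ideal.map_pow] at h
  refine Ideal.pow_right_mono (Ideal.map_le_iff_le_comap.2 fun y hy ↦ ?_) j h
  rw [Ideal.mem_comap, RingHom.mem_ker, toZero_limitProj]
  exact hy

variable {φ} [BasicSetup m]

/-- Restricted to the ideals `m R k` the transition maps are surjective, since `ab • r` is the image
of `a • s` when `s` lifts `b • r`. An element `ε • r` therefore extends to a thread. -/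
lemma isAlmostEpi_limitProj (epi : ∀ n, IsAlmostEpi m (φ n)) (n : ℕ) :
    IsAlmostEpi m (limitProj φ n) := by
  intro ε hε r
  have hmap : ∀ k, ∀ a ∈ almostIdeal m (R (k + 1)), φ k a ∈ almostIdeal m (R k) := by
    intro k a ha
    have := Ideal.mem_map_of_mem (φ k) ha
    rw [almostIdeal, ← AlgHom.coe_toRingHom, ← Ideal.map_coe, Ideal.map_map] at this
    convert this using 2
    · exact (φ k).comp_algebraMap.symm
    · rfl
  have hsurj : ∀ k, ∀ b ∈ almostIdeal m (R k), ∃ a ∈ almostIdeal m (R (k + 1)), φ k a = b := by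
    intro k b hb
    refine almostIdeal_induction (p := fun b ↦ ∃ a ∈ almostIdeal m (R (k + 1)), φ k a = b)
      ⟨0, zero_mem _, map_zero _⟩ ?_ (fun ε hε r ↦ ?_) hb
    · rintro _ _ ⟨a, ha, rfl⟩ ⟨b, hb, rfl⟩
      exact ⟨a + b, add_mem ha hb, map_add _ _ _⟩
    · rw [← BasicSetup.mul_self (m := m)] at hε
      induction hε using Submodule.mul_induction_on' with
      | mem_mul_mem a ha b hb =>
        obtain ⟨s, hs⟩ := epi k b hb r
        refine ⟨algebraMap V _ a * s, Ideal.mul_mem_right _ _ (Ideal.mem_map_of_mem _ ha), ?_⟩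
        rw [map_mul, hs, AlgHom.commutes, map_mul, mul_assoc]
      | add a _ b _ ha hb =>
        obtain ⟨s, hs, hs'⟩ := ha
        obtain ⟨t, ht, ht'⟩ := hb
        exact ⟨s + t, add_mem hs ht, by rw [map_add, hs', ht', map_add, add_mul]⟩
  obtain ⟨y, hy, hyn⟩ := exists_compatible_of_surjective n (X := fun k ↦ almostIdeal m (R k))
    (fun k a ↦ ⟨φ k a, hmap k a a.2⟩)
    (fun k b ↦ by
      obtain ⟨a, ha, hab⟩ := hsurj k b b.2
      exact ⟨⟨a, ha⟩, Subtype.ext hab⟩)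
    ⟨algebraMap V (R n) ε * r, Ideal.mul_mem_right _ _ (Ideal.mem_map_of_mem _ hε)⟩
  exact ⟨⟨fun k ↦ y k, fun k ↦ congrArg Subtype.val (hy k)⟩, congrArg Subtype.val hyn⟩

lemma exists_mem_pow_of_mem_ker_toZero_pow (epi : ∀ n, IsAlmostEpi m (φ n)) (n j : ℕ) :
    ∀ x ∈ RingHom.ker (toZero φ n) ^ j, ∀ ε ∈ m,
      ∃ y ∈ RingHom.ker (limitProj φ 0) ^ j, limitProj φ n y = algebraMap V (R n) ε * x := by
  induction j with
  | zero =>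
    intro x _ ε hε
    obtain ⟨y, hy⟩ := isAlmostEpi_limitProj epi n ε hε x
    exact ⟨y, by simp, hy⟩
  | succ j ih =>
    intro x hx ε hε
    rw [← BasicSetup.mul_self (m := m)] at hε
    rw [pow_succ] at hx ⊢
    induction hε using Submodule.mul_induction_on' with
    | mem_mul_mem a ha b hb =>
      refine Submodule.mul_induction_on hx (fun y hy z hz ↦ ?_) (fun y z hy hz ↦ ?_)
      · obtain ⟨s, hs, hs'⟩ := ih y hy a ha
        obtain ⟨t, ht⟩ := isAlmostEpi_limitProj epi n b hb z
        refine ⟨s * t, Ideal.mul_mem_mul hs ?_, ?_⟩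
        · rw [RingHom.mem_ker] at hz ⊢
          rw [← toZero_limitProj φ n, ht, map_mul, hz, mul_zero]
        · rw [map_mul, hs', ht, map_mul]
          ring
      · obtain ⟨s, hs, hs'⟩ := hy
        obtain ⟨t, ht, ht'⟩ := hz
        exact ⟨s + t, add_mem hs ht, by rw [map_add, hs', ht', mul_add]⟩
    | add a _ b _ ha hb =>
      obtain ⟨s, hs, hs'⟩ := ha
      obtain ⟨t, ht, ht'⟩ := hb
      exact ⟨s + t, add_mem hs ht, by rw [map_add, hs', ht', map_add, add_mul]⟩

variable (φ) in
/-- An `R n`-module as a module over the limit algebra. -/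
abbrev restrictLimit (n : ℕ) (M : ModuleCat.{u} (R n)) : ModuleCat.{u} (limitAlgebra φ) :=
  (ModuleCat.restrictScalars.{u} (limitProj φ n).toRingHom).obj M

variable {M : ∀ n, ModuleCat.{u} (R n)}
  (ψ : ∀ n, (ModuleCat.extendScalars.{u} (φ n).toRingHom).obj (M (n + 1)) ⟶ M n)

lemma map_pureTmul_smul (n : ℕ) (a : limitAlgebra φ) (x : M (n + 1)) :
    ψ n (pureTmul (φ n) (M (n + 1)) 1 (limitProj φ (n + 1) a • x)) =
      limitProj φ n a • ψ n (pureTmul (φ n) (M (n + 1)) 1 x) := by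
  rw [pureTmul_smul, apply_limitProj, ← smul_pureTmul, map_smul]

/-- The transition maps of the tower of modules attached to morphisms
`R n ⊗ M (n + 1) → M n`. -/
def towerMap (n : ℕ) : restrictLimit φ (n + 1) (M (n + 1)) →ₗ[limitAlgebra φ]
    restrictLimit φ n (M n) where
  toFun x := ψ n (pureTmul (φ n) (M (n + 1)) 1 x)
  map_add' x y := by
    refine Eq.trans ?_ (map_add (ψ n).hom _ _)
    exact congrArg (ψ n) (pureTmul_add _ _ _ _ _)
  map_smul' a x := map_pureTmul_smul ψ n a x

lemma towerMap_apply (n : ℕ) (x : M (n + 1)) :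
    towerMap ψ n x = ψ n (pureTmul (φ n) (M (n + 1)) 1 x) := rfl

lemma smul_top_restrictLimit {n : ℕ} {M : ModuleCat.{u} (R n)} (hM : IsFirm m M) :
    almostIdeal m (limitAlgebra φ) • (⊤ : Submodule (limitAlgebra φ) (restrictLimit φ n M)) =
      ⊤ := by
  rw [eq_top_iff]
  rintro x -
  refine smul_top_induction (m := m) hM.smul_top (p := fun x ↦ (id x : restrictLimit φ n M) ∈
    almostIdeal m (limitAlgebra φ) • (⊤ : Submodule (limitAlgebra φ) (restrictLimit φ n M)))
    (fun x y hx hy ↦ add_mem hx hy) (fun ε hε x ↦ ?_) x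
  have h := Submodule.smul_mem_smul (N := (⊤ : Submodule (limitAlgebra φ) (restrictLimit φ n M)))
    (Ideal.mem_map_of_mem (algebraMap V (limitAlgebra φ)) hε)
    (Submodule.mem_top (x := (id x : restrictLimit φ n M)))
  have e : algebraMap V (limitAlgebra φ) ε • (id x : restrictLimit φ n M) =
      algebraMap V (R n) ε • x :=
    congrArg (· • x) ((limitProj φ n).commutes ε)
  exact e ▸ h

/-- Condition (b) supplies both `pow_le` and `ker`. Firmness makes the transition maps surjective
and lets almost finite generation and almost projectivity be read off on elements. -/
theorem isAlmostTower (epi : ∀ n, IsAlmostEpi m (φ n))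
    (ker_le : ∀ n, AlmostLE m (RingHom.ker (φ n)) (RingHom.ker (toZero φ (n + 1)) ^ (n + 1)))
    (le_ker : ∀ n, AlmostLE m (RingHom.ker (toZero φ (n + 1)) ^ (n + 1)) (RingHom.ker (φ n)))
    (tight : IsTight m (RingHom.ker (limitProj φ 0)))
    (hM : ∀ n, IsFirm m (M n)) (hM' : ∀ n, afpr m (R n) ((almostFunctor m (R n)).obj (M n)))
    (hψ : ∀ n, IsIso (ψ n)) :
    IsAlmostTower (M := fun n ↦ restrictLimit φ n (M n)) (almostIdeal m (limitAlgebra φ))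
      (RingHom.ker (limitProj φ 0)) (fun n ↦ RingHom.ker (limitProj φ n)) (towerMap ψ) where
  idem := almostIdeal_mul_self m _
  anti := antitone_ker_limitProj φ
  pow_le n := by
    refine Ideal.mul_le.2 fun a ha x hx ↦ ?_
    refine (forall_almostIdeal m (RingHom.ker (limitProj φ n)) x).2 (fun ε hε ↦ ?_) a ha
    have h := le_ker n ε hε _ (mem_ker_toZero_pow φ (n + 1) (n + 1) hx)
    rw [RingHom.mem_ker] at h
    rw [RingHom.mem_ker, ← apply_limitProj, smul_eq_mul, map_mul, AlgHom.commutes]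
    exact h
  smul_top n := smul_top_restrictLimit (hM n)
  smul_eq_zero n r hr x := by
    have h : limitProj φ n r • (id x : M n) = 0 := by
      rw [RingHom.mem_ker.1 hr, zero_smul]
    exact h
  surj n y := by
    obtain ⟨x, hx⟩ := exists_pureTmul_one_eq (epi n) (hM (n + 1)).smul_top (inv (ψ n) y)
    refine ⟨x, (towerMap_apply ψ n x).trans ?_⟩
    rw [hx]
    exact ConcreteCategory.congr_hom (IsIso.inv_hom_id (ψ n)) y
  ker n x hx := by
    let N := RingHom.ker (limitProj φ 0) ^ (n + 1) •
      (⊤ : Submodule (limitAlgebra φ) (restrictLimit φ (n + 1) (M (n + 1))))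
    change ∀ a ∈ _, a • x ∈ N
    rw [forall_almostIdeal]
    -- Three factors are spent: `δ` to reach `ker (φ n) M (n + 1)`, `ε'` to pass to the power of the
    -- kernel of `toZero`, and `ε` to lift that power to the limit algebra.
    refine smul_mem_of_mul m N x fun ε hε δ hδ ↦ ?_
    revert ε hε
    change ∀ ε ∈ m, _
    refine smul_mem_of_mul m N _ fun ε hε ε' hε' ↦ ?_
    have h₀ : pureTmul (φ n) (M (n + 1)) 1 x = 0 := by
      have h := congrArg (inv (ψ n)) hx
      refine Eq.trans ?_ (h.trans (map_zero (inv (ψ n)).hom))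
      exact (ConcreteCategory.congr_hom (IsIso.hom_inv_id (ψ n)) _).symm
    have h₁ := smul_mem_ker_smul_top (epi n) x h₀ hδ
    let ι : M (n + 1) →+ restrictLimit φ (n + 1) (M (n + 1)) := AddMonoidHom.id (M (n + 1))
    have key : ∀ y ∈ RingHom.ker (φ n) • (⊤ : Submodule (R (n + 1)) (M (n + 1))),
        ι (algebraMap V (R (n + 1)) (ε * ε') • y) ∈ N := by
      intro y hy
      refine Submodule.smul_induction_on (p := fun y ↦
        ι (algebraMap V (R (n + 1)) (ε * ε') • y) ∈ N) hy (fun r hr z _ ↦ ?_) (fun y z hy hz ↦ ?_)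
      · obtain ⟨s, hs, hs'⟩ := exists_mem_pow_of_mem_ker_toZero_pow epi (n + 1) (n + 1) _
          (ker_le n ε' hε' r hr) ε hε
        have h₂ := Submodule.smul_mem_smul
          (N := (⊤ : Submodule (limitAlgebra φ) (restrictLimit φ (n + 1) (M (n + 1)))))
          hs (Submodule.mem_top (x := ι z))
        have e : limitProj φ (n + 1) s • z = algebraMap V (R (n + 1)) (ε * ε') • r • z := by
          rw [smul_smul, map_mul, mul_assoc, ← hs']
        rw [← e]
        exact h₂
      · rw [smul_add, map_add]
        exact add_mem hy hz
    have h₂ := key _ h₁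
    have e : algebraMap V (limitAlgebra φ) ε • algebraMap V (limitAlgebra φ) ε' •
        algebraMap V (limitAlgebra φ) δ • x = algebraMap V (R (n + 1)) (ε * ε') •
          algebraMap V (R (n + 1)) δ • (id x : M (n + 1)) := by
      rw [map_mul, mul_smul]
      rfl
    exact e ▸ h₂
  proj n X Y _ _ _ _ q hq hX g a ha := by
    obtain ⟨h, hh⟩ := exists_lift_of_almostEpi (isAlmostEpi_limitProj epi n) (hM n).smul_top
      ((hM n).exists_lift (hM' n).2) (ModuleCat.of _ X) (ModuleCat.of _ Y) (ModuleCat.ofHom q) hq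
      hX (ModuleCat.ofHom (X := restrictLimit φ n (M n)) (Y := Y) g) a ha
    exact ⟨h.hom, congrArg ModuleCat.Hom.hom hh⟩
  gen J₀ h₀ hfg := by
    -- The second factor pays for lifting coefficients from `R 0` to the limit algebra.
    obtain ⟨J₁, h₁, h₁fg, h₀₁⟩ := exists_fg_le_mul_self (almostIdeal_mul_self m _) J₀ h₀ hfg
    obtain ⟨m₁, hm₁, hm₁fg, hJ₁⟩ := exists_fg_le_map J₁ h₁ h₁fg
    obtain ⟨U, hU, hU'⟩ := (hM 0).exists_fg (hM' 0).1 (almostIdeal m₁ (R 0)) (Ideal.map_mono hm₁)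
      (hm₁fg.map _)
    obtain ⟨k, x, rfl⟩ := Submodule.fg_iff_exists_fin_generating_family.1 hU
    refine ⟨k, x, (Submodule.smul_mono_left h₀₁).trans ?_⟩
    let N := Submodule.span (limitAlgebra φ) (Set.range (fun i ↦ (id (x i) : restrictLimit φ 0 (M 0))))
    change (J₁ * J₁) • (⊤ : Submodule _ (restrictLimit φ 0 (M 0))) ≤ N
    rw [Submodule.mul_smul, Submodule.smul_le]
    intro a ha z hz
    refine (forall_almostIdeal m N z).2 (fun ε hε ↦ ?_) a (h₁ ha)
    refine Submodule.smul_induction_on (p := fun z ↦ algebraMap V (limitAlgebra φ) ε • z ∈ N) hz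
      (fun b hb y _ ↦ ?_) (fun y z hy hz ↦ by rw [smul_add]; exact add_mem hy hz)
    suffices ∀ b ∈ almostIdeal m₁ (limitAlgebra φ), b • y ∈
        N.comap (LinearMap.lsmul _ _ (algebraMap V (limitAlgebra φ) ε)) from this b (hJ₁ hb)
    rw [forall_almostIdeal]
    intro δ hδ
    have h₂ := hU' (Submodule.smul_mem_smul (Ideal.mem_map_of_mem (algebraMap V (R 0)) hδ)
      (Submodule.mem_top (x := (id y : M 0))))
    obtain ⟨c, hc⟩ := (Submodule.mem_span_range_iff_exists_fun _).1 h₂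
    choose d hd using fun i ↦ isAlmostEpi_limitProj epi 0 ε hε (c i)
    have e : algebraMap V (limitAlgebra φ) ε • algebraMap V (limitAlgebra φ) δ • y =
        ∑ i, d i • (id (x i) : restrictLimit φ 0 (M 0)) := by
      have e₁ : algebraMap V (R 0) ε • algebraMap V (R 0) δ • (id y : M 0) =
          ∑ i, limitProj φ 0 (d i) • x i := by
        rw [← hc, Finset.smul_sum]
        exact Finset.sum_congr rfl fun i _ ↦ by rw [hd, mul_smul]
      exact e₁
    change algebraMap V (limitAlgebra φ) ε • algebraMap V (limitAlgebra φ) δ • y ∈ N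
    rw [e]
    exact sum_mem fun i _ ↦ Submodule.smul_mem _ _ (Submodule.subset_span ⟨i, rfl⟩)
  tight := by
    obtain ⟨m₀, h₀, hfg, N, hN⟩ := tight
    refine ⟨_, Ideal.map_mono h₀, hfg.map _, N, Ideal.mul_le.2 fun a ha x hx ↦ ?_⟩
    exact (forall_almostIdeal m (m₀.map (algebraMap V (limitAlgebra φ))) x).2
      (fun ε hε ↦ hN ε hε x hx) a ha

end Tower

/-! ## Transitivity of extension of scalars -/

section Transitivity

variable {V : Type u} [CommRing V] {m : Ideal V} {R S T : Type u} [CommRing R] [CommRing S]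
  [CommRing T] [Algebra V R] [Algebra V S] [Algebra V T]

/-- The transitivity isomorphism `T ⊗ (S ⊗ M) ≅ T ⊗ M` for extension of scalars. -/
def extendScalarsTrans (f : R →ₐ[V] S) (g : S →ₐ[V] T) (h : R →ₐ[V] T) (hfg : g.comp f = h) :
    ModuleCat.extendScalars.{u} f.toRingHom ⋙ ModuleCat.extendScalars.{u} g.toRingHom ≅
      ModuleCat.extendScalars.{u} h.toRingHom :=
  (ModuleCat.extendScalarsComp f.toRingHom g.toRingHom).symm ≪≫ eqToIso (by subst hfg; rfl)

lemma extendScalarsTrans_apply (f : R →ₐ[V] S) (g : S →ₐ[V] T) (h : R →ₐ[V] T)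
    (hfg : g.comp f = h) (M : ModuleCat.{u} R) (x : M) :
    (extendScalarsTrans f g h hfg).hom.app M (pureTmul g _ 1 (pureTmul f M 1 x)) =
      pureTmul h M 1 x := by
  subst hfg
  have h₁ : (ModuleCat.extendScalarsComp f.toRingHom g.toRingHom).hom.app M
      (pureTmul (g.comp f) M 1 x) = pureTmul g _ 1 (pureTmul f M 1 x) :=
    ModuleCat.extendScalarsComp_hom_app_one_tmul f.toRingHom g.toRingHom M x
  rw [← h₁]
  exact ConcreteCategory.congr_hom
    ((ModuleCat.extendScalarsComp f.toRingHom g.toRingHom).hom_inv_id_app M) _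

lemma extendScalarsTrans_apply_pureTmul (f : R →ₐ[V] S) (g : S →ₐ[V] T) (h : R →ₐ[V] T)
    (hfg : g.comp f = h) (M : ModuleCat.{u} R) (s : S) (x : M) :
    (extendScalarsTrans f g h hfg).hom.app M (pureTmul g _ 1 (pureTmul f M s x)) =
      pureTmul h M (g s) x := by
  rw [pureTmul_eq_smul f, pureTmul_smul, mul_one, pureTmul_eq_smul g, map_smul,
    extendScalarsTrans_apply, ← pureTmul_eq_smul]

/-- On modules in the image of the localization functor, the abstract transitivity isomorphism
becomes that of extension of scalars, so compatibilities can be checked on pure tensors. -/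
lemma baseChangeComp_app [BasicSetup m] (f : R →ₐ[V] S) (g : S →ₐ[V] T) (h : R →ₐ[V] T)
    (hfg : g.comp f = h) (M : ModuleCat.{u} R) :
    (baseChangeComp m f g h hfg).hom.app ((almostFunctor m R).obj M) =
      (baseChange m g).map ((baseChangeFac m f).hom.app M) ≫ (baseChangeFac m g).hom.app _ ≫
        (almostFunctor m T).map ((extendScalarsTrans f g h hfg).hom.app M) ≫
          (baseChangeFac m h).inv.app M := by
  let _ : Localization.Lifting (almostFunctor m R) (almostZero m R).isoModSerre
      ((ModuleCat.extendScalars.{u} f.toRingHom ⋙ ModuleCat.extendScalars.{u} g.toRingHom) ⋙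
        almostFunctor m T) (baseChange m f ⋙ baseChange m g) :=
    ⟨(Functor.associator _ _ _).symm ≪≫ Functor.isoWhiskerRight (baseChangeFac m f) _ ≪≫
      Functor.associator _ _ _ ≪≫ Functor.isoWhiskerLeft _ (baseChangeFac m g) ≪≫
      (Functor.associator _ _ _).symm⟩
  let _ : Localization.Lifting (almostFunctor m R) (almostZero m R).isoModSerre
      (ModuleCat.extendScalars.{u} h.toRingHom ⋙ almostFunctor m T) (baseChange m h) :=
    ⟨baseChangeFac m h⟩
  refine (Localization.liftNatTrans_app (almostFunctor m R) (almostZero m R).isoModSerre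
    ((ModuleCat.extendScalars.{u} f.toRingHom ⋙ ModuleCat.extendScalars.{u} g.toRingHom) ⋙
      almostFunctor m T)
    (ModuleCat.extendScalars.{u} h.toRingHom ⋙ almostFunctor m T) (baseChange m f ⋙ baseChange m g)
    (baseChange m h) (Functor.whiskerRight (extendScalarsTrans f g h hfg).hom _) M).trans ?_
  have e : (Localization.Lifting.iso (almostFunctor m R) (almostZero m R).isoModSerre
      ((ModuleCat.extendScalars.{u} f.toRingHom ⋙ ModuleCat.extendScalars.{u} g.toRingHom) ⋙
        almostFunctor m T) (baseChange m f ⋙ baseChange m g)).hom.app M =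
      (baseChange m g).map ((baseChangeFac m f).hom.app M) ≫ (baseChangeFac m g).hom.app _ := by
    change 𝟙 _ ≫ (baseChange m g).map ((baseChangeFac m f).hom.app M) ≫ 𝟙 _ ≫
      (baseChangeFac m g).hom.app _ ≫ 𝟙 _ = _
    simp only [Category.id_comp]
    exact congrArg _ (Category.comp_id _)
  rw [e, Category.assoc]
  rfl

/-- The morphism `S ⊗ M → N` attached to a morphism `M → N` of `R`-modules. -/
def extendScalarsDesc (f : R →ₐ[V] S) {M : ModuleCat.{u} R} {N : ModuleCat.{u} S}
    (g : M ⟶ (ModuleCat.restrictScalars.{u} f.toRingHom).obj N) :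
    (ModuleCat.extendScalars.{u} f.toRingHom).obj M ⟶ N :=
  ((ModuleCat.extendRestrictScalarsAdj.{u} f.toRingHom).homEquiv M N).symm g

lemma extendScalarsDesc_apply (f : R →ₐ[V] S) {M : ModuleCat.{u} R} {N : ModuleCat.{u} S}
    (g : M ⟶ (ModuleCat.restrictScalars.{u} f.toRingHom).obj N) (x : M) :
    extendScalarsDesc f g (pureTmul f M 1 x) = g x :=
  ConcreteCategory.congr_hom
    (((ModuleCat.extendRestrictScalarsAdj.{u} f.toRingHom).homEquiv M N).apply_symm_apply g) x

end Transitivity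

/-! ## Limits of towers in the category of modules -/

section SequentialLimit

variable {S : Type u} [CommRing S] {M : ℕ → ModuleCat.{u} S} (ρ : ∀ n, M (n + 1) →ₗ[S] M n)

/-- The limit of a tower of modules, as an object of the category of modules. -/
def seqLimit : ModuleCat.{u} S := ModuleCat.of S (limitModule (M := fun n ↦ M n) ρ)

/-- The projections of the limit of a tower of modules. -/
def seqLimitEval (n : ℕ) : seqLimit ρ ⟶ M n := ModuleCat.ofHom (limitEval (M := fun n ↦ M n) ρ n)

variable {ρ}

lemma seqLimit_ext {x y : seqLimit ρ} (h : ∀ n, seqLimitEval ρ n x = seqLimitEval ρ n y) :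
    x = y :=
  Subtype.ext (funext h)

lemma apply_seqLimitEval (n : ℕ) (x : seqLimit ρ) :
    ρ n (seqLimitEval ρ (n + 1) x) = seqLimitEval ρ n x :=
  x.2 n

variable (ρ) in
/-- The morphism to the limit of a tower attached to a compatible family of morphisms. -/
def seqLimitLift {N : ModuleCat.{u} S} (g : ∀ n, N ⟶ M n)
    (hg : ∀ n x, ρ n (g (n + 1) x) = g n x) : N ⟶ seqLimit ρ :=
  ModuleCat.ofHom (Y := limitModule (M := fun n ↦ M n) ρ)
    { toFun := fun x ↦ ⟨fun n ↦ g n x, fun n ↦ hg n x⟩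
      map_add' := fun x y ↦ Subtype.ext (funext fun n ↦ map_add (g n).hom x y)
      map_smul' := fun a x ↦ Subtype.ext (funext fun n ↦ map_smul (g n).hom a x) }

end SequentialLimit

/-! ### Modules over the limit algebra and their reductions -/

section Limits

variable {V : Type u} [CommRing V] {m : Ideal V}
  {R : ℕ → Type u} [∀ n, CommRing (R n)] [∀ n, Algebra V (R n)]
  (φ : ∀ n, R (n + 1) →ₐ[V] R n)

lemma comp_limitProj (n : ℕ) : (φ n).comp (limitProj φ (n + 1)) = limitProj φ n :=
  AlgHom.ext fun x ↦ x.2 n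

/-- The `R n`-module `R n ⊗ N`, for a module `N` over the limit algebra. -/
abbrev reduction (n : ℕ) (N : ModuleCat.{u} (limitAlgebra φ)) : ModuleCat.{u} (R n) :=
  (ModuleCat.extendScalars.{u} (limitProj φ n).toRingHom).obj N

/-- The isomorphism `R n ⊗ (R (n + 1) ⊗ N) ≅ R n ⊗ N`. -/
abbrev reductionTrans (n : ℕ) (N : ModuleCat.{u} (limitAlgebra φ)) :
    (ModuleCat.extendScalars.{u} (φ n).toRingHom).obj (reduction φ (n + 1) N) ⟶ reduction φ n N :=
  (extendScalarsTrans _ _ _ (comp_limitProj φ n)).hom.app N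

/-- The transition maps of the tower of the modules `R n ⊗ N`. -/
def reductionMap (N : ModuleCat.{u} (limitAlgebra φ)) (n : ℕ) :
    restrictLimit φ (n + 1) (reduction φ (n + 1) N) →ₗ[limitAlgebra φ]
      restrictLimit φ n (reduction φ n N) :=
  towerMap (φ := φ) (M := fun n ↦ reduction φ n N) (fun n ↦ reductionTrans φ n N) n

lemma reductionMap_pureTmul (n : ℕ) (N : ModuleCat.{u} (limitAlgebra φ)) (s : R (n + 1))
    (x : N) :
    reductionMap φ N n (pureTmul (limitProj φ (n + 1)) N s x) =
      pureTmul (limitProj φ n) N (φ n s) x :=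
  extendScalarsTrans_apply_pureTmul _ _ _ (comp_limitProj φ n) N s x

variable {φ} in
lemma map_reductionMap {N : ModuleCat.{u} (limitAlgebra φ)} {k : ℕ}
    {t : N ⟶ ModuleCat.of (limitAlgebra φ) (Fin k → limitAlgebra φ)}
    {τ : ∀ n, reduction φ n N ⟶ ModuleCat.of (R n) (Fin k → R n)}
    (hτ : ∀ n s y i, τ n (pureTmul (limitProj φ n) N s y) i = s * limitProj φ n (t y i))
    (n : ℕ) (z : reduction φ (n + 1) N) (i : Fin k) :
    τ n (reductionMap φ N n z) i = φ n (τ (n + 1) z i) := by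
  refine extendScalars_induction (limitProj φ (n + 1)) N (p := fun z ↦
    τ n (reductionMap φ N n z) i = φ n (τ (n + 1) z i))
    (fun y z hy hz ↦ ?_) (fun s y ↦ ?_) z
  · have h₁ : reductionMap φ N n (y + z) = _ + _ := map_add (reductionMap φ N n) y z
    have h₂ := congrFun (map_add (τ n).hom (reductionMap φ N n y) (reductionMap φ N n z)) i
    have h₃ := congrFun (map_add (τ (n + 1)).hom y z) i
    refine Eq.trans ?_ (congrArg (φ n) h₃).symm
    rw [h₁]
    refine h₂.trans ?_
    exact (congrArg₂ _ hy hz).trans (map_add (φ n) _ _).symm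
  · have h₁ := congrArg (φ n) (hτ (n + 1) s y i)
    rw [map_mul, apply_limitProj] at h₁
    have h₂ := congrArg (fun w ↦ τ n w i) (reductionMap_pureTmul φ n N s y)
    exact (h₂.trans (hτ n _ y i)).trans h₁.symm

variable {φ} in
lemma sum_smul_eq_of_sections {N : ModuleCat.{u} (limitAlgebra φ)} {k : ℕ} {c : V}
    {t : N ⟶ ModuleCat.of (limitAlgebra φ) (Fin k → limitAlgebra φ)} {x : Fin k → N}
    (hx : ∀ y, ∑ i, t y i • x i = algebraMap V (limitAlgebra φ) c • y) {n : ℕ}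
    {τ : reduction φ n N ⟶ ModuleCat.of (R n) (Fin k → R n)}
    (hτ : ∀ s y i, τ (pureTmul (limitProj φ n) N s y) i = s * limitProj φ n (t y i))
    (w : reduction φ n N) :
    ∑ i, pureTmul (limitProj φ n) N (τ w i) (x i) = algebraMap V (R n) c • w := by
  refine extendScalars_induction (limitProj φ n) N (p := fun w ↦
    ∑ i, pureTmul (limitProj φ n) N (τ w i) (x i) = algebraMap V (R n) c • w)
    (fun v w hv hw ↦ ?_) (fun s y ↦ ?_) w
  · rw [smul_add, ← hv, ← hw, ← Finset.sum_add_distrib]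
    refine Finset.sum_congr rfl fun i _ ↦ ?_
    have h := congrFun (map_add τ.hom v w) i
    refine (congrArg (fun s ↦ pureTmul (limitProj φ n) N s (x i)) h).trans ?_
    rw [pureTmul_eq_smul, pureTmul_eq_smul _ _ (τ v i), pureTmul_eq_smul _ _ (τ w i), ← add_smul]
    rfl
  · have h := congrArg (fun z ↦ pureTmul (limitProj φ n) N s z) (hx y)
    dsimp only at h
    rw [pureTmul_smul, AlgHom.commutes, ← smul_pureTmul] at h
    rw [← h]
    refine (Finset.sum_congr rfl fun i _ ↦ ?_).trans
      (map_sum (AddMonoidHom.mk' (fun z ↦ pureTmul (limitProj φ n) N s z)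
        (pureTmul_add (limitProj φ n) N s)) _ _).symm
    refine Eq.trans ?_ (pureTmul_smul _ _ _ _ _).symm
    exact congrArg (fun s ↦ pureTmul (limitProj φ n) N s (x i)) ((hτ s y i).trans (mul_comm _ _))

/-- The limit of the modules `R n ⊗ N`. -/
abbrev completion (N : ModuleCat.{u} (limitAlgebra φ)) : ModuleCat.{u} (limitAlgebra φ) :=
  seqLimit (M := fun n ↦ restrictLimit φ n (reduction φ n N)) (reductionMap φ N)

/-- The projection of the limit of the modules `R n ⊗ N`. -/
def completionEval (N : ModuleCat.{u} (limitAlgebra φ)) (n : ℕ) (x : completion φ N) :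
    reduction φ n N :=
  seqLimitEval (M := fun n ↦ restrictLimit φ n (reduction φ n N)) (reductionMap φ N) n x

variable {φ} in
lemma completionEval_smul {N : ModuleCat.{u} (limitAlgebra φ)} (n : ℕ) (a : limitAlgebra φ)
    (x : completion φ N) :
    completionEval φ N n (a • x) = limitProj φ n a • completionEval φ N n x := rfl

/-- The map from a module over the limit algebra to the limit of its reductions. -/
def toCompletion (N : ModuleCat.{u} (limitAlgebra φ)) : N ⟶ completion φ N :=
  seqLimitLift (M := fun n ↦ restrictLimit φ n (reduction φ n N)) (reductionMap φ N)
    (fun n ↦ oneTmul (limitProj φ n) N) fun n x ↦ by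
      refine (reductionMap_pureTmul φ n N 1 x).trans ?_
      rw [map_one]
      rfl

lemma completionEval_toCompletion (N : ModuleCat.{u} (limitAlgebra φ)) (n : ℕ) (x : N) :
    completionEval φ N n (toCompletion φ N x) = pureTmul (limitProj φ n) N 1 x := rfl

lemma reductionMap_completionEval (N : ModuleCat.{u} (limitAlgebra φ)) (n : ℕ)
    (x : completion φ N) :
    reductionMap φ N n (completionEval φ N (n + 1) x) = completionEval φ N n x :=
  apply_seqLimitEval (M := fun n ↦ restrictLimit φ n (reduction φ n N)) n x

variable {φ} in
lemma completion_ext {N : ModuleCat.{u} (limitAlgebra φ)} {x y : completion φ N}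
    (h : ∀ n, completionEval φ N n x = completionEval φ N n y) : x = y :=
  seqLimit_ext h

variable [BasicSetup m]

/-- Reduce an almost dual basis `t`, `x` to every `R n`. If all `1 ⊗ y` vanish, then `t y = 0`, so
`Σ t_i(y) x_i`, a multiple of `y`, is zero. Conversely, for a thread `y` the coordinates of its
components are threads `z i` in the limit algebra, and `Σ z_i x_i` maps to a multiple of `y`. -/
lemma isoModSerre_toCompletion {N : ModuleCat.{u} (limitAlgebra φ)} (hN : IsFirm m N)
    (hN' : afpr m _ ((almostFunctor m _).obj N)) :
    (almostZero m (limitAlgebra φ)).isoModSerre (toCompletion φ N) := by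
  have key : ∀ ε ∈ m, ∀ δ ∈ m,
      (∀ x, toCompletion φ N x = 0 → algebraMap V (limitAlgebra φ) (ε * δ) • x = 0) ∧
      ∀ y, ∃ x, toCompletion φ N x = algebraMap V (limitAlgebra φ) (ε * δ) • y := by
    intro ε hε δ hδ
    obtain ⟨k, t, x, hx⟩ := hN.exists_section hN' hε hδ
    simp_rw [smul_smul, ← map_mul] at hx
    let α : ∀ n, N ⟶ restrictLimit φ n (ModuleCat.of (R n) (Fin k → R n)) := fun n ↦
      ModuleCat.ofHom (Y := restrictLimit φ n (ModuleCat.of (R n) (Fin k → R n)))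
        { toFun := fun y i ↦ limitProj φ n (t y i)
          map_add' := fun y z ↦ funext fun i ↦ by
            rw [map_add]
            exact map_add (limitProj φ n) _ _
          map_smul' := fun a y ↦ funext fun i ↦ by
            rw [map_smul]
            exact map_mul (limitProj φ n) _ _ }
    let τ : ∀ n, reduction φ n N ⟶ ModuleCat.of (R n) (Fin k → R n) := fun n ↦
      extendScalarsDesc _ (α n)
    have hτ : ∀ n s y i, τ n (pureTmul (limitProj φ n) N s y) i = s * limitProj φ n (t y i) := by
      intro n s y i
      have h := congrFun (extendScalarsDesc_apply (limitProj φ n) (α n) y) i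
      rw [pureTmul_eq_smul, map_smul]
      exact congrArg (s * ·) h
    clear_value τ
    refine ⟨fun y hy ↦ ?_, fun y ↦ ?_⟩
    · rw [← hx]
      refine Finset.sum_eq_zero fun i _ ↦ ?_
      have : t y i = 0 := by
        refine limitAlgebra_ext φ fun n ↦ ?_
        have h₁ : pureTmul (limitProj φ n) N 1 y = 0 := by
          rw [← completionEval_toCompletion, hy]
          rfl
        have h₂ := hτ n 1 y i
        rw [h₁, map_zero, one_mul] at h₂
        rw [map_zero]
        exact h₂.symm
      rw [this, zero_smul]
    · let z : Fin k → limitAlgebra φ := fun i ↦ ⟨fun n ↦ τ n (completionEval φ N n y) i, fun n ↦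
        (map_reductionMap hτ n _ i).symm.trans
          (congrArg (fun w ↦ τ n w i) (reductionMap_completionEval φ N n y))⟩
      have hz : ∀ n i, limitProj φ n (z i) = τ n (completionEval φ N n y) i := fun n i ↦ rfl
      clear_value z
      refine ⟨∑ i, z i • x i, completion_ext fun n ↦ ?_⟩
      rw [completionEval_smul, AlgHom.commutes, ← sum_smul_eq_of_sections hx (hτ n),
        completionEval_toCompletion]
      refine (map_sum (AddMonoidHom.mk' (fun z ↦ pureTmul (limitProj φ n) N 1 z)
        (pureTmul_add (limitProj φ n) N 1)) _ _).trans (Finset.sum_congr rfl fun i _ ↦ ?_)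
      refine (pureTmul_smul _ _ _ _ _).trans ?_
      rw [mul_one, hz]
  rw [isoModSerre_iff_elem]
  refine ⟨fun x hx ↦ ?_, fun y ↦ ?_⟩
  · exact smul_mem_of_mul m (⊥ : Submodule (limitAlgebra φ) N) x fun ε hε δ hδ ↦ by
      rw [smul_smul, ← map_mul]
      exact (key ε hε δ hδ).1 x hx
  · exact smul_mem_of_mul m (LinearMap.range (toCompletion φ N).hom) y fun ε hε δ hδ ↦ by
      rw [smul_smul, ← map_mul]
      exact (key ε hε δ hδ).2 y

end Limits

lemma exists_pureTmul_one_eq_smul {V : Type u} [CommRing V] {m : Ideal V} {R S : Type u}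
    [CommRing R] [CommRing S] [Algebra V R] [Algebra V S] {f : R →ₐ[V] S} (hf : IsAlmostEpi m f)
    {M : ModuleCat.{u} R} {ε : V} (hε : ε ∈ m) (z) :
    ∃ x, pureTmul f M 1 x = algebraMap V S ε • z := by
  refine extendScalars_induction f M (p := fun z ↦ ∃ x, pureTmul f M 1 x = algebraMap V S ε • z)
    (fun x y hx hy ↦ ?_) (fun s x ↦ ?_) z
  · obtain ⟨a, ha⟩ := hx
    obtain ⟨b, hb⟩ := hy
    exact ⟨a + b, by rw [pureTmul_add, ha, hb, smul_add]⟩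
  · obtain ⟨r, hr⟩ := hf ε hε s
    exact ⟨r • x, by rw [pureTmul_smul, hr, smul_pureTmul, mul_one]⟩

/-! ### The limit of a tower and its comparison with the tower -/

section LimitOfTower

variable {V : Type u} [CommRing V] {m : Ideal V} [BasicSetup m]
  {R : ℕ → Type u} [∀ n, CommRing (R n)] [∀ n, Algebra V (R n)]
  {φ : ∀ n, R (n + 1) →ₐ[V] R n} {M : ∀ n, ModuleCat.{u} (R n)}
  (ψ : ∀ n, (ModuleCat.extendScalars.{u} (φ n).toRingHom).obj (M (n + 1)) ⟶ M n)

/-- The limit of the tower of modules attached to morphisms `R n ⊗ M (n + 1) → M n`. -/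
abbrev towerLimit : ModuleCat.{u} (limitAlgebra φ) :=
  seqLimit (M := fun n ↦ restrictLimit φ n (M n)) (towerMap ψ)

/-- The projections of the limit of a tower. -/
def towerLimitEval (n : ℕ) : towerLimit ψ ⟶ restrictLimit φ n (M n) :=
  seqLimitEval (M := fun n ↦ restrictLimit φ n (M n)) (towerMap ψ) n

/-- The comparison morphism `R n ⊗ L → M n` for the limit `L` of the tower. -/
def towerLimitComparison (n : ℕ) : reduction φ n (towerLimit ψ) ⟶ M n :=
  extendScalarsDesc (limitProj φ n) (towerLimitEval ψ n)

lemma towerLimitComparison_pureTmul (n : ℕ) (x : towerLimit ψ) :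
    towerLimitComparison ψ n (pureTmul (limitProj φ n) _ 1 x) = towerLimitEval ψ n x :=
  extendScalarsDesc_apply (limitProj φ n) (towerLimitEval ψ n) x

lemma towerLimitComparison_comp (n : ℕ) :
    (ModuleCat.extendScalars.{u} (φ n).toRingHom).map (towerLimitComparison ψ (n + 1)) ≫ ψ n =
      reductionTrans φ n (towerLimit ψ) ≫ towerLimitComparison ψ n := by
  refine extendScalars_hom_ext (φ n) fun z ↦ ?_
  refine extendScalars_induction (limitProj φ (n + 1)) (towerLimit ψ) (p := fun z ↦
    ((ModuleCat.extendScalars.{u} (φ n).toRingHom).map (towerLimitComparison ψ (n + 1)) ≫ ψ n)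
      (pureTmul (φ n) _ 1 z) = (reductionTrans φ n (towerLimit ψ) ≫ towerLimitComparison ψ n)
      (pureTmul (φ n) _ 1 z)) (fun x y hx hy ↦ ?_) (fun s x ↦ ?_) z
  · rw [pureTmul_add, map_add, map_add, hx, hy]
  · rw [pureTmul_eq_smul (limitProj φ (n + 1)), pureTmul_smul, mul_one, pureTmul_eq_smul (φ n) _ (φ n s), map_smul, map_smul]
    congr 1
    have h₁ := congrArg (ψ n) ((extendScalars_map_pureTmul (φ n) (towerLimitComparison ψ (n + 1)) 1
      (pureTmul (limitProj φ (n + 1)) _ 1 x)).trans (congrArg (pureTmul (φ n) (M (n + 1)) 1)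
        (towerLimitComparison_pureTmul ψ (n + 1) x)))
    have h₂ := congrArg (towerLimitComparison ψ n)
      (extendScalarsTrans_apply _ _ _ (comp_limitProj φ n) (towerLimit ψ) x)
    refine Eq.trans h₁ (Eq.trans ?_ h₂.symm)
    rw [towerLimitComparison_pureTmul]
    exact apply_seqLimitEval (M := fun n ↦ restrictLimit φ n (M n)) n x

variable {ψ}
  (T : IsAlmostTower (M := fun n ↦ restrictLimit φ n (M n)) (almostIdeal m (limitAlgebra φ))
      (RingHom.ker (limitProj φ 0)) (fun n ↦ RingHom.ker (limitProj φ n)) (towerMap ψ))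
include T

omit [BasicSetup m] in
lemma exists_towerLimit_sections (m₀ : Ideal V) (h₀ : m₀ ≤ m) (hfg : m₀.FG) :
    ∃ (k : ℕ) (x : Fin k → towerLimit ψ), ∀ ε ∈ m₀,
      ∃ t : towerLimit ψ ⟶ ModuleCat.of _ (Fin k → limitAlgebra φ),
        (∀ y, ∑ i, t y i • x i = algebraMap V (limitAlgebra φ) ε • y) ∧
        ∀ n y, towerLimitEval ψ n y = 0 → ∀ i, limitProj φ n (t y i) = 0 := by
  obtain ⟨k, x, hx⟩ := T.exists_limit_sections (limitAlgebra_complete φ)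
    (fun r hr ↦ limitAlgebra_ext φ fun n ↦ (hr n).trans (map_zero _).symm)
    (m₀.map (algebraMap V (limitAlgebra φ))) (Ideal.map_mono h₀) (hfg.map _)
  refine ⟨k, x, fun ε hε ↦ ?_⟩
  obtain ⟨t, ht, ht'⟩ := hx _ (Ideal.mem_map_of_mem _ hε)
  exact ⟨ModuleCat.ofHom (X := towerLimit ψ) t, ht, ht'⟩

lemma afpr_towerLimit : afpr m _ ((almostFunctor m _).obj (towerLimit ψ)) := by
  refine afpr_of_sections fun m₀ h₀ hfg ↦ ?_
  obtain ⟨k, x, hx⟩ := exists_towerLimit_sections T m₀ h₀ hfg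
  refine ⟨k, ModuleCat.ofHom (Fintype.linearCombination (limitAlgebra φ) x), fun ε hε ↦ ?_⟩
  obtain ⟨t, ht, -⟩ := hx ε hε
  exact ⟨t, ModuleCat.hom_ext (LinearMap.ext ht)⟩

/-- Up to a factor, an element of the kernel is `1 ⊗ y` with `y` vanishing in degree `n`. The
sections then have coordinates `t_i(y)` in the kernel of the projection to `R n`, so `ε ⊗ y = Σ
t_i(y) ⊗ x_i = 0`. Surjectivity up to `m` holds because the limit surjects onto `M n`. -/
lemma isoModSerre_towerLimitComparison (epi : ∀ n, IsAlmostEpi m (φ n)) (n : ℕ) :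
    (almostZero m (R n)).isoModSerre (towerLimitComparison ψ n) := by
  rw [isoModSerre_iff_elem]
  refine ⟨fun z hz ↦ ?_, fun y ε hε ↦ ?_⟩
  · refine smul_mem_of_mul m (⊥ : Submodule (R n) (reduction φ n (towerLimit ψ))) z
      fun ε hε δ hδ ↦ ?_
    obtain ⟨y, hy⟩ := exists_pureTmul_one_eq_smul (isAlmostEpi_limitProj epi n) hδ z
    obtain ⟨k, x, hx⟩ := exists_towerLimit_sections T (Ideal.span {ε})
      ((Ideal.span_singleton_le_iff_mem m).2 hε) (Submodule.fg_span (Set.toFinite _))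
    obtain ⟨t, ht, ht'⟩ := hx ε (Ideal.mem_span_singleton_self ε)
    have hy₀ : towerLimitEval ψ n y = 0 := by
      rw [← towerLimitComparison_pureTmul, hy, map_smul, hz]
      exact smul_zero (A := M n) _
    have h : algebraMap V (R n) ε • pureTmul (limitProj φ n) (towerLimit ψ) 1 y = 0 := by
      rw [smul_pureTmul, ← AlgHom.commutes (limitProj φ n), ← pureTmul_smul, ← ht]
      refine (map_sum (AddMonoidHom.mk' (fun z ↦ pureTmul (limitProj φ n) (towerLimit ψ) 1 z)
        (pureTmul_add (limitProj φ n) _ 1)) _ _).trans (Finset.sum_eq_zero fun i _ ↦ ?_)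
      refine (pureTmul_smul _ _ _ _ _).trans ?_
      rw [ht' n y hy₀, zero_mul, pureTmul_eq_smul, zero_smul]
    rw [Submodule.mem_bot, ← hy]
    exact h
  · obtain ⟨x, hx⟩ := T.limitEval_surjective n y
    refine ⟨algebraMap V (R n) ε • pureTmul (limitProj φ n) _ 1 x, ?_⟩
    rw [map_smul]
    exact congrArg _ ((towerLimitComparison_pureTmul ψ n x).trans hx)

end LimitOfTower

/-! ### Compatibilities of base change with localization -/

section BaseChange

variable {V : Type u} [CommRing V] {m : Ideal V} [BasicSetup m] {R S T : Type u} [CommRing R]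
  [CommRing S] [CommRing T] [Algebra V R] [Algebra V S] [Algebra V T]

lemma afpr_of_iso {X Y : AlmostMod m R} (e : X ≅ Y) (hX : afpr m R X) : afpr m R Y := by
  refine ⟨fun m₀ h₀ hfg ↦ ?_, fun A B p _ g ε hε ↦ ?_⟩
  · obtain ⟨k, h, hh⟩ := hX.1 m₀ h₀ hfg
    refine ⟨k, h ≫ e.hom, fun ε hε ↦ ?_⟩
    have hz : h ≫ e.hom ≫ cokernel.π (h ≫ e.hom) = 0 := by
      rw [← Category.assoc, cokernel.condition]
    rw [← cancel_epi (cokernel.π (h ≫ e.hom)), ← cancel_epi e.hom, Linear.comp_smul,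
      Category.comp_id, comp_zero, comp_zero, Linear.comp_smul, ← cokernel.π_desc h _ hz,
      ← Linear.smul_comp, ← Category.comp_id (cokernel.π h), ← Linear.comp_smul, hh ε hε,
      comp_zero, zero_comp]
  · obtain ⟨h, hh⟩ := hX.2 p (e.hom ≫ g) ε hε
    exact ⟨e.inv ≫ h, by rw [Category.assoc, hh, Linear.comp_smul, e.inv_hom_id_assoc]⟩

variable (m) in
lemma baseChangeFac_naturality (f : R →ₐ[V] S) {M N : ModuleCat.{u} R} (a : M ⟶ N) :
    (baseChange m f).map ((almostFunctor m R).map a) ≫ (baseChangeFac m f).hom.app N =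
      (baseChangeFac m f).hom.app M ≫
        (almostFunctor m S).map ((ModuleCat.extendScalars.{u} f.toRingHom).map a) :=
  (baseChangeFac m f).hom.naturality a

variable (m) in
lemma baseChangeComp_app_comp (f : R →ₐ[V] S) (g : S →ₐ[V] T) (h : R →ₐ[V] T)
    (hfg : g.comp f = h) (M : ModuleCat.{u} R) :
    (baseChangeComp m f g h hfg).hom.app ((almostFunctor m R).obj M) ≫
        (baseChangeFac m h).hom.app M =
      (baseChange m g).map ((baseChangeFac m f).hom.app M) ≫ (baseChangeFac m g).hom.app _ ≫
        (almostFunctor m T).map ((extendScalarsTrans f g h hfg).hom.app M) := by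
  rw [baseChangeComp_app, Category.assoc, Category.assoc, Category.assoc]
  congr 2
  refine (congrArg _ ((baseChangeFac m h).inv_hom_id_app M)).trans (Category.comp_id _)

end BaseChange

/-! ## Base change to the tower is fully faithful -/

section FullyFaithful

variable {V : Type u} [CommRing V] {m : Ideal V} [BasicSetup m]
  {R : ℕ → Type u} [∀ n, CommRing (R n)] [∀ n, Algebra V (R n)]
  {φ : ∀ n, R (n + 1) →ₐ[V] R n} {M N : ModuleCat.{u} (limitAlgebra φ)}

lemma completionEval_map (a : M ⟶ N) (n : ℕ) (x : M) :
    completionEval φ N n (toCompletion φ N (a x)) =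
      (ModuleCat.extendScalars.{u} (limitProj φ n).toRingHom).map a
        (pureTmul (limitProj φ n) M 1 x) := rfl

lemma eq_of_reduction_map_eq (hM : IsFirm m M) (hN : IsFirm m N)
    (hN' : afpr m _ ((almostFunctor m _).obj N)) {a b : M ⟶ N}
    (h : ∀ n, (ModuleCat.extendScalars.{u} (limitProj φ n).toRingHom).map a =
      (ModuleCat.extendScalars.{u} (limitProj φ n).toRingHom).map b) : a = b := by
  refine (hM _ (isoModSerre_toCompletion φ hN hN')).1 (ModuleCat.hom_ext (LinearMap.ext fun x ↦ ?_))
  refine completion_ext fun n ↦ ?_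
  exact (completionEval_map a n x).trans ((ConcreteCategory.congr_hom (h n) _).trans
    (completionEval_map b n x).symm)

/-- The family `γ` is a morphism from `M` to the completion of `N`, and firmness of `M` lifts it
through the almost isomorphism from `N` to its completion. -/
lemma exists_reduction_map_eq (hM : IsFirm m M) (hN : IsFirm m N)
    (hN' : afpr m _ ((almostFunctor m _).obj N))
    (γ : ∀ n, reduction φ n M ⟶ reduction φ n N)
    (hγ : ∀ n, (ModuleCat.extendScalars.{u} (φ n).toRingHom).map (γ (n + 1)) ≫
      reductionTrans φ n N = reductionTrans φ n M ≫ γ n) :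
    ∃ a : M ⟶ N, ∀ n, (ModuleCat.extendScalars.{u} (limitProj φ n).toRingHom).map a = γ n := by
  let g : M ⟶ completion φ N :=
    seqLimitLift (M := fun n ↦ restrictLimit φ n (reduction φ n N)) (reductionMap φ N)
      (fun n ↦ oneTmul (limitProj φ n) M ≫
        (ModuleCat.restrictScalars.{u} (limitProj φ n).toRingHom).map (γ n)) fun n x ↦
      (ConcreteCategory.congr_hom (hγ n) (pureTmul (φ n) _ 1 (pureTmul (limitProj φ (n + 1)) M 1 x))
        ).trans (congrArg (γ n) (extendScalarsTrans_apply _ _ _ (comp_limitProj φ n) M x))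
  obtain ⟨a, ha⟩ := (hM _ (isoModSerre_toCompletion φ hN hN')).2 g
  refine ⟨a, fun n ↦ extendScalars_hom_ext _ fun x ↦ ?_⟩
  exact congrArg (completionEval φ N n) (ConcreteCategory.congr_hom ha x)

lemma eq_of_baseChange_map_eq {X Y : AlmostMod m (limitAlgebra φ)} (hY : afpr m _ Y) {f g : X ⟶ Y}
    (h : ∀ n, (baseChange m (limitProj φ n)).map f = (baseChange m (limitProj φ n)).map g) :
    f = g := by
  obtain ⟨M, hM, ⟨e⟩⟩ := exists_firm_iso m X
  obtain ⟨N, hN, ⟨e'⟩⟩ := exists_firm_iso m Y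
  obtain ⟨a, ha⟩ := (hM.map_bijective N).2 (e.hom ≫ f ≫ e'.inv)
  obtain ⟨b, hb⟩ := (hM.map_bijective N).2 (e.hom ≫ g ≫ e'.inv)
  dsimp only at ha hb
  have hab : a = b := by
    refine eq_of_reduction_map_eq hM hN (afpr_of_iso e'.symm hY) fun n ↦ ?_
    refine ((hM.extendScalars (limitProj φ n)).map_bijective _).1 ?_
    dsimp only
    rw [← cancel_epi ((baseChangeFac m (limitProj φ n)).hom.app M), ← baseChangeFac_naturality,
      ← baseChangeFac_naturality, ha, hb]
    simp only [Functor.map_comp, h]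
  rw [hab, hb] at ha
  rwa [cancel_epi, cancel_mono, eq_comm] at ha

/-- Reductions of firm modules are firm, so both the `g n` and their compatibilities come from
linear maps, and the question becomes one about modules. -/
lemma exists_map_eq_of_firm (hM : IsFirm m M) (hN : IsFirm m N)
    (hN' : afpr m _ ((almostFunctor m _).obj N))
    (g : ∀ n, (baseChange m (limitProj φ n)).obj ((almostFunctor m _).obj M) ⟶
      (baseChange m (limitProj φ n)).obj ((almostFunctor m _).obj N))
    (hg : ∀ n, (baseChange m (φ n)).map (g (n + 1)) ≫
        (baseChangeComp m _ _ _ (comp_limitProj φ n)).hom.app _ =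
      (baseChangeComp m _ _ _ (comp_limitProj φ n)).hom.app _ ≫ g n) :
    ∃ a : M ⟶ N, ∀ n, (baseChange m (limitProj φ n)).map ((almostFunctor m _).map a) = g n := by
  choose γ hγ using fun n ↦ ((hM.extendScalars (limitProj φ n)).map_bijective
    (reduction φ n N)).2 ((baseChangeFac m (limitProj φ n)).inv.app M ≫ g n ≫
      (baseChangeFac m (limitProj φ n)).hom.app N)
  dsimp only at hγ
  have hγ' : ∀ n, (baseChangeFac m (limitProj φ n)).hom.app M ≫ (almostFunctor m _).map (γ n) =
      g n ≫ (baseChangeFac m (limitProj φ n)).hom.app N := by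
    intro n
    rw [hγ]
    exact (baseChangeFac m (limitProj φ n)).hom_inv_id_app_assoc M _
  obtain ⟨a, ha⟩ := exists_reduction_map_eq hM hN hN' γ fun n ↦ by
    refine (((hM.extendScalars (limitProj φ (n + 1))).extendScalars (φ n)).map_bijective _).1 ?_
    dsimp only
    rw [← cancel_epi ((baseChangeFac m (φ n)).hom.app _),
      ← cancel_epi ((baseChange m (φ n)).map ((baseChangeFac m (limitProj φ (n + 1))).hom.app M))]
    rw [Functor.map_comp, Functor.map_comp, ← Category.assoc ((baseChangeFac m (φ n)).hom.app _),
      ← baseChangeFac_naturality, Category.assoc, ← Category.assoc, ← Functor.map_comp, hγ',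
      Functor.map_comp, Category.assoc, ← baseChangeComp_app_comp, ← Category.assoc, hg,
      Category.assoc, ← hγ', ← Category.assoc, baseChangeComp_app_comp]
    simp only [Category.assoc]
  refine ⟨a, fun n ↦ ?_⟩
  rw [← cancel_mono ((baseChangeFac m (limitProj φ n)).hom.app N), baseChangeFac_naturality, ha, hγ']

lemma exists_baseChange_map_eq {X Y : AlmostMod m (limitAlgebra φ)} (hY : afpr m _ Y)
    (g : ∀ n, (baseChange m (limitProj φ n)).obj X ⟶ (baseChange m (limitProj φ n)).obj Y)
    (hg : ∀ n, (baseChange m (φ n)).map (g (n + 1)) ≫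
        (baseChangeComp m _ _ _ (comp_limitProj φ n)).hom.app Y =
      (baseChangeComp m _ _ _ (comp_limitProj φ n)).hom.app X ≫ g n) :
    ∃ f : X ⟶ Y, ∀ n, (baseChange m (limitProj φ n)).map f = g n := by
  obtain ⟨M, hM, ⟨e⟩⟩ := exists_firm_iso m X
  obtain ⟨N, hN, ⟨e'⟩⟩ := exists_firm_iso m Y
  obtain ⟨a, ha⟩ := exists_map_eq_of_firm hM hN (afpr_of_iso e'.symm hY)
    (fun n ↦ (baseChange m (limitProj φ n)).map e.hom ≫ g n ≫
      (baseChange m (limitProj φ n)).map e'.inv) fun n ↦ by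
    have h₁ := (baseChangeComp m _ _ _ (comp_limitProj φ n)).hom.naturality e.hom
    have h₂ := (baseChangeComp m _ _ _ (comp_limitProj φ n)).hom.naturality e'.inv
    dsimp only [Functor.comp_map] at h₁ h₂
    rw [Functor.map_comp, Functor.map_comp, Category.assoc, Category.assoc, h₂, ← Category.assoc
      ((baseChange m (φ n)).map (g (n + 1))), hg, ← Category.assoc, ← Category.assoc, h₁]
    simp only [Category.assoc]
  refine ⟨e.inv ≫ (almostFunctor m _).map a ≫ e'.hom, fun n ↦ ?_⟩
  rw [Functor.map_comp, Functor.map_comp, ha, Category.assoc, Category.assoc, ← Functor.map_comp,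
    e'.inv_hom_id, CategoryTheory.Functor.map_id, Category.comp_id, ← Category.assoc,
    ← Functor.map_comp, e.inv_hom_id, CategoryTheory.Functor.map_id, Category.id_comp]

end FullyFaithful

/-! ## Descent from the tower -/

section Equivalence

variable {V : Type u} [CommRing V] {m : Ideal V} [BasicSetup m]
  {R : ℕ → Type u} [∀ n, CommRing (R n)] [∀ n, Algebra V (R n)]
  {φ : ∀ n, R (n + 1) →ₐ[V] R n}

lemma IsFirm.exists_isIso {A : Type u} [CommRing A] [Algebra V A] {M N : ModuleCat.{u} A}
    (hM : IsFirm m M) (hN : IsFirm m N)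
    (e : (almostFunctor m A).obj M ≅ (almostFunctor m A).obj N) :
    ∃ f : M ⟶ N, IsIso f ∧ (almostFunctor m A).map f = e.hom := by
  obtain ⟨f, hf⟩ := (hM.map_bijective N).2 e.hom
  obtain ⟨g, hg⟩ := (hN.map_bijective M).2 e.inv
  dsimp only at hf hg
  refine ⟨f, ⟨g, (hM.map_bijective M).1 ?_, (hN.map_bijective N).1 ?_⟩, hf⟩
  · dsimp only
    rw [Functor.map_comp, hf, hg, e.hom_inv_id, CategoryTheory.Functor.map_id]
  · dsimp only
    rw [Functor.map_comp, hf, hg, e.inv_hom_id, CategoryTheory.Functor.map_id]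

/-- A compatible system of almost finitely generated projective modules comes from a module over
the limit algebra. -/
lemma exists_baseChange_iso (epi : ∀ n, IsAlmostEpi m (φ n))
    (ker_le : ∀ n, AlmostLE m (RingHom.ker (φ n)) (RingHom.ker (toZero φ (n + 1)) ^ (n + 1)))
    (le_ker : ∀ n, AlmostLE m (RingHom.ker (toZero φ (n + 1)) ^ (n + 1)) (RingHom.ker (φ n)))
    (tight : IsTight m (RingHom.ker (limitProj φ 0)))
    (X : ∀ n, AlmostMod m (R n)) (hX : ∀ n, afpr m (R n) (X n))
    (α : ∀ n, (baseChange m (φ n)).obj (X (n + 1)) ≅ X n) :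
    ∃ (Y : AlmostMod m (limitAlgebra φ)) (_ : afpr m _ Y)
      (c : ∀ n, (baseChange m (limitProj φ n)).obj Y ≅ X n),
      ∀ n, (baseChange m (φ n)).map (c (n + 1)).hom ≫ (α n).hom =
        (baseChangeComp m _ _ _ (comp_limitProj φ n)).hom.app Y ≫ (c n).hom := by
  choose M hM e using fun n ↦ exists_firm_iso m (X n)
  replace e := fun n ↦ (e n).some
  -- Both `R n ⊗ M (n + 1)` and `M n` are firm, so the structure isomorphisms are induced by
  -- isomorphisms of modules, and the system becomes an honest tower.
  choose ψ hψ hψ' using fun n ↦ ((hM (n + 1)).extendScalars (φ n)).exists_isIso (hM n)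
    (((baseChangeFac m (φ n)).app (M (n + 1))).symm ≪≫ (baseChange m (φ n)).mapIso (e (n + 1)) ≪≫
      α n ≪≫ (e n).symm)
  have T := isAlmostTower ψ epi ker_le le_ker tight hM
    (fun n ↦ afpr_of_iso (e n).symm (hX n)) hψ
  refine ⟨(almostFunctor m _).obj (towerLimit ψ), afpr_towerLimit T, fun n ↦
    (baseChangeFac m (limitProj φ n)).app (towerLimit ψ) ≪≫
      Localization.isoOfHom (almostFunctor m (R n)) (almostZero m (R n)).isoModSerre
        (towerLimitComparison ψ n) (isoModSerre_towerLimitComparison T epi n) ≪≫ e n, fun n ↦ ?_⟩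
  have h₁ : (baseChangeFac m (φ n)).hom.app (M (n + 1)) ≫ (almostFunctor m _).map (ψ n) ≫
      (e n).hom = (baseChange m (φ n)).map (e (n + 1)).hom ≫ (α n).hom := by
    rw [hψ']
    simp only [Iso.trans_hom, Iso.symm_hom, Functor.mapIso_hom, Category.assoc,
      Iso.inv_hom_id, Category.comp_id]
    exact (baseChangeFac m (φ n)).hom_inv_id_app_assoc (M (n + 1)) _
  have h₂ := congrArg (almostFunctor m _).map (towerLimitComparison_comp ψ n)
  rw [Functor.map_comp, Functor.map_comp] at h₂
  simp only [Iso.trans_hom, Iso.app_hom, Localization.isoOfHom_hom, Functor.map_comp,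
    Category.assoc]
  rw [← h₁, ← Category.assoc ((baseChange m (φ n)).map ((almostFunctor m _).map _)),
    baseChangeFac_naturality, Category.assoc, ← Category.assoc ((almostFunctor m _).map _)
      ((almostFunctor m _).map _), h₂, ← Category.assoc
      ((baseChangeComp m _ _ _ (comp_limitProj φ n)).hom.app _), baseChangeComp_app_comp]
  simp only [Category.assoc]

variable (φ)

lemma faithful_afprToTwoLimit : (afprToTwoLimit m φ).Faithful where
  map_injective {X Y f g} h := by
    refine ObjectProperty.hom_ext _ (eq_of_baseChange_map_eq Y.property fun n ↦ ?_)
    exact congrArg (fun h : (afprToTwoLimit m φ).obj X ⟶ (afprToTwoLimit m φ).obj Y ↦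
      (TwoLimit.Hom.app h n).hom) h

lemma full_afprToTwoLimit : (afprToTwoLimit m φ).Full where
  map_surjective {X Y} g := by
    obtain ⟨f, hf⟩ := exists_baseChange_map_eq (X := X.obj) Y.property
      (fun n ↦ (TwoLimit.Hom.app g n).hom)
      fun n ↦ congrArg (afpr m (R n)).ι.map (TwoLimit.Hom.comm g n)
    exact ⟨ObjectProperty.homMk f, TwoLimit.Hom.ext (funext fun n ↦
      ObjectProperty.hom_ext _ (hf n))⟩

variable {φ}

lemma essSurj_afprToTwoLimit (epi : ∀ n, IsAlmostEpi m (φ n))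
    (ker_le : ∀ n, AlmostLE m (RingHom.ker (φ n)) (RingHom.ker (toZero φ (n + 1)) ^ (n + 1)))
    (le_ker : ∀ n, AlmostLE m (RingHom.ker (toZero φ (n + 1)) ^ (n + 1)) (RingHom.ker (φ n)))
    (tight : IsTight m (RingHom.ker (limitProj φ 0))) : (afprToTwoLimit m φ).EssSurj where
  mem_essImage X := by
    obtain ⟨Y, hY, c, hc⟩ := exists_baseChange_iso epi ker_le le_ker tight
      (fun n ↦ (X.obj n).obj) (fun n ↦ (X.obj n).property)
      (fun n ↦ (afpr m (R n)).ι.mapIso (X.iso n))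
    let c' : ∀ n, ((afprToTwoLimit m φ).obj ⟨Y, hY⟩).obj n ≅ X.obj n := fun n ↦
      (afpr m (R n)).isoMk (c n)
    have hc' : ∀ n, (afprBaseChange m (φ n)).map (c' (n + 1)).hom ≫ (X.iso n).hom =
        (((afprToTwoLimit m φ).obj ⟨Y, hY⟩).iso n).hom ≫ (c' n).hom := fun n ↦
      ObjectProperty.hom_ext _ (hc n)
    refine ⟨⟨Y, hY⟩, ⟨⟨⟨fun n ↦ (c' n).hom, hc'⟩, ⟨fun n ↦ (c' n).inv, fun n ↦ ?_⟩, ?_, ?_⟩⟩⟩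
    · rw [Iso.eq_comp_inv, Category.assoc, ← hc', ← Category.assoc, ← Functor.map_comp,
        Iso.inv_hom_id, CategoryTheory.Functor.map_id, Category.id_comp]
    · exact TwoLimit.Hom.ext (funext fun n ↦ (c' n).hom_inv_id)
    · exact TwoLimit.Hom.ext (funext fun n ↦ (c' n).inv_hom_id)

end Equivalence

end AlmostRing

end

theorem mainTheorem11 {V : Type u} [CommRing V] (m : Ideal V) [AlmostRing.BasicSetup m]
    {R : ℕ → Type u} [∀ n, CommRing (R n)] [∀ n, Algebra V (R n)]
    (φ : ∀ n, R (n + 1) →ₐ[V] R n)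
    (epi : ∀ n, AlmostRing.IsAlmostEpi m (φ n))
    (ker_le : ∀ n, AlmostRing.AlmostLE m (RingHom.ker (φ n))
      (RingHom.ker (AlmostRing.toZero φ (n + 1)) ^ (n + 1)))
    (le_ker : ∀ n, AlmostRing.AlmostLE m
      (RingHom.ker (AlmostRing.toZero φ (n + 1)) ^ (n + 1)) (RingHom.ker (φ n)))
    (tight : AlmostRing.IsTight m (RingHom.ker (AlmostRing.limitProj φ 0))) :
    (AlmostRing.afprToTwoLimit m φ).IsEquivalence where
  faithful := AlmostRing.faithful_afprToTwoLimit φ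
  full := AlmostRing.full_afprToTwoLimit φ
  essSurj := AlmostRing.essSurj_afprToTwoLimit epi ker_le le_ker tight
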